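/- **Setting.** Let $K$ be a non-archimedean local field with ring of integers $\mathcal{O}_K$, maximal ideal $\mathfrak{p}_K$, uniformiser $\varpi_K$, residue field of order $q_K$ and normalised absolute value $|\cdot|$ (so $|\varpi_K| = q_K^{-1}$). Let $L$ be an étale $K$-algebra of degree $2$ (a separable quadratic field extension or $K \times K$), and let $\mathcal{O}_L$ be the integral closure of $\mathcal{O}_K$ in $L$. Let $\psi : L \to \mathbb{C}^\times$ be a continuous additive character that is trivial on $K$ and on $\mathcal{O}_L$, but not on any larger fractional ideal of $\mathcal{O}_L$. Write $H = \mathrm{GL}_2(K) \subset G = \mathrm{GL}_2(L)$, let $Z_H$ be the centre of $H$, and let $N_H$ be the upper triangular unipotent subgroup of $H$. Let $\pi$ be a generic irreducible smooth complex representation of $G$ (for instance a unitary and tempered one), let $\mathcal{W}(\pi)$ be its Whittaker model with respect to $\psi$, and let $\chi = \omega_\pi|_{K^\times}$ be the restriction of its central character. For an ideal $\mathfrak{a}$ of $\mathcal{O}_L$ put $K_1(\mathfrak{a}) = \{ g \in \mathrm{GL}_2(\mathcal{O}_L) : g \equiv \begin{pmatrix} * & * \\ 0 & 1 \end{pmatrix}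 \bmod \mathfrak{a} \}$. The conductor $\mathfrak{c}$ of $\pi$ is the largest ideal $\mathfrak{a}$ of $\mathcal{O}_L$ such that $\pi$ has non-zero $K_1(\mathfrak{a})$-invariants, and the normalised new vector $W^{\mathrm{new}}$ is the generator of the line of $K_1(\mathfrak{c})$-invariants in $\mathcal{W}(\pi)$ with $W^{\mathrm{new}}(1) = 1$. We say that $\pi$ is unramified if it has non-zero $\mathrm{GL}_2(\mathcal{O}_L)$-invariants, and ramified otherwise. Let $\mathrm{d}^\times a$ be the Haar measure on $K^\times$ with $\mathrm{vol}(\mathcal{O}_K^\times) = 1$, and let $\mathrm{d}h$ be the right $H$-invariant measure on $Z_H N_H \backslash H$ for which the image of $\mathrm{GL}_2(\mathcal{O}_K)$ has volume $1$. For $W \in \mathcal{W}(\pi)$ and a locally constant, compactly supported function $\Phi$ on $K^2$ put $$ Z(W; s) = \int_{K^\times} W\left( \begin{pmatrix} x & 0 \\ 0 & 1 \end{pmatrix} \right) |x|^{s-1}\, \mathrm{d}^\times x, \qquad f^{\Phi}(h; \chi, s) = |\det h|^s \int_{K^\times} \Phi((0, a) h)\, \chi(a) |a|^{2s}\, \mathrm{d}^\times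 a, $$ $$ Z(W, \Phi; s) = \int_{Z_H N_H \backslash H} W(h)\, f^{\Phi}(h; \chi, s)\, \mathrm{d}h, $$ where the integrals are taken for $\mathrm{Re}(s) \gg 0$, and $Z(W; s)$ and $Z(W, \Phi; s)$ are then continued meromorphically, as rational functions of $q_K^{-s}$. Let $\Phi_0$ be the characteristic function of $\mathcal{O}_K^2$, and for $r \ge 1$ let $$ \Phi_r = (q_K^2 - 1)\, q_K^{2r-2} \cdot \mathrm{ch}(\mathfrak{p}_K^r \times (1 + \mathfrak{p}_K^r)). $$ The imprimitive Asai $L$-factor is $$ L^{\mathrm{imp}}_{\mathrm{As}}(\pi, s) = \begin{cases} Z(W^{\mathrm{new}}; s) & \text{if } \pi \text{ is ramified}, \\ L(\chi, 2s) \cdot Z(W^{\mathrm{new}}; s) & \text{if } \pi \text{ is unramified}, \end{cases} $$ where $L(\chi, 2s) = (1 - \chi(\varpi_K) q_K^{-2s})^{-1}$ if $\chi$ is unramified, and $L(\chi, 2s) = 1$ otherwise. **Proposition.** Let $r_0 \ge 0$ be the integer such that $\varpi_K^{r_0}$ generates $\mathfrak{c} \cap \mathcal{O}_K$. The integrals defining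 $Z(W^{\mathrm{new}}; s)$ and, for $r = r_0$ and, if $r_0 \ge 1$, for every $r \ge r_0$, those defining $Z(W^{\mathrm{new}}, \Phi_r; s)$ converge absolutely for $\mathrm{Re}(s) \gg 0$ and have meromorphic continuation as rational functions of $q_K^{-s}$. We have $$ L^{\mathrm{imp}}_{\mathrm{As}}(\pi, s) = Z(W^{\mathrm{new}}, \Phi_{r_0}; s), $$ and if $r_0 \ge 1$, then $L^{\mathrm{imp}}_{\mathrm{As}}(\pi, s) = Z(W^{\mathrm{new}}, \Phi_r; s)$ for every $r \ge r_0$. -/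

import Mathlib

open MeasureTheory Matrix ValuativeRel Polynomial
open scoped MatrixGroups

noncomputable section

namespace AsaiZeta

/-! ### The local field `K` -/

section LocalField

variable (K : Type*) [Field K] [ValuativeRel K] [TopologicalSpace K] [IsNonarchimedeanLocalField K]

/-- The order `q_K` of the residue field of `K`. -/
def resCard : ℕ := Nat.card 𝓀[K]

variable {K} in
/-- The normalised absolute value on `K`: `|ϖ| = q_K⁻¹` for a uniformiser `ϖ`. -/
def normAbs (x : K) : ℝ :=
  open Classical in
  if x = 0 then 0 else
    (resCard K : ℝ) ^
      (WithZero.log (IsNonarchimedeanLocalField.valueGroupWithZeroIsoInt K (valuation K x)))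

/-- A uniformiser `ϖ_K` of `K`, as an element of `𝒪[K]`. -/
def uniformiser : 𝒪[K] := Classical.choose (IsDiscreteValuationRing.exists_irreducible 𝒪[K])

lemma uniformiser_irreducible : Irreducible (uniformiser K) :=
  Classical.choose_spec (IsDiscreteValuationRing.exists_irreducible 𝒪[K])

/-- The uniformiser `ϖ_K` as an element of `Kˣ`. -/
def uniformiserUnit : Kˣ :=
  Units.mk0 (uniformiser K : K) fun h =>
    (uniformiser_irreducible K).ne_zero (Subtype.ext h)

variable {K} in
lemma resCard_pos : 0 < resCard K := Nat.card_pos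

variable {K} in
lemma normAbs_pos {x : K} (hx : x ≠ 0) : 0 < normAbs x := by
  rw [normAbs, if_neg hx]
  exact zpow_pos (by exact_mod_cast resCard_pos) _

variable {K} in
lemma normAbs_mul (x y : K) : normAbs (x * y) = normAbs x * normAbs y := by
  by_cases hx : x = 0
  · simp [normAbs, hx]
  by_cases hy : y = 0
  · simp [normAbs, hy]
  have hq : (resCard K : ℝ) ≠ 0 := by exact_mod_cast (resCard_pos (K := K)).ne'
  rw [normAbs, normAbs, normAbs, if_neg hx, if_neg hy, if_neg (mul_ne_zero hx hy), map_mul, map_mul,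
    WithZero.log_mul (by simpa using hx) (by simpa using hy), zpow_add₀ hq]

lemma normAbs_uniformiser : normAbs (uniformiser K : K) = (resCard K : ℝ)⁻¹ := by
  have hirr := uniformiser_irreducible K
  have h0 : (uniformiser K : K) ≠ 0 := fun h => hirr.ne_zero (Subtype.ext h)
  rw [normAbs, if_neg h0]
  set e := IsNonarchimedeanLocalField.valueGroupWithZeroIsoInt K
  have key : e (valuation K (uniformiser K : K)) = WithZero.exp (-1) := by
    apply le_antisymm
    · have h1 : valuation K (uniformiser K : K) < 1 := by
        refine lt_of_le_of_ne (uniformiser K).2 fun h => hirr.not_isUnit ?_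
        exact (Valuation.Integers.isUnit_iff_valuation_eq_one
          (Valuation.integer.integers (valuation K))).mpr h
      have h2 : e (valuation K (uniformiser K : K)) < 1 := by
        rw [← map_one e]
        exact e.toOrderIso.lt_iff_lt.mpr h1
      have h3 : e (valuation K (uniformiser K : K)) ≠ 0 := by simpa using h0
      rw [← WithZero.log_le_iff_le_exp h3]
      have := (WithZero.log_lt_iff_lt_exp h3 (a := 0)).mpr (by simpa using h2)
      omega
    · obtain ⟨y, hy⟩ := ValuativeRel.valuation_surjective (e.symm (WithZero.exp (-1)))
      have hy1 : e (valuation K y) = WithZero.exp (-1) := by rw [hy]; simp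
      have hy2 : valuation K y < 1 := by
        refine e.toOrderIso.lt_iff_lt.mp ?_
        change e _ < e _
        rw [hy1, map_one, ← WithZero.exp_zero, WithZero.exp_lt_exp]; norm_num
      have hm : (⟨y, hy2.le⟩ : 𝒪[K]) ∈ 𝓂[K] := by
        rw [IsLocalRing.mem_maximalIdeal, mem_nonunits_iff]
        intro hu
        have := (Valuation.Integers.isUnit_iff_valuation_eq_one
          (Valuation.integer.integers (valuation K))).mp hu
        exact hy2.ne this
      rw [hirr.maximalIdeal_eq, Ideal.mem_span_singleton] at hm
      obtain ⟨c, hc⟩ := hm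
      have hc' : y = (uniformiser K : K) * c := congrArg Subtype.val hc
      rw [← hy1]
      refine e.toOrderIso.monotone ?_
      rw [hc', map_mul]
      exact mul_le_of_le_one_right' c.2
  rw [key]; simp

/-- `x ∈ 𝔭_K ^ r`, for `x ∈ K`. -/
def MemPow (r : ℕ) (x : K) : Prop := ∃ y : 𝒪[K], y ∈ 𝓂[K] ^ r ∧ (y : K) = x

instance : T1Space K := by
  let := IsTopologicalAddGroup.rightUniformSpace K
  have := isUniformAddGroup_of_addCommGroup (G := K)
  infer_instance

/-- The units `𝒪_K^×`, as a subset of `Kˣ`. -/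
def unitSet : Set Kˣ := {u | valuation K (u : K) = 1}

/-- The Haar measure `d^× a` on `Kˣ` giving `𝒪_K^×` volume `1`. -/
def mulHaar [MeasurableSpace Kˣ] [BorelSpace Kˣ] : Measure Kˣ :=
  (Measure.haar (unitSet K))⁻¹ • Measure.haar

instance [MeasurableSpace Kˣ] [BorelSpace Kˣ] : (mulHaar K).IsMulLeftInvariant := by
  unfold mulHaar; infer_instance

/-- The special function `Φ_r` on `K²`: the function
`(q_K² - 1) q_K^{2r-2} ch(𝔭_K^r, 1 + 𝔭_K^r)` if `r ≥ 1`, and `ch(𝒪_K, 𝒪_K)` if `r = 0`. -/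
def specialPhi (r : ℕ) (x : Fin 2 → K) : ℂ :=
  open Classical in
  if r = 0 then
    if MemPow K 0 (x 0) ∧ MemPow K 0 (x 1) then 1 else 0
  else
    if MemPow K r (x 0) ∧ MemPow K r (x 1 - 1) then
      ((resCard K : ℂ) ^ 2 - 1) * (resCard K : ℂ) ^ (2 * r - 2) else 0

/-- For a character `χ` of `Kˣ`, the `L`-factor `L(χ, 2s)`, as a rational function of
`X = q_K^{-s}`: it is `(1 - χ(ϖ_K) X²)⁻¹` if `χ` is unramified, and `1` otherwise. -/
def lFactorTwo (χ : Kˣ →* ℂˣ) : RatFunc ℂ :=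
  open Classical in
  if ∀ u ∈ unitSet K, χ u = 1 then
    (1 - RatFunc.C (χ (uniformiserUnit K) : ℂ) * RatFunc.X ^ 2)⁻¹
  else 1

/-- The subgroup `Z_H N_H` of `H = GL₂(K)`: the matrices `(z x; 0 z)`. -/
def centreUnipotent : Subgroup (GL (Fin 2) K) where
  carrier := {g | g 1 0 = 0 ∧ g 0 0 = g 1 1}
  one_mem' := by simp
  mul_mem' := by
    rintro a b ⟨ha, ha'⟩ ⟨hb, hb'⟩
    simp [Matrix.mul_apply, Fin.sum_univ_two, ha, hb, ha', hb']
  inv_mem' := by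
    rintro a ⟨ha, ha'⟩
    simp [Matrix.inv_def, Matrix.adjugate_fin_two, ha, ha']

/-- The space of cosets `Z_H N_H \ H`, with the quotient topology. -/
def CosetSpace : Type _ := Quotient (QuotientGroup.rightRel (centreUnipotent K))

instance : TopologicalSpace (CosetSpace K) :=
  inferInstanceAs (TopologicalSpace (Quotient (QuotientGroup.rightRel (centreUnipotent K))))

instance : MeasurableSpace (CosetSpace K) := borel _

instance : BorelSpace (CosetSpace K) := ⟨rfl⟩

variable {K} in
/-- The projection `H → Z_H N_H \ H`. -/
def toCoset (h : GL (Fin 2) K) : CosetSpace K := Quotient.mk _ h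

variable {K} in
/-- Right translation by `g` on `Z_H N_H \ H`. -/
def rightTranslate (g : GL (Fin 2) K) : CosetSpace K → CosetSpace K :=
  Quotient.map (· * g) fun a b hab => by
    have hab' := QuotientGroup.rightRel_apply.mp hab
    exact QuotientGroup.rightRel_apply.mpr (by simpa [mul_assoc] using hab')

/-- The subgroup `K_H = GL₂(𝒪_K)` of `H`. -/
def maxCompact : Subgroup (GL (Fin 2) K) :=
  (Matrix.GeneralLinearGroup.map (n := Fin 2) (algebraMap 𝒪[K] K)).range

variable {K} in
/-- `μ` is the `H`-invariant measure `dh` on `Z_H N_H \ H` with the unramified normalisation,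
i.e. the image of `GL₂(𝒪_K)` has volume `1`. (This is the quotient of the Haar measures on `H` and
`Z_H N_H` giving volume `1` to `GL₂(𝒪_K)` and to its intersection with `Z_H N_H`.) -/
structure IsUnramifiedInvariant (μ : Measure (CosetSpace K)) : Prop where
  invariant : ∀ g : GL (Fin 2) K, μ.map (rightTranslate g) = μ
  normalised : μ (toCoset '' (maxCompact K : Set (GL (Fin 2) K))) = 1

end LocalField

/-! ### Meromorphic continuation as a rational function of `q^{-s}` -/

/-- Let `I` be a function given by an integral, absolutely convergent at those `s` with `conv s`.
Then `R(q^{-s})` is the meromorphic continuation of `I`: the integral converges absolutely and is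
equal to `R(q^{-s})` for all `s` in some right half-plane. -/
def IsContinuation (q : ℕ) (conv : ℂ → Prop) (I : ℂ → ℂ) (R : RatFunc ℂ) : Prop :=
  ∃ σ : ℝ, ∀ s : ℂ, σ < s.re →
    conv s ∧ R.denom.eval ((q : ℂ) ^ (-s)) ≠ 0 ∧
      I s = R.eval (RingHom.id ℂ) ((q : ℂ) ^ (-s))

/-- The rational function `R` for which `R(q^{-s})` is the meromorphic continuation of `I`
(it is unique; the value is `0` if there is none). -/
def continuation (q : ℕ) (conv : ℂ → Prop) (I : ℂ → ℂ) : RatFunc ℂ :=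
  open Classical in
  if h : ∃ R, IsContinuation q conv I R then h.choose else 0

/-! ### Representations of `G = GL₂(L)` and their Whittaker models -/

section Representation

variable {K : Type*} [Field K] [ValuativeRel K] [TopologicalSpace K] [IsNonarchimedeanLocalField K]
variable (K) (L : Type*) [CommRing L] [Algebra K L]

/-- The ring of integers `𝒪_L`: the integral closure of `𝒪_K` in `L`. -/
abbrev intRing : Subalgebra 𝒪[K] L := integralClosure 𝒪[K] L

/-- The inclusion `GL₂(𝒪_L) → GL₂(L)`. -/
def intMap : GL (Fin 2) (intRing K L) →* GL (Fin 2) L :=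
  Matrix.GeneralLinearGroup.map (n := Fin 2) (algebraMap (intRing K L) L)

/-- The inclusion `H = GL₂(K) → G = GL₂(L)`. -/
def inclH : GL (Fin 2) K →* GL (Fin 2) L :=
  Matrix.GeneralLinearGroup.map (n := Fin 2) (algebraMap K L)

variable {L} in
/-- The set `K_1(𝔞)` of those `g ∈ GL₂(𝒪_L)` with `g ≡ (* *; 0 1) mod 𝔞`, inside `GL₂(L)`. -/
def K1 (𝔞 : Ideal (intRing K L)) : Set (GL (Fin 2) L) :=
  {g | ∃ k : GL (Fin 2) (intRing K L), k 1 0 ∈ 𝔞 ∧ k 1 1 - 1 ∈ 𝔞 ∧ intMap K L k = g}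

variable {L} in
/-- `ψ` is unramified: it is trivial on `𝒪_L`, but not on any larger fractional ideal. -/
structure IsUnramifiedChar (ψ : AddChar L ℂ) : Prop where
  trivial_on_integers : ∀ x : intRing K L, ψ (x : L) = 1
  nontrivial_on_larger : ∀ I : Submodule (intRing K L) L, 1 < I → ∃ x ∈ I, ψ x ≠ 1

variable {L} {V : Type*} [AddCommGroup V] [Module ℂ V]

/-- A representation of `GL₂(L)` is smooth if all vectors have open stabilisers. -/
def IsSmooth [TopologicalSpace L] (π : Representation ℂ (GL (Fin 2) L) V) : Prop :=
  ∀ v : V, IsOpen {g : GL (Fin 2) L | π g v = v}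

/-- The vectors of `π` that are invariant under the elements of `S`. -/
def invariants (π : Representation ℂ (GL (Fin 2) L) V) (S : Set (GL (Fin 2) L)) :
    Submodule ℂ V where
  carrier := {v | ∀ g ∈ S, π g v = v}
  add_mem' ha hb g hg := by rw [map_add, ha g hg, hb g hg]
  zero_mem' g _ := map_zero _
  smul_mem' c v hv g hg := by rw [map_smul, hv g hg]

/-- The conductor `𝔠(π)`, an ideal of `𝒪_L`: the largest ideal `𝔞` such that `π` has non-zero
invariants under `K_1(𝔞)`. -/
def conductorIdeal (π : Representation ℂ (GL (Fin 2) L) V) : Ideal (intRing K L) :=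
  sSup {𝔞 | invariants π (K1 K 𝔞) ≠ ⊥}

/-- `π` is unramified if it has non-zero invariants under `GL₂(𝒪_L)`. -/
def IsUnramified (π : Representation ℂ (GL (Fin 2) L) V) : Prop :=
  invariants π (Set.range (intMap K L)) ≠ ⊥

/-- The central character `ω_π` of `π`, by which the centre of `GL₂(L)` acts. -/
def centralChar (π : Representation ℂ (GL (Fin 2) L) V) : Lˣ →* ℂˣ :=
  open Classical in
  if h : ∃ ω : Lˣ →* ℂˣ, ∀ (z : Lˣ) (v : V),
      π (Matrix.GeneralLinearGroup.scalar (Fin 2) z) v = (ω z : ℂ) • v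
  then h.choose else 1

/-- The restriction `χ = ω_π|_{Kˣ}` of the central character. -/
def restrictedCentralChar (π : Representation ℂ (GL (Fin 2) L) V) : Kˣ →* ℂˣ :=
  (centralChar π).comp (Units.map (algebraMap K L).toMonoidHom)

/-- `Λ` is a `ψ`-Whittaker functional on `π`. (So `π` is generic if there is a non-zero one.) -/
def IsWhittaker (ψ : AddChar L ℂ) (π : Representation ℂ (GL (Fin 2) L) V) (Λ : V →ₗ[ℂ] ℂ) : Prop :=
  ∀ (x : L) (v : V),
    Λ (π (Matrix.GeneralLinearGroup.upperRightHom x) v) = ψ x * Λ v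

/-- The Whittaker model `𝒲(π)` of `π` given by a Whittaker functional `Λ`: the space of functions
`g ↦ Λ(π(g) v)` on `GL₂(L)`. -/
def whittakerModel (π : Representation ℂ (GL (Fin 2) L) V) (Λ : V →ₗ[ℂ] ℂ) :
    Submodule ℂ (GL (Fin 2) L → ℂ) :=
  LinearMap.range (LinearMap.pi fun g => Λ ∘ₗ π g)

/-- The functions in the Whittaker model that are invariant under (right translation by)
`K_1(𝔠)`, where `𝔠` is the conductor. -/
def newLine (π : Representation ℂ (GL (Fin 2) L) V) (Λ : V →ₗ[ℂ] ℂ) :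
    Submodule ℂ (GL (Fin 2) L → ℂ) where
  carrier := {W | W ∈ whittakerModel π Λ ∧ ∀ k ∈ K1 K (conductorIdeal K π), ∀ g, W (g * k) = W g}
  add_mem' ha hb := ⟨add_mem ha.1 hb.1, fun k hk g => by
    rw [Pi.add_apply, Pi.add_apply, ha.2 k hk, hb.2 k hk]⟩
  zero_mem' := ⟨zero_mem _, fun _ _ _ => rfl⟩
  smul_mem' c W hW := ⟨Submodule.smul_mem _ c hW.1, fun k hk g => by
    rw [Pi.smul_apply, Pi.smul_apply, hW.2 k hk]⟩

/-- `W` is the normalised new vector `W^new`: the generator of the line of `K_1(𝔠)`-invariants in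
the Whittaker model with `W(1) = 1`. -/
structure IsNewVector (π : Representation ℂ (GL (Fin 2) L) V) (Λ : V →ₗ[ℂ] ℂ)
    (W : GL (Fin 2) L → ℂ) : Prop where
  generates : newLine K π Λ = Submodule.span ℂ {W}
  normalised : W 1 = 1

end Representation

/-! ### The zeta integrals -/

section Zeta

variable {K : Type*} [Field K] [ValuativeRel K] [TopologicalSpace K] [IsNonarchimedeanLocalField K]
variable [MeasurableSpace Kˣ] [BorelSpace Kˣ]
variable {L : Type*} [CommRing L] [Algebra K L]

/-- The integrand `Φ((0, a) h) χ(a) |a|^{2s}` of the Godement--Siegel section. -/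
def sectionIntegrand (χ : Kˣ →* ℂˣ) (Φ : (Fin 2 → K) → ℂ) (s : ℂ) (h : GL (Fin 2) K) (a : Kˣ) : ℂ :=
  Φ (![0, (a : K)] ᵥ* (h : Matrix (Fin 2) (Fin 2) K)) * (χ a : ℂ) *
    (normAbs (a : K) : ℂ) ^ (2 * s)

/-- The Godement--Siegel section
`f^Φ(h; χ, s) = |det h|^s ∫_{Kˣ} Φ((0, a) h) χ(a) |a|^{2s} d^× a`. -/
def siegelSection (χ : Kˣ →* ℂˣ) (Φ : (Fin 2 → K) → ℂ) (s : ℂ) (h : GL (Fin 2) K) : ℂ :=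
  (normAbs (h : Matrix (Fin 2) (Fin 2) K).det : ℂ) ^ s *
    ∫ a, sectionIntegrand χ Φ s h a ∂(mulHaar K)

lemma siegelSection_mul (χ : Kˣ →* ℂˣ) (Φ : (Fin 2 → K) → ℂ) (s : ℂ)
    (n h : GL (Fin 2) K) (z : Kˣ) (h10 : n 1 0 = 0) (h00 : n 0 0 = z) (h11 : n 1 1 = z) :
    siegelSection χ Φ s (n * h) = (χ z : ℂ)⁻¹ * siegelSection χ Φ s h := by
  have hz := normAbs_pos z.ne_zero
  have hz' : (normAbs (z : K) : ℂ) ≠ 0 := by exact_mod_cast hz.ne'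
  have hsec : ∀ a, sectionIntegrand χ Φ s (n * h) a =
      ((χ z : ℂ)⁻¹ * (normAbs (z : K) : ℂ) ^ (-(2 * s))) * sectionIntegrand χ Φ s h (z * a) := by
    intro a
    have hv : ![0, (a : K)] ᵥ* ((n * h : GL (Fin 2) K) : Matrix (Fin 2) (Fin 2) K) =
        ![0, ((z * a : Kˣ) : K)] ᵥ* (h : Matrix (Fin 2) (Fin 2) K) := by
      rw [Units.val_mul, ← Matrix.vecMul_vecMul]
      congr 1
      funext i
      fin_cases i <;> simp [Matrix.vecMul, dotProduct, Fin.sum_univ_two, h10, h11, mul_comm]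
    have hχ : (χ z : ℂ) ≠ 0 := (χ z).ne_zero
    rw [sectionIntegrand, sectionIntegrand, hv]
    simp only [map_mul, Units.val_mul]
    rw [normAbs_mul, Complex.ofReal_mul,
      Complex.mul_cpow_ofReal_nonneg hz.le (normAbs_pos a.ne_zero).le, Complex.cpow_neg]
    have : (normAbs (z : K) : ℂ) ^ (2 * s) ≠ 0 := by simp [Complex.cpow_eq_zero_iff, hz']
    field_simp
  have hdet : (n : Matrix (Fin 2) (Fin 2) K).det = z * z := by
    rw [Matrix.det_fin_two, h00, h11, h10]; ring
  simp only [siegelSection, hsec]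
  rw [integral_const_mul, integral_mul_left_eq_self (μ := mulHaar K) (sectionIntegrand χ Φ s h) z,
    Units.val_mul, Matrix.det_mul, hdet, normAbs_mul, normAbs_mul, Complex.ofReal_mul,
    Complex.mul_cpow_ofReal_nonneg (by positivity) ?_, Complex.ofReal_mul,
    Complex.mul_cpow_ofReal_nonneg hz.le hz.le, Complex.cpow_neg, two_mul, Complex.cpow_add _ _ hz']
  · have : (normAbs (z : K) : ℂ) ^ s ≠ 0 := by simp [Complex.cpow_eq_zero_iff, hz']
    field_simp
  · exact (normAbs_pos ((Matrix.isUnit_iff_isUnit_det _).mp h.isUnit).ne_zero).le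

/-- The integrand `W(h) f^Φ(h; χ, s)` of the Asai zeta integral, on `H`. -/
def asaiIntegrand (W : GL (Fin 2) L → ℂ) (χ : Kˣ →* ℂˣ) (Φ : (Fin 2 → K) → ℂ) (s : ℂ)
    (h : GL (Fin 2) K) : ℂ :=
  W (inclH K L h) * siegelSection χ Φ s h

/-- The integrand of the Asai zeta integral is left invariant under `Z_H N_H`. -/
lemma asaiIntegrand_mul (W : GL (Fin 2) L → ℂ) (χ : Kˣ →* ℂˣ) (Φ : (Fin 2 → K) → ℂ) (s : ℂ)
    (hN : ∀ (x : K) g, W (inclH K L (Matrix.GeneralLinearGroup.upperRightHom x) * g) = W g)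
    (hZ : ∀ (z : Kˣ) g,
      W (inclH K L (Matrix.GeneralLinearGroup.scalar (Fin 2) z) * g) = (χ z : ℂ) * W g)
    (n h : GL (Fin 2) K) (hn : n ∈ centreUnipotent K) :
    asaiIntegrand W χ Φ s (n * h) = asaiIntegrand W χ Φ s h := by
  obtain ⟨h10, hd⟩ := hn
  have h00 : n 0 0 ≠ 0 := fun h0 => by
    have := ((Matrix.isUnit_iff_isUnit_det _).mp n.isUnit).ne_zero
    rw [Matrix.det_fin_two, h0, h10] at this
    simp at this
  set z : Kˣ := Units.mk0 _ h00
  have hfac : n = Matrix.GeneralLinearGroup.scalar (Fin 2) z *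
      Matrix.GeneralLinearGroup.upperRightHom ((z : K)⁻¹ * n 0 1) := by
    apply Matrix.GeneralLinearGroup.ext
    intro i j
    fin_cases i <;> fin_cases j <;>
      simp [Matrix.GeneralLinearGroup.scalar, Matrix.mul_apply, Fin.sum_univ_two, h10, ← hd, z,
        Matrix.GeneralLinearGroup.upperRightHom, h00]
  rw [asaiIntegrand, siegelSection_mul χ Φ s n h z h10 rfl hd.symm, asaiIntegrand]
  conv_lhs => rw [hfac]
  rw [map_mul, map_mul, mul_assoc, hZ, hN]
  have hχ : (χ z : ℂ) ≠ 0 := (χ z).ne_zero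
  field_simp

/-- The integrand of the Asai zeta integral, as a function on `Z_H N_H \ H`. (For `W` in the
Whittaker model, the choice of representative does not matter, by `asaiIntegrand_mul`.) -/
def asaiIntegrandQuot (W : GL (Fin 2) L → ℂ) (χ : Kˣ →* ℂˣ) (Φ : (Fin 2 → K) → ℂ) (s : ℂ)
    (x : CosetSpace K) : ℂ :=
  asaiIntegrand W χ Φ s (Quotient.out x)

/-- The Asai zeta integral `∫_{Z_H N_H \ H} W(h) f^Φ(h; χ, s) dh`, at a point of convergence. -/
def asaiIntegral (μ : Measure (CosetSpace K)) (W : GL (Fin 2) L → ℂ) (χ : Kˣ →* ℂˣ)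
    (Φ : (Fin 2 → K) → ℂ) (s : ℂ) : ℂ :=
  ∫ x, asaiIntegrandQuot W χ Φ s x ∂μ

/-- Absolute convergence of the Asai zeta integral at `s`, and of the integrals that define the
Godement--Siegel section in it. -/
def AsaiConverges (μ : Measure (CosetSpace K)) (W : GL (Fin 2) L → ℂ) (χ : Kˣ →* ℂˣ)
    (Φ : (Fin 2 → K) → ℂ) (s : ℂ) : Prop :=
  (∀ h, Integrable (sectionIntegrand χ Φ s h) (mulHaar K)) ∧
    Integrable (asaiIntegrandQuot W χ Φ s) μ

/-- `Z(W, Φ; s)`, as a rational function of `q_K^{-s}`. -/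
def asaiZeta (μ : Measure (CosetSpace K)) (W : GL (Fin 2) L → ℂ) (χ : Kˣ →* ℂˣ)
    (Φ : (Fin 2 → K) → ℂ) : RatFunc ℂ :=
  continuation (resCard K) (AsaiConverges μ W χ Φ) (asaiIntegral μ W χ Φ)

variable (K) in
/-- The integrand `W((x 0; 0 1)) |x|^{s - 1}` of the partial zeta integral. -/
def partialIntegrand (W : GL (Fin 2) L → ℂ) (s : ℂ) (x : Kˣ) : ℂ :=
  W (inclH K L (Matrix.GeneralLinearGroup.mkOfDetNeZero !![(x : K), 0; 0, 1] (by simp))) *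
    (normAbs (x : K) : ℂ) ^ (s - 1)

variable (K) in
/-- The partial zeta integral `∫_{Kˣ} W((x 0; 0 1)) |x|^{s - 1} d^× x`, at a point of
convergence. -/
def partialIntegral (W : GL (Fin 2) L → ℂ) (s : ℂ) : ℂ :=
  ∫ x, partialIntegrand K W s x ∂(mulHaar K)

variable (K) in
/-- Absolute convergence of the partial zeta integral at `s`. -/
def PartialConverges (W : GL (Fin 2) L → ℂ) (s : ℂ) : Prop :=
  Integrable (partialIntegrand K W s) (mulHaar K)

variable (K) in
/-- `Z(W; s)`, as a rational function of `q_K^{-s}`. -/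
def partialZeta (W : GL (Fin 2) L → ℂ) : RatFunc ℂ :=
  continuation (resCard K) (PartialConverges K W) (partialIntegral K W)

variable (K) in
/-- The imprimitive Asai `L`-factor of `π`, as a rational function of `q_K^{-s}`: it is
`Z(W^new; s)` if `π` is ramified and `L(χ, 2s) Z(W^new; s)` if `π` is unramified.
Here `W` is the normalised new vector. -/
def imprimitiveAsai {V : Type*} [AddCommGroup V] [Module ℂ V]
    (π : Representation ℂ (GL (Fin 2) L) V) (W : GL (Fin 2) L → ℂ) : RatFunc ℂ :=
  open Classical in
  if IsUnramified K π then lFactorTwo K (restrictedCentralChar K π) * partialZeta K W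
  else partialZeta K W

end Zeta

end AsaiZeta

end

open AsaiZeta

set_option linter.unusedSectionVars false

noncomputable section

namespace AsaiZeta

/-! ### Sequences with a rational generating function -/

/-! Everything is controlled by the numbers a(n) = W(diag(ϖ_K^n, 1)) (`torusValue`). They vanish for
n < 0, because W is right invariant under integral unipotents while ψ is non-trivial on every
fractional ideal larger than 𝒪_L. With q = q_K and X = q^{-s}, both kinds of zeta integral are
multiples of one power series, Σ q^n a(n) X^n (`torusTerm`).

For Z(W; s), the elements of valuation n have volume 1 and |x|^{s-1} contributes (qX)^n
(`partialIntegral_eq`). For Z(W, Φ_r; s) with r ≥ r₀, both W and the Siegel section are right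
invariant under K_1(𝔭_K^r), and the relevant pieces of Z_H N_H \ H are the cells Z_H N_H diag(x, 1)
K_1(𝔭_K^r) with x of valuation n. They exhaust H when r = 0, and the section vanishes off them when
r ≥ 1. A cell has volume q^n times that of the cell with n = 0
(`IsUnramifiedInvariant.measure_cell`), and the section equals X^n f(1) on it. So Z(W, Φ_r; s) =
f(1) · vol(cell 0 r) · Σ q^n a(n) X^n (`asaiIntegral_eq`).

The constant explains the normalisation of Φ_r. For r ≥ 1 one has f(1) = (q² - 1) q^{2r-2} / ((q -
1) q^{r-1}) = (q + 1) q^{r-1}, the inverse of the volume of the cell (`sectionIntegrand_integral`).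
For r = 0 the volume is 1 and f(1) is the geometric series L(χ, 2s)
(`sectionIntegrand_zero_integral`). Since r₀ = 0 exactly when π is unramified, these are the two
branches of the imprimitive L-factor.

Rationality comes from the new line being one-dimensional: a Hecke operator at a principal maximal
ideal (p) of 𝒪_L acts on it by a scalar, which gives a two-term recurrence for W along powers of p
(`IsNewVector.hecke`). If L is a field, then ϖ_K = p^e u and a(n) = α(en) for such a recurrence
sequence α; if L is K × K, then a(n) = α(n) β(n) with one factor for each place. Diagonal
coefficients of powers of a matrix are stable under both operations and have rational generating
functions (`IsMatrixCoeff.exists_generating`). -/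

/-- The sequence `a` is a diagonal matrix coefficient of `n ↦ M ^ n` for a complex matrix `M`. -/
def IsMatrixCoeff (a : ℕ → ℂ) : Prop :=
  ∃ (ι : Type) (_ : Fintype ι) (_ : DecidableEq ι) (M : Matrix ι ι ℂ) (i : ι),
    ∀ n, a n = (M ^ n) i i

lemma IsMatrixCoeff.geom_mul {a : ℕ → ℂ} (ha : IsMatrixCoeff a) (c : ℂ) :
    IsMatrixCoeff fun n => c ^ n * a n := by
  obtain ⟨ι, _, _, M, i, h⟩ := ha
  exact ⟨ι, ‹_›, ‹_›, c • M, i, fun n => by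
    simp only [_root_.smul_pow, Matrix.smul_apply, h, smul_eq_mul]⟩

/-- Serves the case where `e` is the exponent of a uniformiser of 𝒪_L in ϖ_K. -/
lemma IsMatrixCoeff.comp_mul {a : ℕ → ℂ} (ha : IsMatrixCoeff a) (e : ℕ) :
    IsMatrixCoeff fun n => a (e * n) := by
  obtain ⟨ι, _, _, M, i, h⟩ := ha
  exact ⟨ι, ‹_›, ‹_›, M ^ e, i, fun n => by simp only [← pow_mul, h]⟩

/-- The Kronecker product satisfies (M ⊗ N)^n = M^n ⊗ N^n. This handles split L, where the torus
values are a product over the two places. -/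
lemma IsMatrixCoeff.mul {a b : ℕ → ℂ} (ha : IsMatrixCoeff a) (hb : IsMatrixCoeff b) :
    IsMatrixCoeff fun n => a n * b n := by
  obtain ⟨ι, _, _, M, i, h⟩ := ha
  obtain ⟨κ, _, _, N, j, h'⟩ := hb
  refine ⟨ι × κ, inferInstance, inferInstance, Matrix.kroneckerMap (· * ·) M N, (i, j), fun n => ?_⟩
  have hpow : Matrix.kroneckerMap (· * ·) M N ^ n =
      Matrix.kroneckerMap (· * ·) (M ^ n) (N ^ n) := by
    induction n with
    | zero => simp
    | succ n ih => rw [pow_succ, ih, ← Matrix.mul_kronecker_mul, pow_succ, pow_succ]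
  simp only [hpow, Matrix.kroneckerMap_apply, h, h']

-- The series is an entry of the Neumann series for (1 - zM)⁻¹, and Cramer's rule writes that entry
-- as a cofactor over det(1 - zM). This determinant is the value at z of the reversed characteristic
-- polynomial, which is 1 at z = 0 and so has no zero near 0.
open scoped Matrix.Norms.Operator in
lemma IsMatrixCoeff.exists_generating {a : ℕ → ℂ} (ha : IsMatrixCoeff a) :
    ∃ (P Q : ℂ[X]) (ρ : ℝ), 0 < ρ ∧ ∀ z : ℂ, ‖z‖ < ρ →
      Q.eval z ≠ 0 ∧ Summable (fun n => ‖a n * z ^ n‖) ∧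
        ∑' n, a n * z ^ n = P.eval z / Q.eval z := by
  obtain ⟨ι, _, _, M, i, h⟩ := ha
  have hcont : ContinuousAt (fun z => M.charpolyRev.eval z) 0 :=
    M.charpolyRev.continuous.continuousAt
  have hne : ∀ᶠ z in nhds (0 : ℂ), M.charpolyRev.eval z ≠ 0 := by
    refine hcont.eventually_ne ?_
    rw [Matrix.eval_charpolyRev]; exact one_ne_zero
  obtain ⟨ε, hε, hball⟩ := Metric.eventually_nhds_iff.mp hne
  set P : Matrix ι ι ℂ[X] := 1 - (X : ℂ[X]) • M.map C
  have hP : ∀ z : ℂ, (evalRingHom z).mapMatrix P = 1 - z • M := by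
    intro z
    ext j k
    simp [P, Matrix.one_apply, Matrix.sub_apply, Matrix.smul_apply, apply_ite (Polynomial.eval z), mul_comm z]
  refine ⟨P.adjugate i i, M.charpolyRev, min ε (‖M‖ + 1)⁻¹, by positivity, fun z hz => ?_⟩
  have hQ : M.charpolyRev.eval z ≠ 0 :=
    hball (by simpa using lt_of_lt_of_le hz (min_le_left _ _))
  have hnorm : ‖z • M‖ < 1 := by
    have h1 : ‖z‖ < (‖M‖ + 1)⁻¹ := lt_of_lt_of_le hz (min_le_right _ _)
    have h0 : 0 < ‖M‖ + 1 := by positivity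
    calc ‖z • M‖ ≤ ‖z‖ * ‖M‖ := norm_smul_le _ _
      _ ≤ ‖z‖ * (‖M‖ + 1) := by gcongr; linarith
      _ < (‖M‖ + 1)⁻¹ * (‖M‖ + 1) := by gcongr
      _ = 1 := inv_mul_cancel₀ h0.ne'
  have hsum : Summable fun n => (z • M) ^ n := summable_geometric_of_norm_lt_one hnorm
  have hterm : ∀ n, ((z • M) ^ n) i i = a n * z ^ n := fun n => by
    rw [_root_.smul_pow, Matrix.smul_apply, h, smul_eq_mul, mul_comm]
  have hS : HasSum (fun n => a n * z ^ n) ((∑' n, (z • M) ^ n) i i) := by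
    have := (Pi.hasSum.mp (Pi.hasSum.mp hsum.hasSum i) i)
    simpa only [hterm] using this
  refine ⟨hQ, hS.summable.norm, ?_⟩
  rw [hS.tsum_eq, eq_div_iff hQ]
  have hdet : (1 - z • M).det = M.charpolyRev.eval z := by
    rw [← hP z, ← RingHom.map_det]; rfl
  have hadj : (1 - z • M).adjugate i i = (P.adjugate i i).eval z := by
    rw [← hP z, ← RingHom.map_adjugate]; rfl
  rw [← hdet, ← hadj]
  have key : (1 - z • M).adjugate = (1 - z • M).det • ∑' n, (z • M) ^ n := by
    have h1 : (1 - z • M) * ∑' n, (z • M) ^ n = 1 := mul_neg_geom_series (z • M) hnorm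
    calc (1 - z • M).adjugate
        = (1 - z • M).adjugate * ((1 - z • M) * ∑' n, (z • M) ^ n) := by rw [h1, mul_one]
      _ = _ := by rw [← mul_assoc, Matrix.adjugate_mul, Matrix.smul_mul, one_mul]
  rw [key, Matrix.smul_apply, smul_eq_mul, mul_comm]

/-- A sequence satisfying a two-term recurrence with `a 0 = 1`. -/
lemma isMatrixCoeff_of_recurrence {a : ℕ → ℂ} (b c : ℂ) (h0 : a 0 = 1) (h1 : a 1 = b)
    (h : ∀ n, a (n + 2) = b * a (n + 1) + c * a n) : IsMatrixCoeff a := by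
  refine ⟨Fin 2, inferInstance, inferInstance, !![b, c; 1, 0], 0, fun n => ?_⟩
  have key : ∀ n, a n = ((!![b, c; 1, 0] : Matrix (Fin 2) (Fin 2) ℂ) ^ n) 0 0 ∧
      a (n + 1) = ((!![b, c; 1, 0] : Matrix (Fin 2) (Fin 2) ℂ) ^ (n + 1)) 0 0 ∧
      ((!![b, c; 1, 0] : Matrix (Fin 2) (Fin 2) ℂ) ^ (n + 1)) 1 0 = a n := by
    intro n
    induction n with
    | zero => simp [h0, h1]
    | succ n ih =>
      obtain ⟨-, h2, h3⟩ := ih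
      refine ⟨h2, ?_, ?_⟩
      · rw [pow_succ', Matrix.mul_apply, Fin.sum_univ_two, ← h2, h3, h n]; simp
      · rw [pow_succ', Matrix.mul_apply, Fin.sum_univ_two, ← h2]; simp
  exact (key n).1

/-! ### Continuations -/

section Continuation

variable {q : ℕ} {conv conv' : ℂ → Prop} {I I' : ℂ → ℂ} {R R' : RatFunc ℂ}

lemma norm_natCast_cpow_neg (hq : 0 < q) (s : ℂ) : ‖(q : ℂ) ^ (-s)‖ = (q : ℝ) ^ (-s.re) := by
  rw [Complex.norm_natCast_cpow_of_pos hq, Complex.neg_re]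

lemma exists_norm_cpow_lt (hq : 1 < q) {ρ : ℝ} (hρ : 0 < ρ) :
    ∃ σ : ℝ, ∀ s : ℂ, σ < s.re → ‖(q : ℂ) ^ (-s)‖ < ρ := by
  have hq' : (1 : ℝ) < q := by exact_mod_cast hq
  refine ⟨-Real.logb q ρ, fun s hs => ?_⟩
  rw [norm_natCast_cpow_neg (by omega), ← Real.lt_logb_iff_rpow_lt hq' hρ]
  linarith

lemma IsContinuation.of_eq_div (hq : 1 < q) (P Q : ℂ[X]) {ρ : ℝ} (hρ : 0 < ρ)
    (hQ : ∀ z : ℂ, ‖z‖ < ρ → Q.eval z ≠ 0)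
    (h : ∀ s : ℂ, ‖(q : ℂ) ^ (-s)‖ < ρ →
      conv s ∧ I s = P.eval ((q : ℂ) ^ (-s)) / Q.eval ((q : ℂ) ^ (-s))) :
    IsContinuation q conv I (algebraMap ℂ[X] (RatFunc ℂ) P / algebraMap ℂ[X] (RatFunc ℂ) Q) := by
  obtain ⟨σ, hσ⟩ := exists_norm_cpow_lt hq hρ
  have hQ0 : Q ≠ 0 := by
    rintro rfl
    exact hQ 0 (by simpa using hρ) (by simp)
  set R := algebraMap ℂ[X] (RatFunc ℂ) P / algebraMap ℂ[X] (RatFunc ℂ) Q with hR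
  refine ⟨σ, fun s hs => ?_⟩
  obtain ⟨h1, h2⟩ := h s (hσ s hs)
  have hQs := hQ _ (hσ s hs)
  have hden : R.denom.eval ((q : ℂ) ^ (-s)) ≠ 0 := by
    -- The reduced denominator divides `Q`, so it has no zero where `Q` has none.
    obtain ⟨T, hT⟩ := RatFunc.denom_div_dvd P Q
    intro h0
    rw [hT, Polynomial.eval_mul, h0, zero_mul] at hQs
    exact hQs rfl
  refine ⟨h1, hden, ?_⟩
  have hmul := congrArg (Polynomial.eval ((q : ℂ) ^ (-s)))
    ((RatFunc.num_mul_eq_mul_denom_iff hQ0).mpr hR)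
  rw [Polynomial.eval_mul, Polynomial.eval_mul] at hmul
  rw [h2, RatFunc.eval, Polynomial.eval₂_id, Polynomial.eval₂_id, div_eq_div_iff hQs hden, hmul]

/-- An integral given by a power series in `q^{-s}` whose coefficients are matrix coefficients is
continued by a rational function. -/
lemma IsMatrixCoeff.exists_isContinuation {a : ℕ → ℂ} (ha : IsMatrixCoeff a) (hq : 1 < q)
    (h : ∀ s : ℂ, Summable (fun n => ‖a n * ((q : ℂ) ^ (-s)) ^ n‖) →
      conv s ∧ I s = ∑' n, a n * ((q : ℂ) ^ (-s)) ^ n) :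
    ∃ R, IsContinuation q conv I R := by
  obtain ⟨P, Q, ρ, hρ, hPQ⟩ := ha.exists_generating
  refine ⟨_, IsContinuation.of_eq_div hq P Q hρ (fun z hz => (hPQ z hz).1) fun s hs => ?_⟩
  obtain ⟨h1, h2⟩ := h s (hPQ _ hs).2.1
  exact ⟨h1, h2.trans (hPQ _ hs).2.2⟩

lemma IsContinuation.congr (h : IsContinuation q conv I R) {σ : ℝ}
    (h' : ∀ s : ℂ, σ < s.re → conv s → conv' s ∧ I' s = I s) : IsContinuation q conv' I' R := by
  obtain ⟨τ, hτ⟩ := h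
  refine ⟨max σ τ, fun s hs => ?_⟩
  obtain ⟨h1, h2, h3⟩ := hτ s (lt_of_le_of_lt (le_max_right _ _) hs)
  obtain ⟨h4, h5⟩ := h' s (lt_of_le_of_lt (le_max_left _ _) hs) h1
  exact ⟨h4, h2, h5.trans h3⟩

lemma IsContinuation.mul (h : IsContinuation q conv I R) (h' : IsContinuation q conv' I' R') :
    IsContinuation q (fun s => conv s ∧ conv' s) (fun s => I s * I' s) (R * R') := by
  obtain ⟨σ, hσ⟩ := h
  obtain ⟨τ, hτ⟩ := h'
  refine ⟨max σ τ, fun s hs => ?_⟩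
  obtain ⟨h1, h2, h3⟩ := hσ s (lt_of_le_of_lt (le_max_left _ _) hs)
  obtain ⟨h4, h5, h6⟩ := hτ s (lt_of_le_of_lt (le_max_right _ _) hs)
  refine ⟨⟨h1, h4⟩, ?_, ?_⟩
  · obtain ⟨T, hT⟩ := RatFunc.denom_mul_dvd R R'
    intro h0
    have := congrArg (Polynomial.eval ((q : ℂ) ^ (-s))) hT
    rw [Polynomial.eval_mul, Polynomial.eval_mul, h0, zero_mul] at this
    exact mul_ne_zero h2 h5 this
  · simp only
    rw [RatFunc.eval_mul _ _ (by rwa [Polynomial.eval₂_id]) (by rwa [Polynomial.eval₂_id]), h3, h6]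

/-- Two rational functions that agree at infinitely many points are equal. Hence the value picked by
`continuation` is the expected one, whatever domain of convergence is used. -/
lemma IsContinuation.unique (hq : 1 < q) (h : IsContinuation q conv I R)
    (h' : IsContinuation q conv' I R') : R = R' := by
  obtain ⟨σ, hσ⟩ := h
  obtain ⟨τ, hτ⟩ := h'
  have hq' : (1 : ℝ) < q := by exact_mod_cast hq
  set T : ℂ[X] := R.num * R'.denom - R'.num * R.denom
  -- Real points s = max σ τ + 1 + n lie in both half-planes, and their images q^{-s} are distinct
  -- because q > 1.
  let f : ℕ → ℂ := fun n => (q : ℂ) ^ (-((max σ τ + 1 + n : ℝ) : ℂ))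
  have hf : Function.Injective f := by
    intro m n hmn
    have h1 := congrArg norm hmn
    simp only [f] at h1
    rw [norm_natCast_cpow_neg (by omega), norm_natCast_cpow_neg (by omega), Complex.ofReal_re,
      Complex.ofReal_re, Real.rpow_right_inj (by linarith) hq'.ne'] at h1
    exact_mod_cast (by linarith : (m : ℝ) = n)
  have hroot : ∀ n, T.IsRoot (f n) := by
    intro n
    have hn : (0 : ℝ) ≤ n := n.cast_nonneg
    obtain ⟨-, h2, h3⟩ := hσ (max σ τ + 1 + n : ℝ) (by
      rw [Complex.ofReal_re]; linarith [le_max_left σ τ])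
    obtain ⟨-, h5, h6⟩ := hτ (max σ τ + 1 + n : ℝ) (by
      rw [Complex.ofReal_re]; linarith [le_max_right σ τ])
    rw [h3, RatFunc.eval, RatFunc.eval, Polynomial.eval₂_id, Polynomial.eval₂_id,
      Polynomial.eval₂_id, Polynomial.eval₂_id, div_eq_div_iff h2 h5] at h6
    simp only [T, Polynomial.IsRoot.def, Polynomial.eval_sub, Polynomial.eval_mul]
    exact sub_eq_zero.mpr h6
  have hT : T = 0 := by
    refine Polynomial.eq_zero_of_infinite_isRoot T (Set.Infinite.mono ?_ (Set.infinite_range_of_injective hf))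
    rintro _ ⟨n, rfl⟩
    exact hroot n
  rw [← RatFunc.num_div_denom R']
  refine (RatFunc.num_mul_eq_mul_denom_iff (RatFunc.denom_ne_zero R')).mp (sub_eq_zero.mp hT)

lemma IsContinuation.continuation_eq (hq : 1 < q) (h : IsContinuation q conv I R) :
    continuation q conv I = R := by
  have hex : ∃ R, IsContinuation q conv I R := ⟨R, h⟩
  rw [continuation, dif_pos hex]
  exact hex.choose_spec.unique hq h

end Continuation

/-! ### Valuation and absolute value on a local field -/

section LocalField

variable (K : Type*) [Field K] [ValuativeRel K] [TopologicalSpace K] [IsNonarchimedeanLocalField K]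

lemma one_lt_resCard : 1 < resCard K := Finite.one_lt_card

/-- The valuation of the uniformiser. -/
def unifVal : ValueGroupWithZero K := valuation K (uniformiser K : K)

lemma uniformiser_ne_zero : (uniformiser K : K) ≠ 0 := (uniformiserUnit K).ne_zero

lemma unifVal_pos : 0 < unifVal K := by
  rw [unifVal, zero_lt_iff]
  simpa using uniformiser_ne_zero K

lemma unifVal_ne_zero : unifVal K ≠ 0 := (unifVal_pos K).ne'

variable {K}

/-- The normalised additive valuation (with the junk value `0` at `0`). -/
def ord (x : K) : ℤ :=
  -WithZero.log (IsNonarchimedeanLocalField.valueGroupWithZeroIsoInt K (valuation K x))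

lemma normAbs_eq {x : K} (hx : x ≠ 0) : normAbs x = (resCard K : ℝ) ^ (-ord x) := by
  rw [normAbs, if_neg hx, ord, neg_neg]

lemma resCard_zpow_injective : Function.Injective fun n : ℤ => (resCard K : ℝ) ^ n :=
  zpow_right_injective₀ (by exact_mod_cast resCard_pos (K := K))
    (by exact_mod_cast (one_lt_resCard K).ne')

lemma ord_uniformiser : ord (uniformiser K : K) = 1 := by
  have h := normAbs_uniformiser K
  rw [normAbs_eq (uniformiser_ne_zero K), ← _root_.zpow_neg_one] at h
  have := resCard_zpow_injective (K := K) h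
  omega

lemma valuation_eq_zpow {x : K} (hx : x ≠ 0) : valuation K x = unifVal K ^ ord x := by
  set e := IsNonarchimedeanLocalField.valueGroupWithZeroIsoInt K
  have h1 : WithZero.log (e (unifVal K)) = -1 := by
    have := ord_uniformiser (K := K)
    rw [ord] at this
    change WithZero.log (e (valuation K (uniformiser K : K))) = -1
    change -WithZero.log (e (valuation K (uniformiser K : K))) = 1 at this
    omega
  apply e.injective
  change e _ = e _
  have hx' : e (valuation K x) ≠ 0 := by simpa using hx
  have hv : e (unifVal K) ≠ 0 := by simpa using unifVal_ne_zero K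
  rw [map_zpow₀, ← WithZero.exp_log hx', ← WithZero.exp_log (zpow_ne_zero _ hv),
    WithZero.log_zpow, h1, ord]
  simp [e]

lemma unifVal_lt_one : unifVal K < 1 := by
  refine lt_of_le_of_ne (uniformiser K).2 fun h => (uniformiser_irreducible K).not_isUnit ?_
  exact (Valuation.Integers.isUnit_iff_valuation_eq_one
    (Valuation.integer.integers (valuation K))).mpr h

lemma unifVal_zpow_le_iff {m n : ℤ} : unifVal K ^ m ≤ unifVal K ^ n ↔ n ≤ m :=
  zpow_le_zpow_iff_right_of_lt_one₀ (unifVal_pos K) unifVal_lt_one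

lemma unifVal_zpow_inj {m n : ℤ} : unifVal K ^ m = unifVal K ^ n ↔ m = n := by
  refine ⟨fun h => ?_, fun h => by rw [h]⟩
  exact le_antisymm (unifVal_zpow_le_iff.mp h.ge) (unifVal_zpow_le_iff.mp h.le)

lemma exists_valuation_eq_zpow {x : K} (hx : x ≠ 0) : ∃ n : ℤ, valuation K x = unifVal K ^ n :=
  ⟨_, valuation_eq_zpow hx⟩

lemma valuation_eq_zpow_iff {x : K} (hx : x ≠ 0) {n : ℤ} :
    valuation K x = unifVal K ^ n ↔ ord x = n := by
  rw [valuation_eq_zpow hx, unifVal_zpow_inj]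

lemma normAbs_of_valuation {x : K} {n : ℤ} (h : valuation K x = unifVal K ^ n) :
    normAbs x = (resCard K : ℝ) ^ (-n) := by
  have hx : x ≠ 0 := by
    rintro rfl
    rw [map_zero] at h
    exact zpow_ne_zero n (unifVal_ne_zero K) h.symm
  rw [normAbs_eq hx, (valuation_eq_zpow_iff hx).mp h]

lemma valuation_lt_one_iff {x : K} : valuation K x < 1 ↔ valuation K x ≤ unifVal K := by
  by_cases hx : x = 0
  · simp [hx]
  have h0 := unifVal_zpow_le_iff (K := K) (m := 0) (n := ord x)
  have h1 := unifVal_zpow_le_iff (K := K) (m := ord x) (n := 1)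
  rw [_root_.zpow_zero] at h0
  rw [_root_.zpow_one] at h1
  rw [valuation_eq_zpow hx, h1, ← not_le, h0]
  omega

lemma memPow_iff {r : ℕ} {x : K} : MemPow K r x ↔ valuation K x ≤ unifVal K ^ r := by
  have hϖ := uniformiser_ne_zero K
  simp only [MemPow, (uniformiser_irreducible K).maximalIdeal_eq, Ideal.span_singleton_pow,
    Ideal.mem_span_singleton]
  constructor
  · rintro ⟨_, ⟨c, rfl⟩, rfl⟩
    have : valuation K (c : K) ≤ 1 := c.2
    simpa [unifVal] using mul_le_of_le_one_right' this
  · intro h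
    have hm : x / (uniformiser K : K) ^ r ∈ 𝒪[K] := by
      change valuation K _ ≤ 1
      rw [map_div₀, map_pow]
      exact div_le_one_of_le₀ h zero_le
    refine ⟨uniformiser K ^ r * ⟨x / (uniformiser K : K) ^ r, hm⟩, dvd_mul_right _ _, ?_⟩
    change (uniformiser K : K) ^ r * (x / (uniformiser K : K) ^ r) = x
    field_simp

/-- Turns every power of the absolute value in the integrands into a monomial in q^{-s}, on the set
where the valuation is constant. -/
lemma cpow_normAbs {x : K} {n : ℤ} (h : valuation K x = unifVal K ^ n) (s : ℂ) :
    (normAbs x : ℂ) ^ s = ((resCard K : ℂ) ^ (-s)) ^ n := by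
  have hq : (0 : ℝ) < resCard K := by exact_mod_cast resCard_pos
  have hq' : (resCard K : ℂ) ≠ 0 := by exact_mod_cast hq.ne'
  have hpos : (0 : ℝ) < (resCard K : ℝ) ^ (-n) := zpow_pos hq _
  rw [normAbs_of_valuation h, Complex.cpow_def_of_ne_zero (by exact_mod_cast hpos.ne'),
    Complex.cpow_def_of_ne_zero hq', ← Complex.exp_int_mul, ← Complex.ofReal_log hpos.le,
    Real.log_zpow, ← Complex.ofReal_natCast (resCard K), ← Complex.ofReal_log hq.le]
  push_cast
  ring_nf

/-- A fixed representative in `𝒪_K` of an element of the residue field. -/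
def residueRep (i : 𝓀[K]) : K := ((IsLocalRing.residue_surjective i).choose : 𝒪[K])

lemma valuation_residueRep_le (i : 𝓀[K]) : valuation K (residueRep i) ≤ 1 :=
  ((IsLocalRing.residue_surjective i).choose).2

lemma residue_eq_iff (x y : 𝒪[K]) :
    IsLocalRing.residue 𝒪[K] x = IsLocalRing.residue 𝒪[K] y ↔
      valuation K ((x : K) - y) ≤ unifVal K := by
  rw [← sub_eq_zero, ← map_sub, IsLocalRing.residue_eq_zero_iff, ← valuation_lt_one_iff]
  rw [IsLocalRing.mem_maximalIdeal, mem_nonunits_iff,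
    Valuation.Integers.isUnit_iff_valuation_eq_one (Valuation.integer.integers (valuation K))]
  exact (lt_iff_le_and_ne.trans (and_iff_right (x - y).2)).symm

lemma residueRep_spec (i : 𝓀[K]) (h : valuation K (residueRep i) ≤ 1) :
    IsLocalRing.residue 𝒪[K] ⟨residueRep i, h⟩ = i :=
  (IsLocalRing.residue_surjective i).choose_spec

/-- The common source of the coset decompositions below: every volume is obtained by sorting points
according to a residue class. -/
lemma existsUnique_residueRep {x : K} (hx : valuation K x ≤ 1) :
    ∃! i : 𝓀[K], valuation K (x - residueRep i) ≤ unifVal K := by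
  refine ⟨IsLocalRing.residue 𝒪[K] ⟨x, hx⟩, ?_, fun i hi => ?_⟩
  · exact (residue_eq_iff ⟨x, hx⟩ ⟨_, valuation_residueRep_le _⟩).mp (residueRep_spec _ _).symm
  · rw [← residueRep_spec i (valuation_residueRep_le i)]
    exact ((residue_eq_iff ⟨x, hx⟩ ⟨_, valuation_residueRep_le _⟩).mpr hi).symm

lemma residueRep_unit_iff (i : 𝓀[K]) : valuation K (residueRep i) = 1 ↔ i ≠ 0 := by
  rw [← residueRep_spec i (valuation_residueRep_le i), Ne, IsLocalRing.residue_eq_zero_iff,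
    IsLocalRing.mem_maximalIdeal, mem_nonunits_iff, not_not,
    Valuation.Integers.isUnit_iff_valuation_eq_one (Valuation.integer.integers (valuation K))]
  rw [residueRep_spec]
  rfl

lemma isOpen_valuation_le {γ : ValueGroupWithZero K} (hγ : γ ≠ 0) :
    IsOpen {x : K | valuation K x ≤ γ} := by
  rw [isOpen_iff_mem_nhds]
  intro x hx
  refine (IsValuativeTopology.hasBasis_nhds' x).mem_iff.mpr ⟨γ, hγ, fun y hy => ?_⟩
  have := (valuation K).map_add (y - x) x
  rw [sub_add_cancel] at this
  exact this.trans (max_le (le_of_lt hy) hx)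

lemma isOpen_valuation_eq {γ : ValueGroupWithZero K} (hγ : γ ≠ 0) :
    IsOpen {x : K | valuation K x = γ} := by
  rw [isOpen_iff_mem_nhds]
  intro x hx
  refine (IsValuativeTopology.hasBasis_nhds' x).mem_iff.mpr ⟨γ, hγ, fun y hy => ?_⟩
  have hx' : valuation K x = γ := hx
  have hy' : valuation K (y - x) < valuation K x := by rw [hx']; exact hy
  have := (valuation K).map_add_eq_of_lt_left hy'
  rw [add_sub_cancel] at this
  exact this.trans hx

end LocalField

/-! ### Integrals of functions that are constant on the pieces of a countable partition -/

/-- Countable additivity in the form needed for both zeta integrals. The pieces are indexed by ℕ and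
need not cover the space, so pieces of negative index are absorbed by the vanishing hypothesis `h0`.
-/
lemma integrable_and_integral_eq_tsum {X : Type*} [MeasurableSpace X] {μ : Measure X}
    {S : ℕ → Set X} (hS : ∀ n, MeasurableSet (S n)) (hd : Pairwise (Function.onFun Disjoint S))
    {w : ℕ → ℝ} (hw : ∀ n, 0 ≤ w n) (hμ : ∀ n, μ (S n) = ENNReal.ofReal (w n))
    {f : X → ℂ} {c : ℕ → ℂ} (hf : ∀ n, ∀ x ∈ S n, f x = c n)
    (h0 : ∀ x, (∀ n, x ∉ S n) → f x = 0) (hs : Summable fun n => ‖c n * w n‖) :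
    Integrable f μ ∧ ∫ x, f x ∂μ = ∑' n, c n * w n := by
  have hfin : ∀ n, μ (S n) ≠ ⊤ := fun n => by rw [hμ n]; exact ENNReal.ofReal_ne_top
  have hreal : ∀ n, μ.real (S n) = w n := fun n => by
    rw [Measure.real, hμ n, ENNReal.toReal_ofReal (hw n)]
  have hint : ∀ n, IntegrableOn f (S n) μ := fun n =>
    (integrableOn_const (hfin n) (C := c n)).congr_fun (fun x hx => (hf n x hx).symm) (hS n)
  have hval : ∀ n, ∫ x in S n, f x ∂μ = c n * w n := fun n => by
    rw [setIntegral_congr_fun (hS n) (hf n), setIntegral_const, hreal, Complex.real_smul, mul_comm]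
  have hnorm : ∀ n, ∫ x in S n, ‖f x‖ ∂μ = ‖c n * w n‖ := fun n => by
    rw [setIntegral_congr_fun (hS n) (g := fun _ => ‖c n‖) (fun x hx => by simp only [hf n x hx]),
      setIntegral_const, hreal, smul_eq_mul, norm_mul, Complex.norm_real,
      Real.norm_of_nonneg (hw n), mul_comm]
  have hU : IntegrableOn f (⋃ n, S n) μ :=
    integrableOn_iUnion_of_summable_integral_norm hint (by simpa only [hnorm] using hs)
  have hzero : ∀ x, x ∉ ⋃ n, S n → f x = 0 := fun x hx =>
    h0 x fun n hn => hx (Set.mem_iUnion.mpr ⟨n, hn⟩)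
  refine ⟨(integrableOn_iff_integrable_of_support_subset fun x hx => ?_).mp hU, ?_⟩
  · by_contra hx'
    exact hx (hzero x hx')
  · rw [← setIntegral_eq_integral_of_forall_compl_eq_zero hzero, integral_iUnion hS hd hU]
    exact tsum_congr hval

/-- Replaces the computation of a subgroup index: exhibiting the translates of one set that make up
another gives the ratio of the volumes. -/
lemma measure_eq_card_mul {X ι : Type*} [MeasurableSpace X] {μ : Measure X} [Finite ι]
    {A : Set X} {B : ι → Set X} {m : ENNReal} (hB : ∀ i, MeasurableSet (B i))
    (hm : ∀ i, μ (B i) = m) (hA : ∀ x ∈ A, ∃! i, x ∈ B i) (hBA : ∀ i, B i ⊆ A) :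
    μ A = Nat.card ι * m := by
  have := Fintype.ofFinite ι
  have hU : A = ⋃ i, B i := by
    refine Set.Subset.antisymm (fun x hx => ?_) (Set.iUnion_subset hBA)
    obtain ⟨i, hi, -⟩ := hA x hx
    exact Set.mem_iUnion.mpr ⟨i, hi⟩
  rw [hU, measure_iUnion _ hB, tsum_fintype]
  · simp [hm]
  · intro i j hij
    refine Set.disjoint_left.mpr fun x hi hj => hij ?_
    exact (hA x (hBA i hi)).unique hi hj

/-! ### Volumes in `Kˣ`: the unit filtration and the shells of fixed valuation. -/

section LocalField

variable (K : Type*) [Field K] [ValuativeRel K] [TopologicalSpace K] [IsNonarchimedeanLocalField K]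

lemma isOpen_unitSet : IsOpen (unitSet K) :=
  (isOpen_valuation_eq one_ne_zero).preimage Units.continuous_val

lemma isCompact_unitSet : IsCompact (unitSet K) := by
  -- The units of a compact submonoid of K form a compact subset of Kˣ; here the submonoid is 𝒪_K.
  let S : Submonoid K := (𝒪[K]).toSubmonoid
  have hS : IsCompact (S : Set K) := IsNonarchimedeanLocalField.isCompact_closedBall K 1
  convert! Submonoid.units_isCompact hS using 1
  ext u
  have hu : valuation K (u : K) ≠ 0 := by simp
  rw [SetLike.mem_coe, Submonoid.mem_units_iff]
  change valuation K (u : K) = 1 ↔ valuation K (u : K) ≤ 1 ∧ valuation K ((u⁻¹ : Kˣ) : K) ≤ 1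
  rw [Units.val_inv_eq_inv_val, map_inv₀, inv_le_one₀ (zero_lt_iff.mpr hu)]
  exact le_antisymm_iff

/-- The group of units `u ∈ 𝒪_K^×` with `u ≡ 1` modulo `𝔭_K ^ r`, as a set. -/
def higherUnits (r : ℕ) : Set Kˣ :=
  {u | valuation K (u : K) = 1 ∧ valuation K ((u : K) - 1) ≤ unifVal K ^ r}

lemma higherUnits_zero : higherUnits K 0 = unitSet K := by
  ext u
  refine ⟨fun h => h.1, fun h => ⟨h, ?_⟩⟩
  have hu : valuation K (u : K) = 1 := h
  rw [pow_zero]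
  refine ((valuation K).map_sub _ _).trans ?_
  rw [hu, map_one, max_self]

variable {K} in
lemma valuation_eq_of_sub_lt {x y : K} (h : valuation K (x - y) < valuation K y) :
    valuation K x = valuation K y := by
  have := (valuation K).map_add_eq_of_lt_left h
  rwa [add_sub_cancel] at this

variable {K} in
lemma valuation_eq_one_of_sub_lt {x : K} (h : valuation K (x - 1) < 1) : valuation K x = 1 := by
  rw [← map_one (valuation K)] at h
  rw [valuation_eq_of_sub_lt h, map_one]

lemma unifVal_pow_lt_one {r : ℕ} (hr : r ≠ 0) : unifVal K ^ r < 1 :=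
  pow_lt_one₀ zero_le unifVal_lt_one hr

variable [MeasurableSpace Kˣ] [BorelSpace Kˣ]

lemma measurableSet_higherUnits (r : ℕ) : MeasurableSet (higherUnits K r) := by
  refine IsOpen.measurableSet (IsOpen.inter (isOpen_unitSet K) ?_)
  exact (isOpen_valuation_le (pow_ne_zero r (unifVal_ne_zero K))).preimage
    (Units.continuous_val.sub continuous_const)

lemma mulHaar_unitSet : mulHaar K (unitSet K) = 1 := by
  have hpos : Measure.haar (unitSet K) ≠ 0 :=
    (IsOpen.measure_pos _ (isOpen_unitSet K) ⟨1, by simp [unitSet]⟩).ne'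
  have hfin : Measure.haar (unitSet K) ≠ ⊤ := (isCompact_unitSet K).measure_lt_top.ne
  rw [mulHaar, Measure.smul_apply, smul_eq_mul, ENNReal.inv_mul_cancel hpos hfin]

/-- The translates of a set of units, described by division, have the same volume. -/
lemma mulHaar_preimage (w : Kˣ) (A : Set Kˣ) : mulHaar K {u | w⁻¹ * u ∈ A} = mulHaar K A :=
  measure_preimage_mul (mulHaar K) w⁻¹ A

/-- The cosets of 1 + 𝔭 in the unit group correspond to the q - 1 non-zero residue classes. -/
lemma mulHaar_unitSet_eq : (1 : ENNReal) = (resCard K - 1 : ℕ) * mulHaar K (higherUnits K 1) := by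
  rw [← mulHaar_unitSet K]
  have hcard : resCard K - 1 = Nat.card {i : 𝓀[K] // i ≠ 0} := by
    have := Fintype.ofFinite 𝓀[K]
    classical
    rw [resCard, Nat.card_eq_fintype_card, Nat.card_eq_fintype_card,
      Fintype.card_subtype_compl, Fintype.card_subtype_eq]
  have hrep : ∀ i : {i : 𝓀[K] // i ≠ 0}, residueRep i.1 ≠ 0 := fun i h => by
    have := (residueRep_unit_iff i.1).mpr i.2
    rw [h, map_zero] at this
    exact zero_ne_one this
  have hmem : ∀ (i : {i : 𝓀[K] // i ≠ 0}) (u : Kˣ),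
      (Units.mk0 _ (hrep i))⁻¹ * u ∈ higherUnits K 1 ↔
        valuation K ((u : K) - residueRep i.1) ≤ unifVal K := by
    intro i u
    have h1 := (residueRep_unit_iff i.1).mpr i.2
    have heq : (((Units.mk0 _ (hrep i))⁻¹ * u : Kˣ) : K) - 1 =
        (residueRep i.1)⁻¹ * (u - residueRep i.1) := by
      rw [Units.val_mul, Units.val_inv_eq_inv_val, Units.val_mk0, mul_sub,
        inv_mul_cancel₀ (hrep i)]
    have hval : valuation K ((((Units.mk0 _ (hrep i))⁻¹ * u : Kˣ) : K) - 1) =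
        valuation K ((u : K) - residueRep i.1) := by
      rw [heq, map_mul, map_inv₀, h1, inv_one, one_mul]
    rw [← hval]
    refine ⟨fun h => by simpa using h.2, fun h => ⟨?_, by simpa using h⟩⟩
    exact valuation_eq_one_of_sub_lt (h.trans_lt unifVal_lt_one)
  rw [hcard]
  refine measure_eq_card_mul
    (B := fun i : {i : 𝓀[K] // i ≠ 0} =>
      {u | (Units.mk0 _ (hrep i))⁻¹ * u ∈ higherUnits K 1}) (fun i => ?_)
    (fun i => mulHaar_preimage K _ _) (fun u hu => ?_) (fun i u hu => ?_)
  · exact (measurable_const_mul _) (measurableSet_higherUnits K 1)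
  · have hu' : valuation K (u : K) = 1 := hu
    simp only [Set.mem_ofPred_eq, hmem]
    obtain ⟨i, hi, huniq⟩ := existsUnique_residueRep hu'.le
    refine ⟨⟨i, (residueRep_unit_iff i).mp ?_⟩, hi, fun j hj => Subtype.ext (huniq j.1 hj)⟩
    rw [← hu']
    refine valuation_eq_of_sub_lt ?_
    rw [← Valuation.map_neg, neg_sub, hu']
    exact hi.trans_lt unifVal_lt_one
  · simp only [Set.mem_ofPred_eq, hmem] at hu
    have h1 := (residueRep_unit_iff i.1).mpr i.2
    change valuation K (u : K) = 1
    rw [← h1]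
    refine valuation_eq_of_sub_lt ?_
    rw [h1]
    exact hu.trans_lt unifVal_lt_one

/-- The elements 1 + ϖ^r i, with i running over residue representatives, represent (1 + 𝔭^r) / (1 +
𝔭^{r+1}). For r = 0 some of them would fail to be units, which is why that layer is treated
separately. -/
lemma mulHaar_higherUnits_succ {r : ℕ} (hr : r ≠ 0) :
    mulHaar K (higherUnits K r) = resCard K * mulHaar K (higherUnits K (r + 1)) := by
  have hϖ := uniformiser_ne_zero K
  set t : K := (uniformiser K : K) ^ r with ht
  have hvt : valuation K t = unifVal K ^ r := by rw [ht, map_pow, unifVal]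
  have ht0 : t ≠ 0 := pow_ne_zero r hϖ
  have hsmall : ∀ i : 𝓀[K], valuation K (1 + t * residueRep i - 1) ≤ unifVal K ^ r := fun i => by
    rw [add_sub_cancel_left, map_mul, hvt]
    exact mul_le_of_le_one_right' (valuation_residueRep_le i)
  have hone : ∀ i : 𝓀[K], valuation K (1 + t * residueRep i) = 1 := fun i =>
    valuation_eq_one_of_sub_lt ((hsmall i).trans_lt (unifVal_pow_lt_one K hr))
  have hrep : ∀ i : 𝓀[K], 1 + t * residueRep i ≠ 0 := fun i h => by
    have := hone i
    rw [h, map_zero] at this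
    exact zero_ne_one this
  have hmem : ∀ (i : 𝓀[K]) (u : Kˣ),
      (Units.mk0 _ (hrep i))⁻¹ * u ∈ higherUnits K (r + 1) ↔
        valuation K (((u : K) - 1) / t - residueRep i) ≤ unifVal K := by
    intro i u
    have heq : (((Units.mk0 _ (hrep i))⁻¹ * u : Kˣ) : K) - 1 =
        (1 + t * residueRep i)⁻¹ * (t * (((u : K) - 1) / t - residueRep i)) := by
      rw [Units.val_mul, Units.val_inv_eq_inv_val, Units.val_mk0, eq_inv_mul_iff_mul_eq₀ (hrep i),
        mul_sub, mul_inv_cancel_left₀ (hrep i)]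
      field_simp
      ring
    have hval : valuation K ((((Units.mk0 _ (hrep i))⁻¹ * u : Kˣ) : K) - 1) =
        unifVal K ^ r * valuation K (((u : K) - 1) / t - residueRep i) := by
      rw [heq, map_mul, map_inv₀, hone, inv_one, one_mul, map_mul, hvt]
    have hpos : 0 < unifVal K ^ r := pow_pos (unifVal_pos K) r
    have hiff : valuation K ((((Units.mk0 _ (hrep i))⁻¹ * u : Kˣ) : K) - 1) ≤ unifVal K ^ (r + 1) ↔
        valuation K (((u : K) - 1) / t - residueRep i) ≤ unifVal K := by
      rw [hval, pow_succ, mul_le_mul_iff_right₀ hpos]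
    refine ⟨fun h => hiff.mp h.2, fun h => ⟨?_, hiff.mpr h⟩⟩
    exact valuation_eq_one_of_sub_lt
      ((hiff.mpr h).trans_lt (unifVal_pow_lt_one K (Nat.succ_ne_zero r)))
  refine measure_eq_card_mul
    (B := fun i : 𝓀[K] => {u | (Units.mk0 _ (hrep i))⁻¹ * u ∈ higherUnits K (r + 1)}) (fun i => ?_)
    (fun i => mulHaar_preimage K _ _) (fun u hu => ?_) (fun i u hu => ?_)
  · exact (measurable_const_mul _) (measurableSet_higherUnits K (r + 1))
  · simp only [Set.mem_ofPred_eq, hmem]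
    refine existsUnique_residueRep ?_
    rw [map_div₀, hvt]
    exact div_le_one_of_le₀ hu.2 zero_le
  · simp only [Set.mem_ofPred_eq, hmem] at hu
    have h1 : valuation K ((u : K) - 1) ≤ unifVal K ^ r := by
      have : (u : K) - 1 = t * ((((u : K) - 1) / t - residueRep i) + residueRep i) := by
        field_simp
        ring
      rw [this, map_mul, hvt]
      refine mul_le_of_le_one_right' (((valuation K).map_add _ _).trans (max_le ?_ ?_))
      · exact hu.trans unifVal_lt_one.le
      · exact valuation_residueRep_le i
    exact ⟨valuation_eq_one_of_sub_lt (h1.trans_lt (unifVal_pow_lt_one K hr)), h1⟩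

lemma mulHaar_higherUnits (r : ℕ) :
    mulHaar K (higherUnits K (r + 1)) =
      ENNReal.ofReal ((((resCard K : ℝ) - 1) * (resCard K : ℝ) ^ r)⁻¹) := by
  have hq : (1 : ℝ) < resCard K := by exact_mod_cast one_lt_resCard K
  have hq0 : (0 : ℝ) < resCard K := by linarith
  induction r with
  | zero =>
    have h := mulHaar_unitSet_eq K
    rw [pow_zero, mul_one, ENNReal.ofReal_inv_of_pos (by linarith)]
    have hcast : ((resCard K - 1 : ℕ) : ENNReal) = ENNReal.ofReal ((resCard K : ℝ) - 1) := by
      rw [← ENNReal.ofReal_natCast, Nat.cast_sub (one_lt_resCard K).le, Nat.cast_one]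
    rw [hcast, mul_comm] at h
    exact ENNReal.eq_inv_of_mul_eq_one_left h.symm
  | succ r ih =>
    have h := mulHaar_higherUnits_succ K (Nat.succ_ne_zero r)
    rw [ih, ← ENNReal.ofReal_natCast] at h
    have hq' : ENNReal.ofReal (resCard K : ℝ) ≠ 0 := by simpa using hq0.ne'
    have h2 : ENNReal.ofReal (resCard K : ℝ) *
        ENNReal.ofReal ((((resCard K : ℝ) - 1) * (resCard K : ℝ) ^ (r + 1))⁻¹) =
          ENNReal.ofReal ((((resCard K : ℝ) - 1) * (resCard K : ℝ) ^ r)⁻¹) := by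
      rw [← ENNReal.ofReal_mul hq0.le]
      congr 1
      have : (resCard K : ℝ) - 1 ≠ 0 := by linarith
      field_simp
      ring
    rw [← h2] at h
    exact ((ENNReal.mul_right_inj hq' ENNReal.ofReal_ne_top).mp h).symm

/-- The units of valuation `n`. -/
def shell (n : ℤ) : Set Kˣ := {u | valuation K (u : K) = unifVal K ^ n}

lemma measurableSet_shell (n : ℤ) : MeasurableSet (shell K n) :=
  ((isOpen_valuation_eq (zpow_ne_zero n (unifVal_ne_zero K))).preimage
    Units.continuous_val).measurableSet

lemma mulHaar_shell (n : ℤ) : mulHaar K (shell K n) = 1 := by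
  rw [← mulHaar_unitSet K, ← mulHaar_preimage K (uniformiserUnit K ^ n) (unitSet K)]
  congr 1
  ext u
  have hpos : unifVal K ^ n ≠ 0 := zpow_ne_zero n (unifVal_ne_zero K)
  have h : valuation K (((uniformiserUnit K ^ n)⁻¹ * u : Kˣ) : K) =
      (unifVal K ^ n)⁻¹ * valuation K (u : K) := by
    rw [Units.val_mul, Units.val_inv_eq_inv_val, Units.val_zpow_eq_zpow_val, map_mul, map_inv₀,
      map_zpow₀]
    rfl
  change _ = _ ↔ valuation K _ = 1
  rw [h, inv_mul_eq_one₀ hpos, eq_comm]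

lemma shell_disjoint (m : ℤ) :
    Pairwise (Function.onFun Disjoint fun n : ℕ => shell K (m + n)) := by
  intro i j hij
  refine Set.disjoint_left.mpr fun u hi hj => hij ?_
  have := unifVal_zpow_inj.mp (Eq.trans (Eq.symm hi) hj : unifVal K ^ (m + i) = unifVal K ^ (m + j))
  omega

/-- The integral of a function supported on elements of valuation at least `m` and constant on each
shell. -/
lemma integral_mulHaar_of_shells {m : ℤ} {f : Kˣ → ℂ} {c : ℕ → ℂ}
    (hf : ∀ n : ℕ, ∀ u ∈ shell K (m + n), f u = c n)
    (h0 : ∀ n < m, ∀ u ∈ shell K n, f u = 0) (hs : Summable fun n => ‖c n‖) :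
    Integrable f (mulHaar K) ∧ ∫ u, f u ∂(mulHaar K) = ∑' n, c n := by
  have := integrable_and_integral_eq_tsum (μ := mulHaar K) (S := fun n : ℕ => shell K (m + n))
    (w := fun _ => 1) (c := c) (f := f) (fun n => measurableSet_shell K _) (shell_disjoint K m)
    (fun _ => zero_le_one) (fun n => by rw [mulHaar_shell, ENNReal.ofReal_one]) hf
    (fun u hu => ?_) (by simpa using hs)
  · simpa using this
  · obtain ⟨k, hk⟩ := exists_valuation_eq_zpow u.ne_zero
    rcases lt_or_ge k m with hlt | hge
    · exact h0 k hlt u hk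
    · obtain ⟨n, rfl⟩ : ∃ n : ℕ, k = m + n := ⟨(k - m).toNat, by omega⟩
      exact absurd hk (hu n)

end LocalField

/-! ### The space of cosets `Z_H N_H \ H` -/

section Coset

variable {K : Type*} [Field K] [ValuativeRel K] [TopologicalSpace K] [IsNonarchimedeanLocalField K]

/-- The matrix `(x 0; 0 1)`. -/
abbrev diagH (x : Kˣ) : GL (Fin 2) K :=
  Matrix.GeneralLinearGroup.mkOfDetNeZero !![(x : K), 0; 0, 1] (by simp)

/-- The matrix `(1 0; y 1)`. -/
abbrev lowerH (y : K) : GL (Fin 2) K :=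
  Matrix.GeneralLinearGroup.mkOfDetNeZero !![1, 0; y, 1] (by simp)

/-- The matrix `(0 1; 1 0)`. -/
abbrev swapH : GL (Fin 2) K :=
  Matrix.GeneralLinearGroup.mkOfDetNeZero !![0, 1; 1, 0] (by simp)

lemma det_ne_zero (h : GL (Fin 2) K) : (h : Matrix (Fin 2) (Fin 2) K).det ≠ 0 :=
  ((Matrix.isUnit_iff_isUnit_det _).mp h.isUnit).ne_zero

lemma mul_entry (g h : GL (Fin 2) K) (i j : Fin 2) :
    (g * h) i j = g i 0 * h 0 j + g i 1 * h 1 j := by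
  rw [Units.val_mul, Matrix.mul_apply, Fin.sum_univ_two]

lemma det_mul_coe (g h : GL (Fin 2) K) : ((g * h : GL (Fin 2) K) : Matrix (Fin 2) (Fin 2) K).det =
    (g : Matrix (Fin 2) (Fin 2) K).det * (h : Matrix (Fin 2) (Fin 2) K).det := by
  rw [Units.val_mul, Matrix.det_mul]

lemma det_eq (h : GL (Fin 2) K) : (h : Matrix (Fin 2) (Fin 2) K).det =
    h 0 0 * h 1 1 - h 0 1 * h 1 0 := Matrix.det_fin_two _

lemma row_ne_zero (h : GL (Fin 2) K) : h 1 0 ≠ 0 ∨ h 1 1 ≠ 0 := by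
  by_contra! hc
  exact det_ne_zero h (by rw [det_eq, hc.1, hc.2]; ring)

/-- Two matrices with proportional bottom rows, and the corresponding determinants, differ by an
element of `Z_H N_H`. -/
lemma exists_centreUnipotent_mul {g h : GL (Fin 2) K} {δ : K} (h0 : h 1 0 = δ * g 1 0)
    (h1 : h 1 1 = δ * g 1 1) (hdet : (h : Matrix (Fin 2) (Fin 2) K).det =
      δ ^ 2 * (g : Matrix (Fin 2) (Fin 2) K).det) :
    ∃ z ∈ centreUnipotent K, h = z * g := by
  have hg := det_ne_zero g
  have hδ : δ ≠ 0 := by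
    rintro rfl
    exact det_ne_zero h (by rw [hdet]; ring)
  obtain ⟨z, hz⟩ : ∃ z, h = z * g := ⟨h * g⁻¹, by simp⟩
  have e10 : z 1 0 * g 0 0 + z 1 1 * g 1 0 = δ * g 1 0 := by rw [← mul_entry, ← hz, h0]
  have e11 : z 1 0 * g 0 1 + z 1 1 * g 1 1 = δ * g 1 1 := by rw [← mul_entry, ← hz, h1]
  have hdz : (z : Matrix (Fin 2) (Fin 2) K).det = δ ^ 2 := by
    rw [hz, det_mul_coe] at hdet
    exact mul_right_cancel₀ hg hdet
  have hz10 : z 1 0 = 0 := by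
    refine (mul_eq_zero.mp ?_).resolve_right hg
    rw [det_eq]
    linear_combination g 1 1 * e10 - g 1 0 * e11
  have hz11 : z 1 1 = δ := by
    refine sub_eq_zero.mp ((mul_eq_zero.mp ?_).resolve_right hg)
    rw [det_eq]
    linear_combination g 0 0 * e11 - g 0 1 * e10
  refine ⟨z, ⟨hz10, ?_⟩, hz⟩
  rw [det_eq, hz10, hz11] at hdz
  rw [hz11]
  exact mul_right_cancel₀ hδ (by linear_combination hdz)

/-- The matrices in `Z_H N_H (x 0; 0 1) K_1(𝔭^r)`, where `x` has valuation `n`, described by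
their bottom row and determinant. -/
def cellSet (n : ℤ) (r : ℕ) : Set (GL (Fin 2) K) :=
  {h | valuation K (h : Matrix (Fin 2) (Fin 2) K).det =
      max (valuation K (h 1 0)) (valuation K (h 1 1)) ^ 2 * unifVal K ^ n ∧
    (r = 0 ∨ valuation K (h 1 0) ≤ valuation K (h 1 1) * unifVal K ^ r)}

lemma cellSet_zero_iff {n : ℤ} {h : GL (Fin 2) K} : h ∈ cellSet n 0 ↔
    valuation K (h : Matrix (Fin 2) (Fin 2) K).det =
      max (valuation K (h 1 0)) (valuation K (h 1 1)) ^ 2 * unifVal K ^ n :=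
  and_iff_left (Or.inl rfl)

lemma cellSet_iff {n : ℤ} {r : ℕ} (hr : r ≠ 0) {h : GL (Fin 2) K} : h ∈ cellSet n r ↔
    valuation K (h : Matrix (Fin 2) (Fin 2) K).det = valuation K (h 1 1) ^ 2 * unifVal K ^ n ∧
      valuation K (h 1 0) ≤ valuation K (h 1 1) * unifVal K ^ r := by
  rw [cellSet, Set.mem_ofPred_eq, or_iff_right hr]
  refine and_congr_left fun hle => ?_
  rw [max_eq_right (hle.trans (mul_le_of_le_one_right' (unifVal_pow_lt_one K hr).le))]

/-- An element of Z_H N_H with diagonal entry δ scales the bottom row by δ and the determinant by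
δ², and both defining conditions are homogeneous for this scaling. -/
lemma mul_mem_cellSet {z h : GL (Fin 2) K} (hz : z ∈ centreUnipotent K) {n : ℤ} {r : ℕ} :
    z * h ∈ cellSet n r ↔ h ∈ cellSet n r := by
  obtain ⟨h10, h00⟩ := hz
  have hdet : (z : Matrix (Fin 2) (Fin 2) K).det = z 1 1 ^ 2 := by
    rw [det_eq, h10, h00]; ring
  have hz0 : z 1 1 ≠ 0 := fun h0 => det_ne_zero z (by rw [hdet, h0]; ring)
  have hv : 0 < valuation K (z 1 1) := zero_lt_iff.mpr (by simpa using hz0)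
  have e : ∀ j, (z * h) 1 j = z 1 1 * h 1 j := fun j => by rw [mul_entry, h10]; ring
  rw [cellSet, Set.mem_ofPred_eq, Set.mem_ofPred_eq, e, e, det_mul_coe, hdet, map_mul, map_mul,
    map_mul, map_pow, ← mul_max, mul_pow, mul_assoc, mul_assoc,
    mul_le_mul_iff_right₀ hv, mul_right_inj' (pow_ne_zero 2 hv.ne')]

/-- The valuation is locally constant away from 0, and so is the maximum over a non-zero bottom row.
Openness gives measurability of the cells in the quotient. -/
lemma isOpen_cellSet (n : ℤ) (r : ℕ) : IsOpen (cellSet n r : Set (GL (Fin 2) K)) := by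
  have hent : ∀ i j, Continuous fun h : GL (Fin 2) K => h i j := fun i j =>
    Units.continuous_val.matrix_elem i j
  have hdetc : Continuous fun h : GL (Fin 2) K => (h : Matrix (Fin 2) (Fin 2) K).det := by
    simp only [det_eq]
    exact ((hent 0 0).mul (hent 1 1)).sub ((hent 0 1).mul (hent 1 0))
  have hπ := unifVal_ne_zero K
  rw [isOpen_iff_mem_nhds]
  intro h hh
  set M := max (valuation K (h 1 0)) (valuation K (h 1 1)) with hM
  have hM0 : M ≠ 0 := by
    rcases row_ne_zero h with h' | h'
    · exact ((zero_lt_iff.mpr (by simpa using h')).trans_le (le_max_left _ _)).ne'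
    · exact ((zero_lt_iff.mpr (by simpa using h')).trans_le (le_max_right _ _)).ne'
  have hdet0 : valuation K (h : Matrix (Fin 2) (Fin 2) K).det ≠ 0 := by
    simpa using det_ne_zero h
  have hA : ∀ᶠ g : GL (Fin 2) K in nhds h, valuation K (g : Matrix (Fin 2) (Fin 2) K).det =
      valuation K (h : Matrix (Fin 2) (Fin 2) K).det :=
    ((isOpen_valuation_eq hdet0).preimage hdetc).mem_nhds rfl
  by_cases hr : r = 0
  · have hB : ∀ᶠ g in nhds h, max (valuation K (g 1 0)) (valuation K (g 1 1)) = M := by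
      have h1 : ∀ j, valuation K (h 1 j) ≤ M → ∀ᶠ g in nhds h, valuation K ((g : GL (Fin 2) K) 1 j) ≤ M :=
        fun j hj => ((isOpen_valuation_le hM0).preimage (hent 1 j)).mem_nhds hj
      have h2 : ∀ j, valuation K (h 1 j) = M → ∀ᶠ g in nhds h, valuation K ((g : GL (Fin 2) K) 1 j) = M :=
        fun j hj => ((isOpen_valuation_eq hM0).preimage (hent 1 j)).mem_nhds hj
      rcases max_choice (valuation K (h 1 0)) (valuation K (h 1 1)) with hc | hc
      · filter_upwards [h2 0 hc.symm, h1 1 (le_max_right _ _)] with g hg0 hg1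
        rw [hg0, max_eq_left hg1]
      · filter_upwards [h2 1 hc.symm, h1 0 (le_max_left _ _)] with g hg1 hg0
        rw [hg1, max_eq_right hg0]
    filter_upwards [hA, hB] with g hgA hgB
    exact ⟨by rw [hgA, hgB]; exact hh.1, Or.inl hr⟩
  · obtain ⟨h1, h2⟩ := (cellSet_iff hr).mp hh
    have hd0 : valuation K (h 1 1) ≠ 0 := fun h0 => hdet0 (by rw [h1, h0]; simp)
    have hB : ∀ᶠ g in nhds h, valuation K ((g : GL (Fin 2) K) 1 1) = valuation K (h 1 1) :=
      ((isOpen_valuation_eq hd0).preimage (hent 1 1)).mem_nhds rfl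
    have hC : ∀ᶠ g in nhds h, valuation K ((g : GL (Fin 2) K) 1 0) ≤
        valuation K (h 1 1) * unifVal K ^ r :=
      ((isOpen_valuation_le (mul_ne_zero hd0 (pow_ne_zero r hπ))).preimage (hent 1 0)).mem_nhds h2
    filter_upwards [hA, hB, hC] with g hgA hgB hgC
    exact (cellSet_iff hr).mpr ⟨by rw [hgA, hgB, h1], by rw [hgB]; exact hgC⟩

/-- The image of `cellSet n r` in `Z_H N_H \ H`. -/
def cell (n : ℤ) (r : ℕ) : Set (CosetSpace K) := toCoset '' cellSet n r

lemma toCoset_eq_iff {g h : GL (Fin 2) K} :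
    toCoset g = toCoset h ↔ ∃ z ∈ centreUnipotent K, h = z * g := by
  have : toCoset g = toCoset h ↔ h * g⁻¹ ∈ centreUnipotent K := by
    exact Quotient.eq.trans QuotientGroup.rightRel_apply
  rw [this]
  refine ⟨fun hz => ⟨_, hz, by simp⟩, ?_⟩
  rintro ⟨z, hz, rfl⟩
  simpa using hz

lemma toCoset_mem_cell {h : GL (Fin 2) K} {n : ℤ} {r : ℕ} :
    toCoset h ∈ cell n r ↔ h ∈ cellSet n r := by
  refine ⟨?_, fun hh => ⟨h, hh, rfl⟩⟩
  rintro ⟨g, hg, hgh⟩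
  obtain ⟨z, hz, rfl⟩ := toCoset_eq_iff.mp hgh
  exact (mul_mem_cellSet hz).mpr hg

lemma toCoset_surjective : Function.Surjective (toCoset : GL (Fin 2) K → CosetSpace K) :=
  Quotient.exists_rep

lemma rightTranslate_toCoset (g h : GL (Fin 2) K) :
    rightTranslate g (toCoset h) = toCoset (h * g) := rfl

lemma measurableSet_cell (n : ℤ) (r : ℕ) : MeasurableSet (cell n r : Set (CosetSpace K)) := by
  refine IsOpen.measurableSet ?_
  change IsOpen ((toCoset : GL (Fin 2) K → CosetSpace K) ⁻¹' cell n r)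
  convert! isOpen_cellSet (K := K) n r using 1
  ext h
  exact toCoset_mem_cell

lemma continuous_rightTranslate (g : GL (Fin 2) K) : Continuous (rightTranslate g) := by
  have h : Continuous fun x : GL (Fin 2) K => x * g := continuous_id.mul continuous_const
  exact h.quotient_map' _

variable {μ : Measure (CosetSpace K)}

lemma IsUnramifiedInvariant.measure_preimage (hμ : IsUnramifiedInvariant μ) (g : GL (Fin 2) K)
    {A : Set (CosetSpace K)} (hA : MeasurableSet A) : μ (rightTranslate g ⁻¹' A) = μ A := by
  conv_rhs => rw [← hμ.invariant g]
  rw [Measure.map_apply (continuous_rightTranslate g).measurable hA]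

/-- Right multiplication by diag(ϖ, 1) multiplies the entry c and the determinant by ϖ and fixes d.
With r ≥ 1 the entry d dominates the bottom row, so the translate is again a cell. -/
lemma IsUnramifiedInvariant.cell_shift (hμ : IsUnramifiedInvariant μ) (n : ℤ) {r : ℕ}
    (hr : r ≠ 0) : μ (cell (n + 1) (r + 1)) = μ (cell n r) := by
  rw [← hμ.measure_preimage (diagH (uniformiserUnit K)) (measurableSet_cell _ _)]
  congr 1
  ext x
  obtain ⟨h, rfl⟩ := toCoset_surjective x
  have hπ := unifVal_pos K
  have hu : valuation K (uniformiserUnit K : K) = unifVal K := rfl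
  have hdet : valuation K (diagH (uniformiserUnit K) : Matrix (Fin 2) (Fin 2) K).det =
      unifVal K := by
    rw [← hu]; simp [Matrix.det_fin_two]
  have e0 : (h * diagH (uniformiserUnit K)) 1 0 = h 1 0 * (uniformiserUnit K : K) := by
    rw [mul_entry]; simp
  have e1 : (h * diagH (uniformiserUnit K)) 1 1 = h 1 1 := by
    rw [mul_entry]; simp
  rw [Set.mem_preimage, rightTranslate_toCoset, toCoset_mem_cell, toCoset_mem_cell,
    cellSet_iff (Nat.succ_ne_zero r), cellSet_iff hr, e0, e1, det_mul_coe, map_mul, map_mul, hu,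
    hdet, pow_succ (unifVal K) r, zpow_add₀ hπ.ne', _root_.zpow_one, ← mul_assoc, ← mul_assoc,
    mul_left_inj' hπ.ne', mul_le_mul_iff_left₀ hπ]

lemma lowerH_mul (h : GL (Fin 2) K) (y : K) :
    (h * lowerH y) 1 0 = h 1 0 + h 1 1 * y ∧ (h * lowerH y) 1 1 = h 1 1 ∧
      ((h * lowerH y : GL (Fin 2) K) : Matrix (Fin 2) (Fin 2) K).det =
        (h : Matrix (Fin 2) (Fin 2) K).det := by
  refine ⟨?_, ?_, ?_⟩
  · rw [mul_entry]; simp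
  · rw [mul_entry]; simp
  · rw [det_mul_coe]; simp [Matrix.det_fin_two]

/-- Within a cell, c / (d ϖ^r) is integral. Its residue class decides which of the q lower unipotent
translates of the smaller cell contains the point. -/
lemma IsUnramifiedInvariant.cell_succ (hμ : IsUnramifiedInvariant μ) (n : ℤ) {r : ℕ}
    (hr : r ≠ 0) : μ (cell n r) = resCard K * μ (cell n (r + 1)) := by
  set t : K := (uniformiser K : K) ^ r with ht
  have hvt : valuation K t = unifVal K ^ r := by rw [ht, map_pow, unifVal]
  have ht0 : t ≠ 0 := pow_ne_zero r (uniformiser_ne_zero K)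
  have hπ := unifVal_pos K
  have hd : ∀ {h : GL (Fin 2) K}, valuation K (h : Matrix (Fin 2) (Fin 2) K).det =
      valuation K (h 1 1) ^ 2 * unifVal K ^ n → h 1 1 ≠ 0 := by
    intro h hh h0
    rw [h0, map_zero, zero_pow two_ne_zero, zero_mul, map_eq_zero] at hh
    exact det_ne_zero h hh
  have hmem : ∀ (i : 𝓀[K]) (h : GL (Fin 2) K),
      toCoset h ∈ rightTranslate (lowerH (-(t * residueRep i))) ⁻¹' cell n (r + 1) ↔
        valuation K (h : Matrix (Fin 2) (Fin 2) K).det = valuation K (h 1 1) ^ 2 * unifVal K ^ n ∧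
          valuation K (h 1 0 / (h 1 1 * t) - residueRep i) ≤ unifVal K := by
    intro i h
    obtain ⟨e0, e1, e2⟩ := lowerH_mul h (-(t * residueRep i))
    rw [Set.mem_preimage, rightTranslate_toCoset, toCoset_mem_cell,
      cellSet_iff (Nat.succ_ne_zero r), e0, e1, e2]
    refine and_congr_right fun hh => ?_
    have hd0 := hd hh
    have hpos : 0 < valuation K (h 1 1 * t) := zero_lt_iff.mpr (by simp [hd0, ht0])
    have heq : h 1 0 + h 1 1 * -(t * residueRep i) =
        (h 1 1 * t) * (h 1 0 / (h 1 1 * t) - residueRep i) := by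
      field_simp
      ring
    rw [heq, map_mul _ (h 1 1 * t), pow_succ, ← mul_assoc, ← hvt,
      ← map_mul _ (h 1 1) t,
      mul_le_mul_iff_right₀ hpos]
  refine measure_eq_card_mul
    (B := fun i : 𝓀[K] => rightTranslate (lowerH (-(t * residueRep i))) ⁻¹' cell n (r + 1))
    (fun i => (continuous_rightTranslate _).measurable (measurableSet_cell _ _))
    (fun i => hμ.measure_preimage _ (measurableSet_cell _ _)) (fun x hx => ?_) (fun i x hx => ?_)
  · obtain ⟨h, rfl⟩ := toCoset_surjective x
    obtain ⟨h1, h2⟩ := (cellSet_iff hr).mp (toCoset_mem_cell.mp hx)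
    simp only [hmem, h1, true_and]
    refine existsUnique_residueRep ?_
    rw [map_div₀, map_mul, hvt]
    exact div_le_one_of_le₀ h2 zero_le
  · obtain ⟨h, rfl⟩ := toCoset_surjective x
    obtain ⟨h1, h2⟩ := (hmem i h).mp hx
    have hd0 := hd h1
    refine toCoset_mem_cell.mpr ((cellSet_iff hr).mpr ⟨h1, ?_⟩)
    have heq : h 1 0 = h 1 1 * t * ((h 1 0 / (h 1 1 * t) - residueRep i) + residueRep i) := by
      field_simp
      ring
    rw [heq, map_mul, map_mul, hvt]
    refine mul_le_of_le_one_right' (((valuation K).map_add _ _).trans (max_le ?_ ?_))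
    · exact h2.trans unifVal_lt_one.le
    · exact valuation_residueRep_le i

/-- The bottom row defines a point (c : d) of the projective line, and its reduction selects one of
q + 1 translates of the cell with r = 1. -/
lemma IsUnramifiedInvariant.cell_zero (hμ : IsUnramifiedInvariant μ) (n : ℤ) :
    μ (cell n 0) = (resCard K + 1 : ℕ) * μ (cell n 1) := by
  have hπ := unifVal_pos K
  have hcard : resCard K + 1 = Nat.card (Option 𝓀[K]) := (Finite.card_option).symm
  -- The value `none` is the point with d ≡ 0, where c is the dominant entry and the swap brings it
  -- into the second column.
  let g : Option 𝓀[K] → GL (Fin 2) K := fun o => o.elim swapH fun i => lowerH (-residueRep i)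
  have hnone : ∀ h : GL (Fin 2) K, toCoset h ∈ rightTranslate (g none) ⁻¹' cell n 1 ↔
      valuation K (h : Matrix (Fin 2) (Fin 2) K).det = valuation K (h 1 0) ^ 2 * unifVal K ^ n ∧
        valuation K (h 1 1) ≤ valuation K (h 1 0) * unifVal K := by
    intro h
    have e0 : (h * swapH : GL (Fin 2) K) 1 0 = h 1 1 := by rw [mul_entry]; simp
    have e1 : (h * swapH : GL (Fin 2) K) 1 1 = h 1 0 := by rw [mul_entry]; simp
    have e2 : valuation K ((h * swapH : GL (Fin 2) K) : Matrix (Fin 2) (Fin 2) K).det =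
        valuation K (h : Matrix (Fin 2) (Fin 2) K).det := by
      rw [det_mul_coe, map_mul]; simp [Matrix.det_fin_two]
    change toCoset (h * swapH) ∈ cell n 1 ↔ _
    rw [toCoset_mem_cell, cellSet_iff one_ne_zero, e0, e1, e2, pow_one]
  have hsome : ∀ (i : 𝓀[K]) (h : GL (Fin 2) K),
      toCoset h ∈ rightTranslate (g (some i)) ⁻¹' cell n 1 ↔
      valuation K (h : Matrix (Fin 2) (Fin 2) K).det = valuation K (h 1 1) ^ 2 * unifVal K ^ n ∧
        valuation K (h 1 0 / h 1 1 - residueRep i) ≤ unifVal K := by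
    intro i h
    obtain ⟨e0, e1, e2⟩ := lowerH_mul h (-residueRep i)
    change toCoset (h * lowerH (-residueRep i)) ∈ cell n 1 ↔ _
    rw [toCoset_mem_cell, cellSet_iff one_ne_zero, e0, e1, e2, pow_one]
    refine and_congr_right fun hh => ?_
    have hd0 : h 1 1 ≠ 0 := by
      intro h0
      rw [h0, map_zero, zero_pow two_ne_zero, zero_mul, map_eq_zero] at hh
      exact det_ne_zero h hh
    have hpos : 0 < valuation K (h 1 1) := zero_lt_iff.mpr (by simpa using hd0)
    have heq : h 1 0 + h 1 1 * -residueRep i = h 1 1 * (h 1 0 / h 1 1 - residueRep i) := by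
      field_simp
      ring
    rw [heq, map_mul, mul_le_mul_iff_right₀ hpos]
  have hdiv : ∀ (i : 𝓀[K]) (h : GL (Fin 2) K), h 1 1 ≠ 0 →
      valuation K (h 1 0 / h 1 1 - residueRep i) ≤ unifVal K →
        valuation K (h 1 0) ≤ valuation K (h 1 1) := by
    intro i h hd0 hh
    have heq : h 1 0 = h 1 1 * ((h 1 0 / h 1 1 - residueRep i) + residueRep i) := by
      field_simp
      ring
    rw [heq, map_mul]
    refine mul_le_of_le_one_right' (((valuation K).map_add _ _).trans (max_le ?_ ?_))
    · exact hh.trans unifVal_lt_one.le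
    · exact valuation_residueRep_le i
  have hne : ∀ {h : GL (Fin 2) K} {j : Fin 2}, valuation K (h : Matrix (Fin 2) (Fin 2) K).det =
      valuation K (h 1 j) ^ 2 * unifVal K ^ n → h 1 j ≠ 0 := by
    intro h j hh h0
    rw [h0, map_zero, zero_pow two_ne_zero, zero_mul, map_eq_zero] at hh
    exact det_ne_zero h hh
  rw [hcard]
  refine measure_eq_card_mul (B := fun o => rightTranslate (g o) ⁻¹' cell n 1)
    (fun o => (continuous_rightTranslate _).measurable (measurableSet_cell _ _))
    (fun o => hμ.measure_preimage _ (measurableSet_cell _ _)) (fun x hx => ?_) (fun o x hx => ?_)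
  · obtain ⟨h, rfl⟩ := toCoset_surjective x
    have h1 := cellSet_zero_iff.mp (toCoset_mem_cell.mp hx)
    rcases le_or_gt (valuation K (h 1 0)) (valuation K (h 1 1)) with hle | hlt
    · rw [max_eq_right hle] at h1
      have hd0 := hne h1
      obtain ⟨i, hi, huniq⟩ := existsUnique_residueRep (x := h 1 0 / h 1 1) (by
        rw [map_div₀]
        exact div_le_one_of_le₀ hle zero_le)
      refine ⟨some i, (hsome i h).mpr ⟨h1, hi⟩, ?_⟩
      rintro (_ | j) hj
      · exfalso
        obtain ⟨-, h3⟩ := (hnone h).mp hj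
        have h4 : valuation K (h 1 1) * unifVal K < valuation K (h 1 1) :=
          mul_lt_of_lt_one_right (zero_lt_iff.mpr (by simpa using hd0)) unifVal_lt_one
        have h5 : valuation K (h 1 0) * unifVal K ≤ valuation K (h 1 1) * unifVal K := by gcongr
        exact absurd (h3.trans h5) (not_le.mpr h4)
      · rw [huniq j ((hsome j h).mp hj).2]
    · rw [max_eq_left hlt.le] at h1
      have hc0 : 0 < valuation K (h 1 0) := lt_of_le_of_lt zero_le hlt
      refine ⟨none, (hnone h).mpr ⟨h1, ?_⟩, ?_⟩
      · have h2 : valuation K (h 1 1 / h 1 0) ≤ unifVal K := by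
          rw [← valuation_lt_one_iff, map_div₀]
          exact (div_lt_one₀ hc0).mpr hlt
        rw [map_div₀, div_le_iff₀ hc0] at h2
        rwa [mul_comm]
      · rintro (_ | j) hj
        · rfl
        · obtain ⟨h2, h3⟩ := (hsome j h).mp hj
          exact absurd (hdiv j h (hne h2) h3) (not_le.mpr hlt)
  · obtain ⟨h, rfl⟩ := toCoset_surjective x
    refine toCoset_mem_cell.mpr (cellSet_zero_iff.mpr ?_)
    cases o with
    | none =>
      obtain ⟨h1, h2⟩ := (hnone h).mp hx
      rw [max_eq_left (h2.trans (mul_le_of_le_one_right' unifVal_lt_one.le)), h1]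
    | some i =>
      obtain ⟨h1, h2⟩ := (hsome i h).mp hx
      rw [max_eq_right (hdiv i h (hne h1) h2), h1]

variable (K) in
/-- The subgroup `K_1(𝔭^r)` of `GL₂(𝒪_K)`, as a set. -/
def congruenceSet (r : ℕ) : Set (GL (Fin 2) K) :=
  {g | ∃ k : GL (Fin 2) 𝒪[K], valuation K (k 1 0 : K) ≤ unifVal K ^ r ∧
    valuation K ((k 1 1 : K) - 1) ≤ unifVal K ^ r ∧
    Matrix.GeneralLinearGroup.map (n := Fin 2) (algebraMap 𝒪[K] K) k = g}

lemma lowerH_mem_congruenceSet {r : ℕ} {y : K} (hy : valuation K y ≤ unifVal K ^ r) :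
    lowerH y ∈ congruenceSet K r := by
  have hy1 : y ∈ 𝒪[K] := hy.trans (pow_le_one₀ zero_le unifVal_lt_one.le)
  let M : Matrix (Fin 2) (Fin 2) 𝒪[K] := !![1, 0; ⟨y, hy1⟩, 1]
  have hM : IsUnit M.det := by simp [M, Matrix.det_fin_two]
  refine ⟨Matrix.GeneralLinearGroup.mk'' M hM, hy, ?_, ?_⟩
  · change valuation K (((1 : 𝒪[K]) : K) - 1) ≤ _
    simp
  · ext i j
    fin_cases i <;> fin_cases j <;> rfl

/-- The matrix `(0 1; 1 y)`. -/
abbrev flipH (y : K) : GL (Fin 2) K :=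
  Matrix.GeneralLinearGroup.mkOfDetNeZero !![0, 1; 1, y] (by simp)

lemma flipH_mem_congruenceSet {y : K} (hy : valuation K y ≤ 1) :
    flipH y ∈ congruenceSet K 0 := by
  let M : Matrix (Fin 2) (Fin 2) 𝒪[K] := !![0, 1; 1, ⟨y, hy⟩]
  have hM : IsUnit M.det := by simp [M, Matrix.det_fin_two]
  refine ⟨Matrix.GeneralLinearGroup.mk'' M hM, ?_, ?_, ?_⟩
  · change valuation K ((1 : 𝒪[K]) : K) ≤ _
    simp
  · change valuation K (y - 1) ≤ _
    refine ((valuation K).map_sub _ _).trans (max_le ?_ ?_) <;> simp [hy]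
  · ext i j
    fin_cases i <;> fin_cases j <;> rfl

/-- A bottom row up to scaling is that of (1 0; c/d 1) if d dominates, and that of (0 1; 1 d/c) if c
does. The remaining freedom modulo Z_H N_H is the determinant, which diag(x, 1) adjusts. For r = 0
this is the Iwasawa decomposition. -/
lemma exists_decomposition {n : ℤ} {r : ℕ} {h : GL (Fin 2) K} (hh : h ∈ cellSet n r) :
    ∃ z ∈ centreUnipotent K, ∃ x ∈ shell K n, ∃ k ∈ congruenceSet K r, h = z * (diagH x * k) := by
  have key : ∀ (k : GL (Fin 2) K) (δ : K),
      valuation K (k : Matrix (Fin 2) (Fin 2) K).det = 1 → h 1 0 = δ * k 1 0 → h 1 1 = δ * k 1 1 →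
      valuation K (h : Matrix (Fin 2) (Fin 2) K).det = valuation K δ ^ 2 * unifVal K ^ n →
      ∃ z ∈ centreUnipotent K, ∃ x ∈ shell K n, h = z * (diagH x * k) := by
    intro k δ hk h0 h1 hdet
    have hδ : δ ≠ 0 := by
      rintro rfl
      rw [map_zero, zero_pow two_ne_zero, zero_mul, map_eq_zero] at hdet
      exact det_ne_zero h hdet
    have hk0 := det_ne_zero k
    -- Forced by comparing determinants in h = z · diag(x, 1) · k, where z has diagonal entry δ.
    let x : Kˣ := Units.mk0 ((h : Matrix (Fin 2) (Fin 2) K).det /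
      (δ ^ 2 * (k : Matrix (Fin 2) (Fin 2) K).det))
      (div_ne_zero (det_ne_zero h) (mul_ne_zero (pow_ne_zero 2 hδ) hk0))
    have hx : x ∈ shell K n := by
      change valuation K (_ / _) = _
      have : valuation K δ ^ 2 ≠ 0 := pow_ne_zero 2 (by simpa using hδ)
      rw [map_div₀, map_mul, hk, mul_one, hdet, map_pow, mul_div_cancel_left₀ _ this]
    have e : ∀ j, (diagH x * k) 1 j = k 1 j := fun j => by rw [mul_entry]; simp
    obtain ⟨z, hz, hzh⟩ := exists_centreUnipotent_mul (g := diagH x * k) (h := h) (δ := δ)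
      (by rw [e, h0]) (by rw [e, h1]) (by
        rw [det_mul_coe]
        have : (diagH x : Matrix (Fin 2) (Fin 2) K).det = x := by simp [Matrix.det_fin_two]
        rw [this, Units.val_mk0]
        field_simp)
    exact ⟨z, hz, x, hx, hzh⟩
  have hdet : ∀ y : K, valuation K (lowerH y : Matrix (Fin 2) (Fin 2) K).det = 1 := fun y => by
    simp [Matrix.det_fin_two]
  by_cases hc : valuation K (h 1 0) ≤ valuation K (h 1 1) * unifVal K ^ r
  · have hle : valuation K (h 1 0) ≤ valuation K (h 1 1) :=
      hc.trans (mul_le_of_le_one_right' (pow_le_one₀ zero_le unifVal_lt_one.le))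
    have h1 := hh.1
    rw [max_eq_right hle] at h1
    have hd0 : h 1 1 ≠ 0 := by
      intro h0
      rw [h0, map_zero, zero_pow two_ne_zero, zero_mul, map_eq_zero] at h1
      exact det_ne_zero h h1
    obtain ⟨z, hz, x, hx, he⟩ := key (lowerH (h 1 0 / h 1 1)) (h 1 1) (hdet _)
      (by simp; field_simp) (by simp) h1
    refine ⟨z, hz, x, hx, _, lowerH_mem_congruenceSet ?_, he⟩
    rw [map_div₀, div_le_iff₀ (zero_lt_iff.mpr (by simpa using hd0)), mul_comm]
    exact hc
  -- A dominant entry c is excluded by the congruence condition as soon as r ≥ 1.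
  · obtain rfl : r = 0 := hh.2.resolve_right hc
    rw [pow_zero, mul_one, not_le] at hc
    have h1 := hh.1
    rw [max_eq_left hc.le] at h1
    have hc0 : 0 < valuation K (h 1 0) := lt_of_le_of_lt zero_le hc
    have hc0' : h 1 0 ≠ 0 := by simpa using hc0.ne'
    obtain ⟨z, hz, x, hx, he⟩ := key (flipH (h 1 1 / h 1 0)) (h 1 0)
      (by simp [Matrix.det_fin_two]) (by simp) (by simp; field_simp) h1
    refine ⟨z, hz, x, hx, _, flipH_mem_congruenceSet ?_, he⟩
    rw [map_div₀]
    exact div_le_one_of_le₀ hc.le zero_le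

end Coset

/-! ### Volumes of the cells in Z_H N_H \ H. -/

section Volume

variable {K : Type*} [Field K] [ValuativeRel K] [TopologicalSpace K] [IsNonarchimedeanLocalField K]

lemma congruenceSet_valuation {r : ℕ} {k : GL (Fin 2) K} (hk : k ∈ congruenceSet K r) :
    (∀ i j, valuation K (k i j) ≤ 1) ∧ valuation K (k : Matrix (Fin 2) (Fin 2) K).det = 1 ∧
      valuation K (k 1 0) ≤ unifVal K ^ r ∧ valuation K (k 1 1 - 1) ≤ unifVal K ^ r := by
  obtain ⟨k, h0, h1, rfl⟩ := hk
  refine ⟨fun i j => (k i j).2, ?_, h0, h1⟩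
  have hu : IsUnit (k : Matrix (Fin 2) (Fin 2) 𝒪[K]).det := (Matrix.isUnit_iff_isUnit_det _).mp k.isUnit
  have h2 := (Valuation.Integers.isUnit_iff_valuation_eq_one
    (Valuation.integer.integers (valuation K))).mp hu
  rw [← h2, Matrix.det_fin_two, Matrix.det_fin_two]
  rfl

variable {μ : Measure (CosetSpace K)}

lemma maxCompact_subset_cellSet : (maxCompact K : Set (GL (Fin 2) K)) ⊆ cellSet 0 0 := by
  rintro _ ⟨k, rfl⟩
  obtain ⟨h1, h2, -, -⟩ := congruenceSet_valuation (r := 0)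
    (k := Matrix.GeneralLinearGroup.map (n := Fin 2) (algebraMap 𝒪[K] K) k) ⟨k, by
      rw [pow_zero]; exact (k 1 0).2, by rw [pow_zero]; exact (k 1 1 - 1).2, rfl⟩
  rw [cellSet_zero_iff, h2, _root_.zpow_zero, mul_one]
  set g := Matrix.GeneralLinearGroup.map (n := Fin 2) (algebraMap 𝒪[K] K) k
  -- The determinant is a unit and lies in the ideal generated by the bottom row, so one of these
  -- integral entries is a unit.
  suffices h : max (valuation K (g 1 0)) (valuation K (g 1 1)) = 1 by rw [h, one_pow]
  refine le_antisymm (max_le (h1 1 0) (h1 1 1)) ?_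
  rw [← h2, det_eq]
  refine ((valuation K).map_sub _ _).trans (max_le ?_ ?_)
  · rw [map_mul]
    exact (mul_le_of_le_one_left' (h1 0 0)).trans (le_max_right _ _)
  · rw [map_mul]
    exact (mul_le_of_le_one_left' (h1 0 1)).trans (le_max_left _ _)

lemma diagH_mem_congruenceSet {u : Kˣ} (hu : u ∈ unitSet K) (r : ℕ) :
    diagH u ∈ congruenceSet K r := by
  have hu1 : valuation K (u : K) = 1 := hu
  let M : Matrix (Fin 2) (Fin 2) 𝒪[K] := !![⟨u, hu1.le⟩, 0; 0, 1]
  have hM : IsUnit M.det := by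
    rw [Matrix.det_fin_two]
    refine (Valuation.Integers.isUnit_iff_valuation_eq_one
      (Valuation.integer.integers (valuation K))).mpr ?_
    change valuation K ((u : K) * ((1 : 𝒪[K]) : K) - ((0 : 𝒪[K]) : K) * ((0 : 𝒪[K]) : K)) = 1
    simpa using hu1
  refine ⟨Matrix.GeneralLinearGroup.mk'' M hM, ?_, ?_, ?_⟩
  · change valuation K ((0 : 𝒪[K]) : K) ≤ _
    simp
  · change valuation K (((1 : 𝒪[K]) : K) - 1) ≤ _
    simp
  · ext i j
    fin_cases i <;> fin_cases j <;> rfl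

lemma scalar_mem_congruenceSet {r : ℕ} {u : Kˣ} (hu : u ∈ higherUnits K r) :
    Matrix.GeneralLinearGroup.scalar (Fin 2) u ∈ congruenceSet K r := by
  have hu1 : valuation K (u : K) = 1 := hu.1
  let M : Matrix (Fin 2) (Fin 2) 𝒪[K] := !![⟨u, hu1.le⟩, 0; 0, ⟨u, hu1.le⟩]
  have hM : IsUnit M.det := by
    rw [Matrix.det_fin_two]
    refine (Valuation.Integers.isUnit_iff_valuation_eq_one
      (Valuation.integer.integers (valuation K))).mpr ?_
    change valuation K ((u : K) * (u : K) - ((0 : 𝒪[K]) : K) * ((0 : 𝒪[K]) : K)) = 1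
    simp [hu1]
  refine ⟨Matrix.GeneralLinearGroup.mk'' M hM, ?_, hu.2, ?_⟩
  · change valuation K ((0 : 𝒪[K]) : K) ≤ _
    simp
  · ext i j
    fin_cases i <;> fin_cases j <;> rfl

/-- The representative `(x 0; 0 1)` only matters up to units on the cells. -/
lemma image_maxCompact : toCoset '' (maxCompact K : Set (GL (Fin 2) K)) = cell 0 0 := by
  refine Set.Subset.antisymm (Set.image_mono maxCompact_subset_cellSet) ?_
  rintro _ ⟨h, hh, rfl⟩
  obtain ⟨z, hz, x, hx, k, hk, rfl⟩ := exists_decomposition hh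
  have hx' : x ∈ unitSet K := by
    have : valuation K (x : K) = unifVal K ^ (0 : ℤ) := hx
    rwa [_root_.zpow_zero] at this
  obtain ⟨k₁, -, -, e₁⟩ := diagH_mem_congruenceSet hx' 0
  obtain ⟨k₂, -, -, rfl⟩ := hk
  refine ⟨_, ⟨k₁ * k₂, rfl⟩, toCoset_eq_iff.mpr ⟨z, hz, ?_⟩⟩
  rw [map_mul, e₁]

/-- The volume of a cell. -/
lemma IsUnramifiedInvariant.measure_cell_one (hμ : IsUnramifiedInvariant μ) (n : ℕ) :
    μ (cell n 1) = ENNReal.ofReal ((resCard K : ℝ) ^ n / ((resCard K : ℝ) + 1)) := by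
  have hq0 : (0 : ℝ) < resCard K := by exact_mod_cast resCard_pos (K := K)
  induction n with
  | zero =>
    have h := hμ.normalised
    rw [image_maxCompact, hμ.cell_zero, mul_comm] at h
    rw [pow_zero, one_div, ENNReal.ofReal_inv_of_pos (by linarith)]
    have hcast : ((resCard K + 1 : ℕ) : ENNReal) = ENNReal.ofReal ((resCard K : ℝ) + 1) := by
      rw [← ENNReal.ofReal_natCast]; push_cast; rfl
    rw [hcast] at h
    exact ENNReal.eq_inv_of_mul_eq_one_left h
  | succ n ih =>
    -- Refining and then shifting back: vol(cell (n+1) 1) = q · vol(cell (n+1) 2) = q · vol(cell n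
    -- 1).
    have h := hμ.cell_succ (n + 1) one_ne_zero
    rw [hμ.cell_shift n one_ne_zero, ih, ← ENNReal.ofReal_natCast, ← ENNReal.ofReal_mul hq0.le] at h
    rw [Nat.cast_succ, h]
    congr 1
    ring

/-- The volume of `cell 0 r`. -/
def cellVol (K : Type*) [Field K] [ValuativeRel K] [TopologicalSpace K]
    [IsNonarchimedeanLocalField K] (r : ℕ) : ℝ :=
  if r = 0 then 1 else (((resCard K : ℝ) + 1) * (resCard K : ℝ) ^ (r - 1))⁻¹

lemma cellVol_nonneg (r : ℕ) : 0 ≤ cellVol K r := by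
  rw [cellVol]; split_ifs <;> positivity

/-- The factor q^n is the same as the one contributed by |x|^{-1} in the partial zeta integral; this
is what makes the two power series agree. -/
lemma IsUnramifiedInvariant.measure_cell (hμ : IsUnramifiedInvariant μ) (n r : ℕ) :
    μ (cell n r) = ENNReal.ofReal ((resCard K : ℝ) ^ n * cellVol K r) := by
  have hq0 : (0 : ℝ) < resCard K := by exact_mod_cast resCard_pos (K := K)
  rcases r with _ | r
  · rw [hμ.cell_zero, hμ.measure_cell_one, ← ENNReal.ofReal_natCast,
      ← ENNReal.ofReal_mul (Nat.cast_nonneg _), cellVol, if_pos rfl]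
    congr 1
    push_cast
    field_simp
  · rw [cellVol, if_neg (Nat.succ_ne_zero r), Nat.succ_sub_one]
    induction r with
    | zero => rw [zero_add, hμ.measure_cell_one, pow_zero, mul_one, div_eq_mul_inv]
    | succ r ih =>
      have h := hμ.cell_succ n (Nat.succ_ne_zero r)
      rw [ih, ← ENNReal.ofReal_natCast] at h
      have hq' : ENNReal.ofReal (resCard K : ℝ) ≠ 0 := by simpa using hq0.ne'
      refine ((ENNReal.mul_right_inj hq' ENNReal.ofReal_ne_top).mp (Eq.trans ?_ h)).symm
      rw [← ENNReal.ofReal_mul hq0.le]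
      congr 1
      field_simp
      ring

lemma cell_disjoint (r : ℕ) :
    Pairwise (Function.onFun Disjoint fun n : ℕ => (cell n r : Set (CosetSpace K))) := by
  intro i j hij
  refine Set.disjoint_left.mpr fun x hi hj => hij ?_
  obtain ⟨h, rfl⟩ := toCoset_surjective x
  have h1 := (toCoset_mem_cell.mp hi).1
  have h2 := (toCoset_mem_cell.mp hj).1
  rw [h1] at h2
  have h0 : max (valuation K (h 1 0)) (valuation K (h 1 1)) ^ 2 ≠ 0 := by
    intro h0
    rw [h0, zero_mul, map_eq_zero] at h1
    exact det_ne_zero h h1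
  exact_mod_cast unifVal_zpow_inj.mp ((mul_right_inj' h0).mp h2)

end Volume

/-! ### The Siegel sections attached to Φ_r. -/

section SiegelSection

variable {K : Type*} [Field K] [ValuativeRel K] [TopologicalSpace K] [IsNonarchimedeanLocalField K]

lemma vecMul_bottom (a : K) (h : GL (Fin 2) K) :
    ![0, a] ᵥ* (h : Matrix (Fin 2) (Fin 2) K) = ![a * h 1 0, a * h 1 1] := by
  ext j
  fin_cases j <;> simp [Matrix.vecMul, dotProduct, Fin.sum_univ_two]

/-- The non-zero value of `specialPhi`. -/
def phiVal (K : Type*) [Field K] [ValuativeRel K] [TopologicalSpace K]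
    [IsNonarchimedeanLocalField K] (r : ℕ) : ℂ :=
  if r = 0 then 1 else ((resCard K : ℂ) ^ 2 - 1) * (resCard K : ℂ) ^ (2 * r - 2)

/-- The support of `specialPhi`. -/
def PhiSupport (r : ℕ) (x : Fin 2 → K) : Prop :=
  valuation K (x 0) ≤ unifVal K ^ r ∧
    valuation K (x 1 - if r = 0 then 0 else 1) ≤ unifVal K ^ r

open Classical in
lemma specialPhi_eq (r : ℕ) (x : Fin 2 → K) :
    specialPhi K r x = if PhiSupport r x then phiVal K r else 0 := by
  unfold specialPhi PhiSupport phiVal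
  by_cases hr : r = 0
  · subst hr
    simp [memPow_iff]
  · simp [hr, memPow_iff]

/-- `specialPhi K r` is right invariant under `K_1(𝔭^r)`, one inclusion of supports. -/
lemma PhiSupport.vecMul {r : ℕ} {x : Fin 2 → K} (hx : PhiSupport r x) {k : GL (Fin 2) K}
    (hk : k ∈ congruenceSet K r) : PhiSupport r (x ᵥ* (k : Matrix (Fin 2) (Fin 2) K)) := by
  obtain ⟨h1, -, h3, h4⟩ := congruenceSet_valuation hk
  obtain ⟨hx0, hx1⟩ := hx
  have hle : unifVal K ^ r ≤ 1 := pow_le_one₀ zero_le unifVal_lt_one.le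
  have hx1' : valuation K (x 1) ≤ 1 := by
    have : x 1 = (x 1 - if r = 0 then 0 else 1) + if r = 0 then 0 else 1 := by ring
    rw [this]
    refine ((valuation K).map_add _ _).trans (max_le (hx1.trans hle) ?_)
    split_ifs <;> simp
  have e : ∀ j, (x ᵥ* (k : Matrix (Fin 2) (Fin 2) K)) j = x 0 * k 0 j + x 1 * k 1 j := fun j => by
    simp [Matrix.vecMul, dotProduct, Fin.sum_univ_two]
  constructor
  · rw [e]
    refine ((valuation K).map_add _ _).trans (max_le ?_ ?_) <;> rw [map_mul]
    · exact mul_le_of_le_of_le_one hx0 (h1 0 0)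
    · exact mul_le_of_le_one_of_le hx1' h3
  · rw [e]
    have h6 : valuation K (x 0 * k 0 1) ≤ unifVal K ^ r := by
      rw [map_mul]
      exact mul_le_of_le_of_le_one hx0 (h1 0 1)
    by_cases hr : r = 0
    · subst hr
      simp only [if_true, sub_zero, pow_zero] at *
      refine ((valuation K).map_add _ _).trans (max_le h6 ?_)
      rw [map_mul]
      exact mul_le_one' hx1 (h1 1 1)
    · simp only [hr, if_false] at *
      have : x 0 * k 0 1 + x 1 * k 1 1 - 1 = x 0 * k 0 1 + (x 1 * (k 1 1 - 1) + (x 1 - 1)) := by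
        ring
      rw [this]
      refine ((valuation K).map_add _ _).trans (max_le h6
        (((valuation K).map_add _ _).trans (max_le ?_ hx1)))
      rw [map_mul]
      exact mul_le_of_le_one_of_le hx1' h4

lemma congruenceSet_inv {r : ℕ} {k : GL (Fin 2) K} (hk : k ∈ congruenceSet K r) :
    k⁻¹ ∈ congruenceSet K r := by
  have hval := congruenceSet_valuation hk
  obtain ⟨k, -, -, rfl⟩ := hk
  obtain ⟨h1, h2, h3, h4⟩ := hval
  set g := Matrix.GeneralLinearGroup.map (n := Fin 2) (algebraMap 𝒪[K] K) k with hg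
  have hd0 := det_ne_zero g
  have e0 : g⁻¹ 1 0 = -((g : Matrix (Fin 2) (Fin 2) K).det⁻¹ * g 1 0) := by
    simp [Matrix.inv_def, Matrix.adjugate_fin_two]
  have e1 : g⁻¹ 1 1 = (g : Matrix (Fin 2) (Fin 2) K).det⁻¹ * g 0 0 := by
    simp [Matrix.inv_def, Matrix.adjugate_fin_two]
  have hk0 : ∀ i j, (((k⁻¹ : GL (Fin 2) 𝒪[K]) i j : 𝒪[K]) : K) = g⁻¹ i j := fun i j => by
    rw [hg, ← map_inv]; rfl
  refine ⟨k⁻¹, ?_, ?_, map_inv _ _⟩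
  · rw [hk0, e0, Valuation.map_neg, map_mul, map_inv₀, h2, inv_one, one_mul]
    exact h3
  -- The lower right entry of the inverse is g₀₀ / det g, and g₀₀ - det g = g₀₁ g₁₀ - g₀₀ (g₁₁ - 1)
  -- is small by the two congruences on g.
  · have : g⁻¹ 1 1 - 1 = (g : Matrix (Fin 2) (Fin 2) K).det⁻¹ *
        (g 0 1 * g 1 0 + -(g 0 0 * (g 1 1 - 1))) := by
      rw [e1, eq_inv_mul_iff_mul_eq₀ hd0, mul_sub, mul_inv_cancel_left₀ hd0, det_eq]
      ring
    rw [hk0, this, map_mul, map_inv₀, h2, inv_one, one_mul]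
    refine ((valuation K).map_add _ _).trans (max_le ?_ ?_)
    · rw [map_mul]
      exact mul_le_of_le_one_of_le (h1 0 1) h3
    · rw [Valuation.map_neg, map_mul]
      exact mul_le_of_le_one_of_le (h1 0 0) h4

lemma specialPhi_vecMul {r : ℕ} (x : Fin 2 → K) {k : GL (Fin 2) K} (hk : k ∈ congruenceSet K r) :
    specialPhi K r (x ᵥ* (k : Matrix (Fin 2) (Fin 2) K)) = specialPhi K r x := by
  classical
  rw [specialPhi_eq, specialPhi_eq]
  congr 1
  refine propext ⟨fun h => ?_, fun h => h.vecMul hk⟩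
  have := h.vecMul (congruenceSet_inv hk)
  rwa [Matrix.vecMul_vecMul, ← Units.val_mul, mul_inv_cancel, Units.val_one, Matrix.vecMul_one]
    at this

variable [MeasurableSpace Kˣ] [BorelSpace Kˣ] {χ : Kˣ →* ℂˣ} {s : ℂ}

lemma sectionIntegrand_mul_right {r : ℕ} (h : GL (Fin 2) K) {k : GL (Fin 2) K}
    (hk : k ∈ congruenceSet K r) (a : Kˣ) :
    sectionIntegrand χ (specialPhi K r) s (h * k) a =
      sectionIntegrand χ (specialPhi K r) s h a := by
  rw [sectionIntegrand, sectionIntegrand, Units.val_mul, ← Matrix.vecMul_vecMul,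
    specialPhi_vecMul _ hk]

lemma sectionIntegrand_diagH (Φ : (Fin 2 → K) → ℂ) (x a : Kˣ) :
    sectionIntegrand χ Φ s (diagH x) a = sectionIntegrand χ Φ s 1 a := by
  rw [sectionIntegrand, sectionIntegrand, vecMul_bottom, vecMul_bottom]
  simp

/-- The value of the Siegel section of `specialPhi` on a cell, in terms of its value at `1`. -/
lemma siegelSection_diagH_mul {r : ℕ} {n : ℤ} {x : Kˣ} (hx : x ∈ shell K n) {k : GL (Fin 2) K}
    (hk : k ∈ congruenceSet K r) :
    siegelSection χ (specialPhi K r) s (diagH x * k) =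
      ((resCard K : ℂ) ^ (-s)) ^ n * ∫ a, sectionIntegrand χ (specialPhi K r) s 1 a ∂(mulHaar K) := by
  have hval : valuation K ((diagH x * k : GL (Fin 2) K) : Matrix (Fin 2) (Fin 2) K).det =
      unifVal K ^ n := by
    have hx' : valuation K (x : K) = unifVal K ^ n := hx
    rw [det_mul_coe, map_mul, (congruenceSet_valuation hk).2.1, mul_one, ← hx']
    simp [Matrix.det_fin_two]
  rw [siegelSection, cpow_normAbs hval]
  simp only [sectionIntegrand_mul_right _ hk, sectionIntegrand_diagH]

/-- If (0, a)h lies in the support of Φ_r, then ad ≡ 1 and ac ≡ 0 modulo 𝔭^r. Dividing, c/d lies in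
𝔭^r, so h belongs to some cell. -/
lemma siegelSection_eq_zero {r : ℕ} (hr : r ≠ 0) {h : GL (Fin 2) K}
    (hh : ∀ n, h ∉ cellSet n r) : siegelSection χ (specialPhi K r) s h = 0 := by
  classical
  have hz : ∀ a, sectionIntegrand χ (specialPhi K r) s h a = 0 := by
    intro a
    rw [sectionIntegrand, specialPhi_eq, if_neg, zero_mul, zero_mul]
    rw [vecMul_bottom]
    rintro ⟨h0, h1⟩
    simp only [hr, if_false, Matrix.cons_val_zero, Matrix.cons_val_one] at h0 h1
    have h2 := valuation_eq_one_of_sub_lt (h1.trans_lt (unifVal_pow_lt_one K hr))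
    rw [map_mul] at h0 h2
    have ha : 0 < valuation K (a : K) := zero_lt_iff.mpr (by simp)
    have hd0 : h 1 1 ≠ 0 := by
      intro hd
      rw [hd, map_zero, mul_zero] at h2
      exact zero_ne_one h2
    obtain ⟨n, hn⟩ := exists_valuation_eq_zpow (x := (h : Matrix (Fin 2) (Fin 2) K).det / h 1 1 ^ 2)
      (div_ne_zero (det_ne_zero h) (pow_ne_zero 2 hd0))
    refine hh n ((cellSet_iff hr).mpr ⟨?_, ?_⟩)
    · have hv : valuation K (h 1 1) ^ 2 ≠ 0 := pow_ne_zero 2 (by simpa using hd0)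
      rw [← hn, map_div₀, map_pow, mul_div_cancel₀ _ hv]
    · rw [← mul_le_mul_iff_right₀ ha, ← mul_assoc, h2, one_mul]
      exact h0
  rw [siegelSection]
  simp [hz]

/-- The integrals that define the Siegel section of `specialPhi K r` for `r ≥ 1`. -/
lemma sectionIntegrand_integral {r : ℕ} (hχ : ∀ u ∈ higherUnits K (r + 1), χ u = 1) :
    (∀ h, Integrable (sectionIntegrand χ (specialPhi K (r + 1)) s h) (mulHaar K)) ∧
      (∫ a, sectionIntegrand χ (specialPhi K (r + 1)) s 1 a ∂(mulHaar K)) * cellVol K (r + 1) =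
        1 := by
  classical
  -- The scalars a with (0, a)h in the support of Φ form either the empty set or one coset a₀(1 +
  -- 𝔭^{r+1}). On such a coset χ and the absolute value are constant.
  have hmem : ∀ (h : GL (Fin 2) K) (a₀ : Kˣ),
      PhiSupport (r + 1) (![0, (a₀ : K)] ᵥ* (h : Matrix (Fin 2) (Fin 2) K)) → ∀ a : Kˣ,
      (PhiSupport (r + 1) (![0, (a : K)] ᵥ* (h : Matrix (Fin 2) (Fin 2) K)) ↔
        a₀⁻¹ * a ∈ higherUnits K (r + 1)) := by
    intro h a₀ h₀ a
    obtain ⟨u, rfl⟩ : ∃ u, a = a₀ * u := ⟨a₀⁻¹ * a, by simp⟩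
    rw [inv_mul_cancel_left]
    rw [vecMul_bottom] at h₀ ⊢
    simp only [PhiSupport, Nat.succ_ne_zero, if_false, Matrix.cons_val_zero,
      Matrix.cons_val_one] at h₀ ⊢
    obtain ⟨h1, h2⟩ := h₀
    have hlt := unifVal_pow_lt_one K (Nat.succ_ne_zero r)
    have h3 := valuation_eq_one_of_sub_lt (h2.trans_lt hlt)
    have e : ((a₀ * u : Kˣ) : K) * h 1 1 - 1 = (a₀ * h 1 1) * (u - 1) + (a₀ * h 1 1 - 1) := by
      push_cast; ring
    have e' : (a₀ : K) * h 1 1 * (u - 1) =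
        (((a₀ * u : Kˣ) : K) * h 1 1 - 1) - (a₀ * h 1 1 - 1) := by
      push_cast; ring
    constructor
    · rintro ⟨-, h5⟩
      have h6 : valuation K ((u : K) - 1) ≤ unifVal K ^ (r + 1) := by
        rw [← one_mul (valuation K ((u : K) - 1)), ← h3, ← map_mul, e']
        exact ((valuation K).map_sub _ _).trans (max_le h5 h2)
      exact ⟨valuation_eq_one_of_sub_lt (h6.trans_lt hlt), h6⟩
    · rintro ⟨h5, h6⟩
      constructor
      · rw [Units.val_mul, mul_right_comm, map_mul, h5, mul_one]
        exact h1
      · rw [e]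
        refine ((valuation K).map_add _ _).trans (max_le ?_ h2)
        rw [map_mul, h3, one_mul]
        exact h6
  have hmeas : ∀ a₀ : Kˣ, MeasurableSet {a | a₀⁻¹ * a ∈ higherUnits K (r + 1)} := fun a₀ =>
    (measurable_const_mul _) (measurableSet_higherUnits K (r + 1))
  have hind : ∀ (h : GL (Fin 2) K) (a₀ : Kˣ),
      PhiSupport (r + 1) (![0, (a₀ : K)] ᵥ* (h : Matrix (Fin 2) (Fin 2) K)) →
      sectionIntegrand χ (specialPhi K (r + 1)) s h =
        Set.indicator {a | a₀⁻¹ * a ∈ higherUnits K (r + 1)} fun _ =>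
          phiVal K (r + 1) * (χ a₀ : ℂ) * (normAbs (a₀ : K) : ℂ) ^ (2 * s) := by
    intro h a₀ h₀
    ext a
    rw [sectionIntegrand, specialPhi_eq, Set.indicator_apply]
    simp only [hmem h a₀ h₀ a, Set.mem_ofPred_eq]
    split_ifs with ha
    · have h1 : χ a = χ a₀ := by
        rw [← mul_inv_cancel_left a₀ a, map_mul, hχ _ ha, mul_one]
      have h2 : normAbs (a : K) = normAbs (a₀ : K) := by
        have h3 : normAbs ((a₀⁻¹ * a : Kˣ) : K) = 1 := by
          rw [normAbs_of_valuation (n := 0) (by rw [_root_.zpow_zero]; exact ha.1)]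
          simp
        rw [← mul_inv_cancel_left a₀ a, Units.val_mul, normAbs_mul, h3, mul_one]
      rw [h1, h2]
    · simp
  have hvol := mulHaar_higherUnits K r
  have hfin : ∀ a₀ : Kˣ, mulHaar K {a | a₀⁻¹ * a ∈ higherUnits K (r + 1)} ≠ ⊤ := fun a₀ => by
    rw [mulHaar_preimage, hvol]
    exact ENNReal.ofReal_ne_top
  refine ⟨fun h => ?_, ?_⟩
  · by_cases hex : ∃ a₀ : Kˣ, PhiSupport (r + 1) (![0, (a₀ : K)] ᵥ* (h : Matrix (Fin 2) (Fin 2) K))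
    · obtain ⟨a₀, h₀⟩ := hex
      rw [hind h a₀ h₀]
      exact (integrable_indicator_iff (hmeas a₀)).mpr (integrableOn_const (hfin a₀))
    · push Not at hex
      have : sectionIntegrand χ (specialPhi K (r + 1)) s h = fun _ => 0 := by
        ext a
        rw [sectionIntegrand, specialPhi_eq, if_neg (hex a), zero_mul, zero_mul]
      rw [this]
      exact integrable_zero _ _ _
  · have hq : (1 : ℝ) < resCard K := by exact_mod_cast one_lt_resCard K
    have h₀ : PhiSupport (r + 1) (![0, ((1 : Kˣ) : K)] ᵥ*
        ((1 : GL (Fin 2) K) : Matrix (Fin 2) (Fin 2) K)) := by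
      rw [vecMul_bottom]
      simp [PhiSupport]
    rw [hind 1 1 h₀, integral_indicator (hmeas 1), setIntegral_const, Measure.real,
      mulHaar_preimage, hvol, ENNReal.toReal_ofReal (by
        have : 0 ≤ (resCard K : ℝ) - 1 := by linarith
        positivity)]
    have hn : normAbs (((1 : Kˣ) : Kˣ) : K) = 1 := by
      rw [normAbs_of_valuation (n := 0) (by simp)]
      simp
    rw [hn, map_one, Units.val_one, Complex.ofReal_one, Complex.one_cpow, mul_one, mul_one,
      Complex.real_smul, cellVol, phiVal, if_neg (Nat.succ_ne_zero r), if_neg (Nat.succ_ne_zero r)]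
    -- What remains is (q² - 1) q^{2r} / ((q - 1) q^r) = (q + 1) q^r, which cancels the volume of
    -- the cell of level r + 1.
    have hq1 : (resCard K : ℂ) - 1 ≠ 0 := by
      rw [sub_ne_zero]; exact_mod_cast (one_lt_resCard K).ne'
    have hq0 : (resCard K : ℂ) ≠ 0 := by exact_mod_cast (resCard_pos (K := K)).ne'
    have hq2 : (resCard K : ℂ) + 1 ≠ 0 := by exact_mod_cast Nat.succ_ne_zero (resCard K)
    have he : 2 * (r + 1) - 2 = r + r := by omega
    rw [he, Nat.succ_sub_one]
    push_cast
    field_simp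
    ring

lemma map_shell (hχ : ∀ u ∈ unitSet K, χ u = 1) {n : ℤ} {a : Kˣ} (ha : a ∈ shell K n) :
    (χ a : ℂ) = (χ (uniformiserUnit K) : ℂ) ^ n := by
  have hu : a * (uniformiserUnit K ^ n)⁻¹ ∈ unitSet K := by
    have ha' : valuation K (a : K) = unifVal K ^ n := ha
    change valuation K _ = 1
    rw [Units.val_mul, Units.val_inv_eq_inv_val, Units.val_zpow_eq_zpow_val, map_mul, map_inv₀,
      map_zpow₀, ha']
    exact mul_inv_cancel₀ (zpow_ne_zero n (unifVal_ne_zero K))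
  have : a = a * (uniformiserUnit K ^ n)⁻¹ * uniformiserUnit K ^ n := by simp
  rw [this, map_mul, hχ _ hu, one_mul, map_zpow, Units.val_zpow_eq_zpow_val]

/-- The integrals that define the Siegel section of `specialPhi K 0`. -/
lemma sectionIntegrand_zero_integral (hχ : ∀ u ∈ unitSet K, χ u = 1)
    (hs : ‖(χ (uniformiserUnit K) : ℂ) * ((resCard K : ℂ) ^ (-s)) ^ 2‖ < 1) :
    (∀ h, Integrable (sectionIntegrand χ (specialPhi K 0) s h) (mulHaar K)) ∧
      ∫ a, sectionIntegrand χ (specialPhi K 0) s 1 a ∂(mulHaar K) =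
        (1 - (χ (uniformiserUnit K) : ℂ) * ((resCard K : ℂ) ^ (-s)) ^ 2)⁻¹ := by
  classical
  set z : ℂ := (χ (uniformiserUnit K) : ℂ) * ((resCard K : ℂ) ^ (-s)) ^ 2 with hz
  have hq0 : (resCard K : ℂ) ≠ 0 := by exact_mod_cast (resCard_pos (K := K)).ne'
  have hz0 : z ≠ 0 := mul_ne_zero (Units.ne_zero _) (pow_ne_zero 2 (by
    rw [Ne, Complex.cpow_eq_zero_iff]; tauto))
  have hterm : ∀ {n : ℤ} {a : Kˣ}, a ∈ shell K n →
      (χ a : ℂ) * (normAbs (a : K) : ℂ) ^ (2 * s) = z ^ n := by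
    intro n a ha
    have h2 : (resCard K : ℂ) ^ (-(2 * s)) = ((resCard K : ℂ) ^ (-s)) ^ 2 := by
      rw [← Complex.cpow_nat_mul]
      congr 1
      push_cast
      ring
    rw [map_shell hχ ha, cpow_normAbs ha, h2, hz, mul_zpow]
  -- If e is the least valuation in the bottom row, then (0, a)h is integral exactly when a has
  -- valuation at least -e. The integral is therefore a geometric series starting at z^{-e}.
  have main : ∀ h : GL (Fin 2) K, ∀ e : ℤ,
      max (valuation K (h 1 0)) (valuation K (h 1 1)) = unifVal K ^ e →
      Integrable (sectionIntegrand χ (specialPhi K 0) s h) (mulHaar K) ∧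
        ∫ a, sectionIntegrand χ (specialPhi K 0) s h a ∂(mulHaar K) = ∑' n : ℕ, z ^ (-e + n) := by
    intro h e he
    have hsupp : ∀ {n : ℤ} {a : Kˣ}, a ∈ shell K n →
        (PhiSupport 0 (![0, (a : K)] ᵥ* (h : Matrix (Fin 2) (Fin 2) K)) ↔ -e ≤ n) := by
      intro n a ha
      have ha' : valuation K (a : K) = unifVal K ^ n := ha
      have hpos := unifVal_zpow_le_iff (K := K) (m := n + e) (n := 0)
      rw [vecMul_bottom]
      simp only [PhiSupport, if_true, sub_zero, Matrix.cons_val_zero, Matrix.cons_val_one, pow_zero]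
      rw [← max_le_iff, map_mul, map_mul, max_mul_mul_left, he, ha',
        ← zpow_add₀ (unifVal_ne_zero K), ← _root_.zpow_zero (unifVal K), hpos]
      omega
    refine integral_mulHaar_of_shells K (m := -e) (fun n a ha => ?_) (fun n hn a ha => ?_) ?_
    · rw [sectionIntegrand, specialPhi_eq, if_pos ((hsupp ha).mpr (by omega)), mul_assoc, hterm ha,
        phiVal, if_pos rfl, one_mul]
    · rw [sectionIntegrand, specialPhi_eq, if_neg (fun h' => by have := (hsupp ha).mp h'; omega),
        zero_mul, zero_mul]
    · simp_rw [zpow_add₀ hz0, zpow_natCast, norm_mul, norm_pow]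
      exact (summable_geometric_of_lt_one (norm_nonneg _) hs).mul_left _
  refine ⟨fun h => ?_, ?_⟩
  · have hex : ∃ e : ℤ, max (valuation K (h 1 0)) (valuation K (h 1 1)) = unifVal K ^ e := by
      rcases max_choice (valuation K (h 1 0)) (valuation K (h 1 1)) with hc | hc
      · have h0 : h 1 0 ≠ 0 := by
          intro h0
          rcases row_ne_zero h with h' | h'
          · exact h' h0
          · rw [h0, map_zero, max_eq_right zero_le, map_eq_zero] at hc
            exact h' hc
        rw [hc]
        exact exists_valuation_eq_zpow h0
      · have h0 : h 1 1 ≠ 0 := by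
          intro h0
          rcases row_ne_zero h with h' | h'
          · rw [h0, map_zero, max_eq_left zero_le, map_eq_zero] at hc
            exact h' hc
          · exact h' h0
        rw [hc]
        exact exists_valuation_eq_zpow h0
    obtain ⟨e, he⟩ := hex
    exact (main h e he).1
  · rw [(main 1 0 (by simp)).2]
    simp only [neg_zero, zero_add, zpow_natCast]
    exact tsum_geometric_of_norm_lt_one hs

end SiegelSection

/-! ### Both zeta integrals as multiples of the power series of torus values. -/

section ZetaIntegrals

variable {K : Type*} [Field K] [ValuativeRel K] [TopologicalSpace K] [IsNonarchimedeanLocalField K]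
variable {L : Type*} [CommRing L] [Algebra K L]

/-- The values of `W` at the matrices `(ϖ_K^n 0; 0 1)`. -/
def torusValue (K : Type*) [Field K] [ValuativeRel K] [TopologicalSpace K]
    [IsNonarchimedeanLocalField K] {L : Type*} [CommRing L] [Algebra K L]
    (W : GL (Fin 2) L → ℂ) (n : ℤ) : ℂ :=
  W (inclH K L (diagH (uniformiserUnit K ^ n)))

/-- The power series in `q_K^{-s}` that expresses the partial zeta integral. -/
def torusTerm (K : Type*) [Field K] [ValuativeRel K] [TopologicalSpace K]
    [IsNonarchimedeanLocalField K] {L : Type*} [CommRing L] [Algebra K L]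
    (W : GL (Fin 2) L → ℂ) (s : ℂ) (n : ℕ) : ℂ :=
  (resCard K : ℂ) ^ n * torusValue K W n * ((resCard K : ℂ) ^ (-s)) ^ n

variable {W : GL (Fin 2) L → ℂ} {χ : Kˣ →* ℂˣ} {r : ℕ}

lemma diagH_mul (x y : Kˣ) : diagH (x * y) = diagH x * diagH y := by
  ext i j
  fin_cases i <;> fin_cases j <;> simp [Matrix.mul_apply, Fin.sum_univ_two]

lemma apply_diagH_eq_torusValue (hK : ∀ k ∈ congruenceSet K r, ∀ g, W (g * inclH K L k) = W g)
    {n : ℤ} {x : Kˣ} (hx : x ∈ shell K n) : W (inclH K L (diagH x)) = torusValue K W n := by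
  have hx' : valuation K (x : K) = unifVal K ^ n := hx
  have hu : (uniformiserUnit K ^ n)⁻¹ * x ∈ unitSet K := by
    change valuation K _ = 1
    rw [Units.val_mul, Units.val_inv_eq_inv_val, Units.val_zpow_eq_zpow_val, map_mul, map_inv₀,
      map_zpow₀, hx']
    exact inv_mul_cancel₀ (zpow_ne_zero n (unifVal_ne_zero K))
  rw [← mul_inv_cancel_left (uniformiserUnit K ^ n) x, diagH_mul, map_mul,
    hK _ (diagH_mem_congruenceSet hu r), torusValue]

/-- A scalar u ≡ 1 modulo 𝔭^r lies in K_1(𝔭^r), so it fixes W on the right; it also multiplies W by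
χ(u), and W(1) = 1. This makes the Siegel integral for Φ_r non-zero. -/
lemma apply_higherUnits (hK : ∀ k ∈ congruenceSet K r, ∀ g, W (g * inclH K L k) = W g)
    (hZ : ∀ (z : Kˣ) g,
      W (inclH K L (Matrix.GeneralLinearGroup.scalar (Fin 2) z) * g) = (χ z : ℂ) * W g)
    (hW : W 1 = 1) : ∀ u ∈ higherUnits K r, χ u = 1 := by
  intro u hu
  have h1 := hZ u 1
  have h2 := hK _ (scalar_mem_congruenceSet hu) 1
  rw [one_mul] at h2
  rw [mul_one, h2, hW, mul_one] at h1
  exact Units.ext h1.symm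

variable [MeasurableSpace Kˣ] [BorelSpace Kˣ]

lemma partialIntegral_eq (hK : ∀ k ∈ congruenceSet K r, ∀ g, W (g * inclH K L k) = W g)
    (hneg : ∀ n < 0, torusValue K W n = 0) {s : ℂ}
    (hs : Summable fun n => ‖torusTerm K W s n‖) :
    PartialConverges K W s ∧ partialIntegral K W s = ∑' n, torusTerm K W s n := by
  have hq0 : (resCard K : ℂ) ≠ 0 := by exact_mod_cast (resCard_pos (K := K)).ne'
  -- The shift s - 1 in the exponent is the source of the factor q^n in `torusTerm`.
  have hcpow : (resCard K : ℂ) ^ (-(s - 1)) = resCard K * (resCard K : ℂ) ^ (-s) := by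
    rw [neg_sub, sub_eq_add_neg, Complex.cpow_add _ _ hq0, Complex.cpow_one]
  refine integral_mulHaar_of_shells K (m := 0) (fun n u hu => ?_) (fun n hn u hu => ?_) hs
  · rw [zero_add] at hu
    have := apply_diagH_eq_torusValue hK hu
    rw [partialIntegrand, this, cpow_normAbs hu, hcpow, zpow_natCast, mul_pow, torusTerm]
    ring
  · have := apply_diagH_eq_torusValue hK hu
    rw [partialIntegrand, this, hneg n hn, zero_mul]

variable {μ : Measure (CosetSpace K)}

/-- On a cell the integrand is the constant a(n) X^n I, where X = q^{-s} and I is the Siegel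
integral at the identity. Weighting by the volume q^n · `cellVol K r` and summing gives the power
series times a factor independent of n. -/
lemma asaiIntegral_eq (hμ : IsUnramifiedInvariant μ)
    (hN : ∀ (x : K) g, W (inclH K L (Matrix.GeneralLinearGroup.upperRightHom x) * g) = W g)
    (hZ : ∀ (z : Kˣ) g,
      W (inclH K L (Matrix.GeneralLinearGroup.scalar (Fin 2) z) * g) = (χ z : ℂ) * W g)
    (hK : ∀ k ∈ congruenceSet K r, ∀ g, W (g * inclH K L k) = W g)
    (hneg : ∀ n < 0, torusValue K W n = 0) {s : ℂ}
    (hs : Summable fun n => ‖torusTerm K W s n‖) :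
    Integrable (asaiIntegrandQuot W χ (specialPhi K r) s) μ ∧
      asaiIntegral μ W χ (specialPhi K r) s =
        (∫ a, sectionIntegrand χ (specialPhi K r) s 1 a ∂(mulHaar K)) * cellVol K r *
          ∑' n, torusTerm K W s n := by
  set I := ∫ a, sectionIntegrand χ (specialPhi K r) s 1 a ∂(mulHaar K)
  have hval : ∀ (n : ℤ), ∀ x ∈ cell n r, asaiIntegrandQuot W χ (specialPhi K r) s x =
      torusValue K W n * (((resCard K : ℂ) ^ (-s)) ^ n * I) := by
    intro n x hx
    have hout : toCoset (Quotient.out x) = x := Quotient.out_eq x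
    rw [← hout, toCoset_mem_cell] at hx
    obtain ⟨z, hz, y, hy, k, hk, he⟩ := exists_decomposition hx
    rw [asaiIntegrandQuot, he, asaiIntegrand_mul W χ _ s hN hZ z _ hz, asaiIntegrand, map_mul,
      hK k hk, apply_diagH_eq_torusValue hK hy, siegelSection_diagH_mul hy hk]
  have hterm : ∀ n : ℕ, torusValue K W n * (((resCard K : ℂ) ^ (-s)) ^ (n : ℤ) * I) *
      (((resCard K : ℝ) ^ n * cellVol K r : ℝ) : ℂ) = I * cellVol K r * torusTerm K W s n := by
    intro n
    rw [torusTerm, zpow_natCast]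
    push_cast
    ring
  have := integrable_and_integral_eq_tsum (μ := μ) (S := fun n : ℕ => cell n r)
    (w := fun n => (resCard K : ℝ) ^ n * cellVol K r)
    (c := fun n => torusValue K W n * (((resCard K : ℂ) ^ (-s)) ^ (n : ℤ) * I))
    (f := asaiIntegrandQuot W χ (specialPhi K r) s)
    (fun n => measurableSet_cell _ _) (cell_disjoint r)
    (fun n => mul_nonneg (by positivity) (cellVol_nonneg r)) (fun n => hμ.measure_cell n r)
    (fun n x hx => hval n x hx) (fun x hx => ?_) ?_
  · refine ⟨this.1, this.2.trans ?_⟩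
    simp_rw [hterm]
    exact tsum_mul_left
  -- Outside the cells with n ≥ 0 there are three cases: a cell with n < 0, where W vanishes; no
  -- cell at all with r = 0, which cannot occur; and no cell with r ≥ 1, where the Siegel section
  -- vanishes.
  · by_cases hex : ∃ n : ℤ, x ∈ cell n r
    · obtain ⟨n, hn⟩ := hex
      have hn0 : n < 0 := by
        by_contra! h0
        lift n to ℕ using h0
        exact hx n hn
      rw [hval n x hn, hneg n hn0, zero_mul]
    · push Not at hex
      have hout : toCoset (Quotient.out x) = x := Quotient.out_eq x
      have hnot : ∀ n, Quotient.out x ∉ cellSet n r := fun n hn =>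
        hex n (by rw [← hout]; exact toCoset_mem_cell.mpr hn)
      by_cases hr : r = 0
      · exfalso
        set h : GL (Fin 2) K := Quotient.out x
        set M := max (valuation K (h 1 0)) (valuation K (h 1 1)) with hM
        obtain ⟨c, hc0, hc⟩ : ∃ c : K, c ≠ 0 ∧ valuation K c = M := by
          have hM0 : M ≠ 0 := by
            rcases row_ne_zero h with h' | h'
            · exact ((zero_lt_iff.mpr (by simpa using h')).trans_le (le_max_left _ _)).ne'
            · exact ((zero_lt_iff.mpr (by simpa using h')).trans_le (le_max_right _ _)).ne'
          obtain ⟨c, hc⟩ := ValuativeRel.valuation_surjective M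
          refine ⟨c, ?_, hc⟩
          rintro rfl
          rw [map_zero] at hc
          exact hM0 hc.symm
        obtain ⟨n, hn⟩ := exists_valuation_eq_zpow
          (x := (h : Matrix (Fin 2) (Fin 2) K).det / c ^ 2)
          (div_ne_zero (det_ne_zero h) (pow_ne_zero 2 hc0))
        have hv : valuation K c ^ 2 ≠ 0 := pow_ne_zero 2 (by simpa using hc0)
        subst hr
        refine hnot n (cellSet_zero_iff.mpr ?_)
        rw [← hM, ← hc, ← hn, map_div₀, map_pow, mul_div_cancel₀ _ hv]
      · rw [asaiIntegrandQuot, asaiIntegrand, siegelSection_eq_zero hr hnot, mul_zero]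
  · simp_rw [hterm, norm_mul]
    exact hs.mul_left _

/-- The rational function whose value at `q_K^{-s}` is the sum of the power series
`∑ torusTerm K W s n`. -/
def IsTorusSum (K : Type*) [Field K] [ValuativeRel K] [TopologicalSpace K]
    [IsNonarchimedeanLocalField K] {L : Type*} [CommRing L] [Algebra K L]
    (W : GL (Fin 2) L → ℂ) (R : RatFunc ℂ) : Prop :=
  IsContinuation (resCard K) (fun s => Summable fun n => ‖torusTerm K W s n‖)
    (fun s => ∑' n, torusTerm K W s n) R

lemma exists_isTorusSum (h : IsMatrixCoeff fun n => torusValue K W n) :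
    ∃ R, IsTorusSum K W R :=
  (h.geom_mul (resCard K : ℂ)).exists_isContinuation (one_lt_resCard K) fun _ hs => ⟨hs, rfl⟩

variable {R : RatFunc ℂ}

lemma IsTorusSum.partial_isContinuation (hR : IsTorusSum K W R)
    (hK : ∀ k ∈ congruenceSet K r, ∀ g, W (g * inclH K L k) = W g)
    (hneg : ∀ n < 0, torusValue K W n = 0) :
    IsContinuation (resCard K) (PartialConverges K W) (partialIntegral K W) R :=
  hR.congr (σ := 0) fun _ _ hs => partialIntegral_eq hK hneg hs

/-- The Siegel integral at the identity and the volume of the cell are inverse to each other, so no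
factor is left over, whatever the positive level. -/
lemma IsTorusSum.asai_isContinuation_succ (hR : IsTorusSum K W R) (hμ : IsUnramifiedInvariant μ)
    (hN : ∀ (x : K) g, W (inclH K L (Matrix.GeneralLinearGroup.upperRightHom x) * g) = W g)
    (hZ : ∀ (z : Kˣ) g,
      W (inclH K L (Matrix.GeneralLinearGroup.scalar (Fin 2) z) * g) = (χ z : ℂ) * W g)
    (hK : ∀ k ∈ congruenceSet K (r + 1), ∀ g, W (g * inclH K L k) = W g)
    (hneg : ∀ n < 0, torusValue K W n = 0) (hW : W 1 = 1) :
    IsContinuation (resCard K) (AsaiConverges μ W χ (specialPhi K (r + 1)))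
      (asaiIntegral μ W χ (specialPhi K (r + 1))) R := by
  refine hR.congr (σ := 0) fun s _ hs => ?_
  obtain ⟨h1, h2⟩ := asaiIntegral_eq hμ hN hZ hK hneg hs
  obtain ⟨h3, h4⟩ := sectionIntegrand_integral (s := s) (apply_higherUnits hK hZ hW)
  exact ⟨⟨h3, h1⟩, by rw [h2, h4, one_mul]⟩

lemma lFactorTwo_isContinuation (hχ : ∀ u ∈ unitSet K, χ u = 1) :
    IsContinuation (resCard K)
      (fun s => ‖(χ (uniformiserUnit K) : ℂ) * ((resCard K : ℂ) ^ (-s)) ^ 2‖ < 1)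
      (fun s => (1 - (χ (uniformiserUnit K) : ℂ) * ((resCard K : ℂ) ^ (-s)) ^ 2)⁻¹)
      (lFactorTwo K χ) := by
  set c : ℂ := (χ (uniformiserUnit K) : ℂ)
  -- For |z| below this radius, |z| ≤ 1 and |c||z| < 1, hence |c z²| < 1. This gives both the
  -- convergence condition and the non-vanishing of 1 - c z².
  have hρ : 0 < (1 + ‖c‖)⁻¹ := by positivity
  have hlt : ∀ z : ℂ, ‖z‖ < (1 + ‖c‖)⁻¹ → ‖c * z ^ 2‖ < 1 := by
    intro z hz
    have h1 : ‖z‖ * (1 + ‖c‖) < 1 := by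
      have h0 : 0 < 1 + ‖c‖ := by positivity
      calc ‖z‖ * (1 + ‖c‖) < (1 + ‖c‖)⁻¹ * (1 + ‖c‖) := by gcongr
        _ = 1 := inv_mul_cancel₀ h0.ne'
    have h2 : ‖z‖ ≤ 1 := by nlinarith [norm_nonneg z, norm_nonneg c]
    rw [norm_mul, norm_pow]
    nlinarith [norm_nonneg z, norm_nonneg c, mul_nonneg (norm_nonneg z) (norm_nonneg c)]
  have hL : lFactorTwo K χ = algebraMap ℂ[X] (RatFunc ℂ) 1 /
      algebraMap ℂ[X] (RatFunc ℂ) (1 - C c * X ^ 2) := by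
    rw [lFactorTwo, if_pos hχ]
    simp [c]
  rw [hL]
  refine IsContinuation.of_eq_div (one_lt_resCard K) _ _ hρ (fun z hz h0 => ?_) fun s hs => ?_
  · have := hlt z hz
    simp only [Polynomial.eval_sub, Polynomial.eval_one, Polynomial.eval_mul, Polynomial.eval_C,
      Polynomial.eval_pow, Polynomial.eval_X] at h0
    rw [← sub_eq_zero.mp h0, norm_one] at this
    exact lt_irrefl _ this
  · exact ⟨hlt _ hs, by simp⟩

/-- At level 0 the cell has volume 1 and χ is unramified, so the extra factor is the geometric
series of the Siegel integral, namely L(χ, 2s). -/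
lemma IsTorusSum.asai_isContinuation_zero (hR : IsTorusSum K W R) (hμ : IsUnramifiedInvariant μ)
    (hN : ∀ (x : K) g, W (inclH K L (Matrix.GeneralLinearGroup.upperRightHom x) * g) = W g)
    (hZ : ∀ (z : Kˣ) g,
      W (inclH K L (Matrix.GeneralLinearGroup.scalar (Fin 2) z) * g) = (χ z : ℂ) * W g)
    (hK : ∀ k ∈ congruenceSet K 0, ∀ g, W (g * inclH K L k) = W g)
    (hneg : ∀ n < 0, torusValue K W n = 0) (hW : W 1 = 1) :
    IsContinuation (resCard K) (AsaiConverges μ W χ (specialPhi K 0))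
      (asaiIntegral μ W χ (specialPhi K 0)) (lFactorTwo K χ * R) := by
  have hχ : ∀ u ∈ unitSet K, χ u = 1 := by
    rw [← higherUnits_zero]
    exact apply_higherUnits hK hZ hW
  refine ((lFactorTwo_isContinuation hχ).mul hR).congr (σ := 0) fun s _ hs => ?_
  obtain ⟨h1, h2⟩ := asaiIntegral_eq hμ hN hZ hK hneg hs.2
  obtain ⟨h3, h4⟩ := sectionIntegrand_zero_integral hχ hs.1
  exact ⟨⟨h3, h1⟩, by rw [h2, h4, cellVol, if_pos rfl, Complex.ofReal_one, mul_one]⟩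

end ZetaIntegrals

/-! ### Matrices over the ring of integers of `L` -/

section Matrices

variable {K : Type*} [Field K] [ValuativeRel K] [TopologicalSpace K] [IsNonarchimedeanLocalField K]
variable {L : Type*} [CommRing L] [Algebra K L]

lemma gl_mul_apply {S : Type*} [CommRing S] (g h : GL (Fin 2) S) (i j : Fin 2) :
    (g * h) i j = g i 0 * h 0 j + g i 1 * h 1 j := by
  rw [Units.val_mul, Matrix.mul_apply, Fin.sum_univ_two]

/-- The matrix `(x 0; 0 1)` over a commutative ring. -/
def diagL {S : Type*} [CommRing S] (x : Sˣ) : GL (Fin 2) S :=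
  ⟨!![(x : S), 0; 0, 1], !![((x⁻¹ : Sˣ) : S), 0; 0, 1], by simp [Matrix.one_fin_two],
    by simp [Matrix.one_fin_two]⟩

@[simp] lemma diagL_coe {S : Type*} [CommRing S] (x : Sˣ) :
    (diagL x : Matrix (Fin 2) (Fin 2) S) = !![(x : S), 0; 0, 1] := rfl

lemma gl_ext {S : Type*} [CommRing S] {g h : GL (Fin 2) S} (h00 : g 0 0 = h 0 0)
    (h01 : g 0 1 = h 0 1) (h10 : g 1 0 = h 1 0) (h11 : g 1 1 = h 1 1) : g = h := by
  ext i j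
  fin_cases i <;> fin_cases j <;> assumption

lemma diagL_mul {S : Type*} [CommRing S] (x y : Sˣ) : diagL (x * y) = diagL x * diagL y := by
  apply gl_ext <;> simp [gl_mul_apply]

lemma inclH_diagH (x : Kˣ) :
    inclH K L (diagH x) = diagL (Units.map (algebraMap K L).toMonoidHom x) := by
  ext i j
  fin_cases i <;> fin_cases j <;> simp [inclH]

variable {𝔞 : Ideal (intRing K L)}

/-- The subgroup of `GL₂(𝒪_L)` whose image is `K_1(𝔞)`. -/
def intK1 (𝔞 : Ideal (intRing K L)) : Subgroup (GL (Fin 2) (intRing K L)) where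
  carrier := {k | k 1 0 ∈ 𝔞 ∧ k 1 1 - 1 ∈ 𝔞}
  one_mem' := by simp
  mul_mem' := by
    rintro a b ⟨ha, ha'⟩ ⟨hb, hb'⟩
    refine ⟨?_, ?_⟩
    · rw [gl_mul_apply]
      exact add_mem (𝔞.mul_mem_right _ ha) (𝔞.mul_mem_left _ hb)
    · have : (a * b) 1 1 - 1 = a 1 0 * b 0 1 + a 1 1 * (b 1 1 - 1) + (a 1 1 - 1) := by
        rw [gl_mul_apply]; ring
      rw [this]
      exact add_mem (add_mem (𝔞.mul_mem_right _ ha) (𝔞.mul_mem_left _ hb')) ha'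
  inv_mem' := by
    rintro a ⟨ha, ha'⟩
    have e0 : a⁻¹ * a = 1 := inv_mul_cancel a
    have h11 : a⁻¹ 1 0 * a 0 1 + a⁻¹ 1 1 * a 1 1 = 1 := by
      rw [← gl_mul_apply, e0]; simp
    have f0 : a * a⁻¹ = 1 := mul_inv_cancel a
    have g10 : a 1 0 * a⁻¹ 0 0 + a 1 1 * a⁻¹ 1 0 = 0 := by
      rw [← gl_mul_apply, f0]; simp
    have hmem : a⁻¹ 1 0 ∈ 𝔞 := by
      have : a⁻¹ 1 0 = -(a 1 0 * a⁻¹ 0 0 + (a 1 1 - 1) * a⁻¹ 1 0) := by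
        linear_combination g10
      rw [this]
      exact neg_mem (add_mem (𝔞.mul_mem_right _ ha) (𝔞.mul_mem_right _ ha'))
    refine ⟨hmem, ?_⟩
    have : a⁻¹ 1 1 - 1 = -(a⁻¹ 1 0 * a 0 1 + a⁻¹ 1 1 * (a 1 1 - 1)) := by
      linear_combination h11
    rw [this]
    exact neg_mem (add_mem (𝔞.mul_mem_right _ hmem) (𝔞.mul_mem_left _ ha'))

lemma mem_K1_iff {g : GL (Fin 2) L} : g ∈ K1 K 𝔞 ↔ g ∈ (intK1 𝔞).map (intMap K L) := by
  constructor
  · rintro ⟨k, h0, h1, rfl⟩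
    exact ⟨k, ⟨h0, h1⟩, rfl⟩
  · rintro ⟨k, ⟨h0, h1⟩, rfl⟩
    exact ⟨k, h0, h1, rfl⟩

lemma K1_mul {g h : GL (Fin 2) L} (hg : g ∈ K1 K 𝔞) (hh : h ∈ K1 K 𝔞) : g * h ∈ K1 K 𝔞 := by
  rw [mem_K1_iff] at *
  exact mul_mem hg hh

lemma K1_inv {g : GL (Fin 2) L} (hg : g ∈ K1 K 𝔞) : g⁻¹ ∈ K1 K 𝔞 := by
  rw [mem_K1_iff] at *
  exact inv_mem hg

lemma intMap_apply (k : GL (Fin 2) (intRing K L)) (i j : Fin 2) :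
    intMap K L k i j = ((k i j : intRing K L) : L) := rfl

lemma upperRight_mem_K1 (b : intRing K L) :
    Matrix.GeneralLinearGroup.upperRightHom (b : L) ∈ K1 K 𝔞 := by
  refine ⟨Matrix.GeneralLinearGroup.upperRightHom b, by simp, by simp, ?_⟩
  apply gl_ext <;> simp [intMap_apply]

lemma diagL_mem_K1 (u : (intRing K L)ˣ) :
    diagL (Units.map (algebraMap (intRing K L) L).toMonoidHom u) ∈ K1 K 𝔞 := by
  refine ⟨diagL u, by simp, by simp, ?_⟩
  apply gl_ext <;> simp [intMap_apply]

/-- The integral matrices with determinant `p` up to units and lower row `(0 1)` modulo `𝔞`. -/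
def heckeSet (𝔞 : Ideal (intRing K L)) (p : intRing K L) : Set (GL (Fin 2) L) :=
  {g | ∃ a b c d : intRing K L, g 0 0 = a ∧ g 0 1 = b ∧ g 1 0 = c ∧ g 1 1 = d ∧ c ∈ 𝔞 ∧
    d - 1 ∈ 𝔞 ∧ ∃ u : (intRing K L)ˣ, a * d - b * c = p * u}

lemma K1_mul_heckeSet {p : intRing K L} {k g : GL (Fin 2) L} (hk : k ∈ K1 K 𝔞)
    (hg : g ∈ heckeSet 𝔞 p) : k * g ∈ heckeSet 𝔞 p := by
  obtain ⟨k, h0, h1, rfl⟩ := hk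
  obtain ⟨a, b, c, d, ha, hb, hc, hd, hc', hd', u, hu⟩ := hg
  have hkd : IsUnit (k : Matrix (Fin 2) (Fin 2) (intRing K L)).det :=
    (Matrix.isUnit_iff_isUnit_det _).mp k.isUnit
  obtain ⟨w, hw⟩ := hkd
  rw [Matrix.det_fin_two] at hw
  refine ⟨k 0 0 * a + k 0 1 * c, k 0 0 * b + k 0 1 * d, k 1 0 * a + k 1 1 * c,
    k 1 0 * b + k 1 1 * d, ?_, ?_, ?_, ?_, ?_, ?_, w * u, ?_⟩
  · rw [gl_mul_apply, ha, hc]; simp [intMap_apply]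
  · rw [gl_mul_apply, hb, hd]; simp [intMap_apply]
  · rw [gl_mul_apply, ha, hc]; simp [intMap_apply]
  · rw [gl_mul_apply, hb, hd]; simp [intMap_apply]
  · exact add_mem (𝔞.mul_mem_right _ h0) (𝔞.mul_mem_left _ hc')
  · have : k 1 0 * b + k 1 1 * d - 1 = k 1 0 * b + k 1 1 * (d - 1) + (k 1 1 - 1) := by ring
    rw [this]
    exact add_mem (add_mem (𝔞.mul_mem_right _ h0) (𝔞.mul_mem_left _ hd')) h1
  · rw [Units.val_mul, hw]
    linear_combination (k 0 0 * k 1 1 - k 0 1 * k 1 0) * hu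

variable {p : intRing K L} {P : Lˣ}

/-- Every element of `heckeSet` is `(p b; 0 1)` or `(1 0; 0 p)` times an element of `K_1(𝔞)`. -/
lemma heckeSet_cover (hP : (P : L) = p) (hmax : (Ideal.span {p}).IsMaximal)
    (hpa : 𝔞 ≤ Ideal.span {p} ∨ p - 1 ∈ 𝔞) {g : GL (Fin 2) L} (hg : g ∈ heckeSet 𝔞 p) :
    (∃ b : intRing K L, ∃ k ∈ K1 K 𝔞,
      g = Matrix.GeneralLinearGroup.upperRightHom (b : L) * diagL P * k) ∨
    ((p - 1 ∈ 𝔞) ∧ ∃ k ∈ K1 K 𝔞,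
      g = Matrix.GeneralLinearGroup.scalar (Fin 2) P * diagL P⁻¹ * k) := by
  obtain ⟨a, b, c, d, ha, hb, hc, hd, hc', hd', u, hu⟩ := hg
  have hcancel : ∀ {x y : intRing K L}, p * x = p * y → x = y := by
    intro x y hxy
    have h1 := congrArg (Subtype.val) hxy
    have h2 : (P : L) * x = (P : L) * y := by rw [hP]; exact h1
    exact Subtype.ext ((Units.mul_right_inj P).mp h2)
  have hmk : ∀ M : Matrix (Fin 2) (Fin 2) (intRing K L), IsUnit M.det → M 1 0 ∈ 𝔞 → M 1 1 - 1 ∈ 𝔞 →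
      ∃ k ∈ K1 K 𝔞, ∀ i j, k i j = (M i j : L) := fun M hM h0 h1 =>
    ⟨intMap K L (Matrix.GeneralLinearGroup.mk'' M hM), ⟨_, h0, h1, rfl⟩, fun i j => rfl⟩
  have hpinv : (P : L) * ((P⁻¹ : Lˣ) : L) = 1 := P.mul_inv
  by_cases hcd : c ∈ Ideal.span {p} ∧ d ∈ Ideal.span {p}
  · obtain ⟨hc1, hd1⟩ := hcd
    right
    -- If 𝔞 were contained in (p), then d ∈ (p) and d - 1 ∈ 𝔞 would put 1 in (p). So this second
    -- kind of coset occurs only when p ≡ 1 modulo 𝔞.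
    have hp1 : p - 1 ∈ 𝔞 := by
      refine hpa.resolve_left fun hle => hmax.ne_top ((Ideal.eq_top_iff_one _).mpr ?_)
      have := sub_mem hd1 (hle hd')
      rwa [sub_sub_cancel] at this
    obtain ⟨c₁, rfl⟩ := Ideal.mem_span_singleton.mp hc1
    obtain ⟨d₁, rfl⟩ := Ideal.mem_span_singleton.mp hd1
    have hdet : a * d₁ - b * c₁ = u := hcancel (by linear_combination hu)
    obtain ⟨k, hk, hke⟩ := hmk !![a, b; c₁, d₁] (by
        rw [Matrix.det_fin_two_of, hdet]; exact u.isUnit)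
      (by
        have : c₁ = p * c₁ - (p - 1) * c₁ := by ring
        change c₁ ∈ 𝔞
        rw [this]
        exact sub_mem hc' (𝔞.mul_mem_right _ hp1))
      (by
        have : d₁ - 1 = (p * d₁ - 1) - (p - 1) * d₁ := by ring
        change d₁ - 1 ∈ 𝔞
        rw [this]
        exact sub_mem hd' (𝔞.mul_mem_right _ hp1))
    refine ⟨hp1, k, hk, ?_⟩
    apply gl_ext
    · rw [ha, gl_mul_apply, gl_mul_apply, gl_mul_apply, hke, hke]
      simp
    · rw [hb, gl_mul_apply, gl_mul_apply, gl_mul_apply, hke, hke]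
      simp
    · rw [hc, gl_mul_apply, gl_mul_apply, gl_mul_apply, hke, hke]
      simp [hP]
    · rw [hd, gl_mul_apply, gl_mul_apply, gl_mul_apply, hke, hke]
      simp [hP]
  · left
    -- The ideal (c, d) contains the determinant, hence p. By maximality it is (p) or everything,
    -- and (p) is excluded in this branch.
    have htop : Ideal.span {c, d} = ⊤ := by
      have hple : Ideal.span {p} ≤ Ideal.span {c, d} := by
        rw [Ideal.span_singleton_le_iff_mem, Ideal.mem_span_pair]
        refine ⟨-(b * (u⁻¹ : (intRing K L)ˣ)), a * (u⁻¹ : (intRing K L)ˣ), ?_⟩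
        have : ((u : (intRing K L)ˣ) : intRing K L) * (u⁻¹ : (intRing K L)ˣ) = 1 := u.mul_inv
        linear_combination (((u⁻¹ : (intRing K L)ˣ) : intRing K L)) * hu + p * this
      by_contra hne
      have heq := hmax.eq_of_le hne hple
      refine hcd ?_
      rw [heq]
      exact ⟨Ideal.subset_span (by simp), Ideal.subset_span (by simp)⟩
    obtain ⟨x, y, hxy⟩ := Ideal.mem_span_pair.mp ((Ideal.eq_top_iff_one _).mp htop)
    -- With xc + yd = 1, the row (c, d) is completed to a matrix k of determinant u. Solving g = (p
    -- b; 0 1) k then forces b = ax + by, read with the original entries on the right.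
    obtain ⟨k, hk, hke⟩ := hmk !![u * y, -(u * x); c, d] (by
        rw [Matrix.det_fin_two_of]
        have : ↑u * y * d - -(↑u * x) * c = (u : intRing K L) := by linear_combination (u : intRing K L) * hxy
        rw [this]; exact u.isUnit) hc' hd'
    refine ⟨a * x + b * y, k, hk, ?_⟩
    have eA : a = p * (u * y) + (a * x + b * y) * c := by
      linear_combination (-a) * hxy + y * hu
    have eB : b = p * -(u * x) + (a * x + b * y) * d := by
      linear_combination (-b) * hxy - x * hu
    apply gl_ext
    · rw [ha, gl_mul_apply, gl_mul_apply, gl_mul_apply, hke, hke]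
      have := congrArg (Subtype.val) eA
      simpa [hP] using this
    · rw [hb, gl_mul_apply, gl_mul_apply, gl_mul_apply, hke, hke]
      have := congrArg (Subtype.val) eB
      simpa [hP] using this
    · rw [hc, gl_mul_apply, gl_mul_apply, gl_mul_apply, hke, hke]
      simp
    · rw [hd, gl_mul_apply, gl_mul_apply, gl_mul_apply, hke, hke]
      simp

lemma upperRight_mul_diagL_mem (hP : (P : L) = p) (b : intRing K L) :
    Matrix.GeneralLinearGroup.upperRightHom (b : L) * diagL P ∈ heckeSet 𝔞 p := by
  refine ⟨p, b, 0, 1, ?_, ?_, ?_, ?_, zero_mem _, by simp, 1, by simp⟩ <;>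
    simp [gl_mul_apply, hP]

lemma scalar_mul_diagL_mem (hP : (P : L) = p) (hp1 : p - 1 ∈ 𝔞) :
    Matrix.GeneralLinearGroup.scalar (Fin 2) P * diagL P⁻¹ ∈ heckeSet 𝔞 p := by
  refine ⟨1, 0, 0, p, ?_, ?_, ?_, ?_, zero_mem _, hp1, 1, by simp⟩ <;>
    simp [gl_mul_apply, hP]

end Matrices

/-! ### The new vector and its Hecke eigenvalues -/

section NewVector

variable {K : Type*} [Field K] [ValuativeRel K] [TopologicalSpace K] [IsNonarchimedeanLocalField K]
variable {L : Type*} [CommRing L] [Algebra K L]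
variable {V : Type*} [AddCommGroup V] [Module ℂ V] {π : Representation ℂ (GL (Fin 2) L) V}
variable {Λ : V →ₗ[ℂ] ℂ} {ψ : AddChar L ℂ} {W : GL (Fin 2) L → ℂ}

lemma eq_top_of_invariant (hπ : π.IsIrreducible) {S : Submodule ℂ V}
    (hS : ∀ g, ∀ v ∈ S, π g v ∈ S) {v : V} (hv : v ∈ S) (hv0 : v ≠ 0) : S = ⊤ := by
  let T : Subrepresentation π := ⟨S, fun g v hv => hS g v hv⟩
  rcases hπ.eq_bot_or_eq_top T with h | h
  · have : v ∈ T := hv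
    rw [h] at this
    exact absurd this hv0
  · have h2 : T.toSubmodule = (⊤ : Subrepresentation π).toSubmodule := by rw [h]
    exact h2

/-- The vectors with zero Whittaker function form a subrepresentation, proper because Λ ≠ 0.
Irreducibility makes it zero, so identities between Whittaker functions transfer to π. -/
lemma eq_zero_of_whittaker_eq_zero (hπ : π.IsIrreducible) (hΛ0 : Λ ≠ 0) {v : V}
    (hv : ∀ g, Λ (π g v) = 0) : v = 0 := by
  by_contra hv0
  let S : Submodule ℂ V :=
    { carrier := {v | ∀ g, Λ (π g v) = 0}
      add_mem' := fun ha hb g => by rw [map_add, map_add, ha g, hb g, add_zero]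
      zero_mem' := fun g => by rw [map_zero, map_zero]
      smul_mem' := fun c v hv g => by rw [map_smul, map_smul, hv g, smul_zero] }
  have hS : S = ⊤ := eq_top_of_invariant hπ (S := S) (fun g v hv h => by
    rw [← Module.End.mul_apply, ← map_mul]; exact hv _) (v := v) hv hv0
  refine hΛ0 (LinearMap.ext fun w => ?_)
  have hw : w ∈ S := by rw [hS]; trivial
  simpa using hw 1

lemma apply_upperRight (hΛ : IsWhittaker ψ π Λ) (hW : W ∈ whittakerModel π Λ) (y : L)
    (g : GL (Fin 2) L) : W (Matrix.GeneralLinearGroup.upperRightHom y * g) = ψ y * W g := by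
  obtain ⟨v, rfl⟩ := hW
  simp only [LinearMap.pi_apply, LinearMap.comp_apply, map_mul, Module.End.mul_apply]
  exact hΛ y _

lemma translate_mem_whittakerModel (hW : W ∈ whittakerModel π Λ) (h : GL (Fin 2) L) :
    (fun g => W (g * h)) ∈ whittakerModel π Λ := by
  obtain ⟨v, rfl⟩ := hW
  refine ⟨π h v, ?_⟩
  ext g
  simp only [LinearMap.pi_apply, LinearMap.comp_apply, map_mul, Module.End.mul_apply]

lemma scalar_mul_comm (z : Lˣ) (g : GL (Fin 2) L) :
    Matrix.GeneralLinearGroup.scalar (Fin 2) z * g =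
      g * Matrix.GeneralLinearGroup.scalar (Fin 2) z := by
  apply gl_ext <;> simp [gl_mul_apply, mul_comm]

lemma diagL_mul_upperRight (x : Lˣ) (b : L) :
    diagL x * Matrix.GeneralLinearGroup.upperRightHom b =
      Matrix.GeneralLinearGroup.upperRightHom (x * b) * diagL x := by
  apply gl_ext <;> simp [gl_mul_apply]

variable (hW : IsNewVector K π Λ W)
include hW

lemma IsNewVector.mem : W ∈ newLine K π Λ := by
  rw [hW.generates]
  exact Submodule.mem_span_singleton_self W

lemma IsNewVector.eq_smul {f : GL (Fin 2) L → ℂ} (hf : f ∈ newLine K π Λ) :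
    ∃ c : ℂ, ∀ g, f g = c * W g := by
  rw [hW.generates, Submodule.mem_span_singleton] at hf
  obtain ⟨c, rfl⟩ := hf
  exact ⟨c, fun g => rfl⟩

lemma IsNewVector.apply_mul_K1 {k : GL (Fin 2) L} (hk : k ∈ K1 K (conductorIdeal K π))
    (g : GL (Fin 2) L) : W (g * k) = W g := hW.mem.2 k hk g

/-- Translation by a central element preserves the new line, so it acts on W by a number, found by
evaluating at 1. -/
lemma IsNewVector.apply_scalar (z : Lˣ) (g : GL (Fin 2) L) :
    W (Matrix.GeneralLinearGroup.scalar (Fin 2) z * g) =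
      W (Matrix.GeneralLinearGroup.scalar (Fin 2) z) * W g := by
  obtain ⟨c, hc⟩ := hW.eq_smul (f := fun g => W (g * Matrix.GeneralLinearGroup.scalar (Fin 2) z))
    ⟨translate_mem_whittakerModel hW.mem.1 _, fun k hk g => by
      simp only
      rw [mul_assoc, ← scalar_mul_comm, ← mul_assoc, hW.apply_mul_K1 hk]⟩
  have h1 := hc 1
  rw [one_mul, hW.normalised, mul_one] at h1
  rw [scalar_mul_comm, hc, h1]

/-- The vector in `π` that gives rise to the new vector in the Whittaker model. -/
lemma IsNewVector.exists_vector (hπ : π.IsIrreducible) (hΛ0 : Λ ≠ 0) :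
    ∃ v : V, v ≠ 0 ∧ v ∈ invariants π (K1 K (conductorIdeal K π)) ∧ ∀ g, W g = Λ (π g v) := by
  obtain ⟨v, hv⟩ := hW.mem.1
  have hv' : ∀ g, W g = Λ (π g v) := fun g => by rw [← hv]; rfl
  refine ⟨v, ?_, fun k hk => ?_, hv'⟩
  · rintro rfl
    have := hW.normalised
    rw [hv', map_zero, map_zero] at this
    exact zero_ne_one this
  · refine sub_eq_zero.mp (eq_zero_of_whittaker_eq_zero hπ hΛ0 fun g => ?_)
    rw [map_sub, map_sub, ← Module.End.mul_apply, ← map_mul, ← hv', ← hv', hW.apply_mul_K1 hk,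
      sub_self]

/-- The vector behind W is an eigenvector of every scalar matrix. The eigenspace is a non-zero
subrepresentation, hence all of V. This replaces Schur's lemma and shows that `centralChar` does not
take its default value. -/
lemma IsNewVector.apply_scalar_centralChar (hπ : π.IsIrreducible) (hΛ0 : Λ ≠ 0) (z : Lˣ)
    (g : GL (Fin 2) L) : W (Matrix.GeneralLinearGroup.scalar (Fin 2) z * g) =
      (centralChar π z : ℂ) * W g := by
  obtain ⟨v, hv0, -, hv⟩ := hW.exists_vector hπ hΛ0
  let f : Lˣ →* ℂ :=
    { toFun := fun z => W (Matrix.GeneralLinearGroup.scalar (Fin 2) z)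
      map_one' := by rw [map_one, hW.normalised]
      map_mul' := fun z w => by rw [map_mul, hW.apply_scalar] }
  have hex : ∃ ω : Lˣ →* ℂˣ, ∀ (z : Lˣ) (v : V),
      π (Matrix.GeneralLinearGroup.scalar (Fin 2) z) v = (ω z : ℂ) • v := by
    refine ⟨f.toHomUnits, fun z w => ?_⟩
    let S : Submodule ℂ V :=
      { carrier := {w | π (Matrix.GeneralLinearGroup.scalar (Fin 2) z) w = f z • w}
        add_mem' := fun {a b} ha hb => by
          have ha' : π (Matrix.GeneralLinearGroup.scalar (Fin 2) z) a = f z • a := ha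
          have hb' : π (Matrix.GeneralLinearGroup.scalar (Fin 2) z) b = f z • b := hb
          change π _ (a + b) = _
          rw [map_add, ha', hb', smul_add]
        zero_mem' := by
          change π _ 0 = _
          rw [map_zero, smul_zero]
        smul_mem' := fun c a ha => by
          have ha' : π (Matrix.GeneralLinearGroup.scalar (Fin 2) z) a = f z • a := ha
          change π _ (c • a) = _
          rw [map_smul, ha', smul_comm] }
    have hvS : v ∈ S := by
      change π _ v = f z • v
      refine sub_eq_zero.mp (eq_zero_of_whittaker_eq_zero hπ hΛ0 fun g => ?_)
      rw [map_sub, map_sub, ← Module.End.mul_apply, ← map_mul, map_smul, map_smul, ← hv, ← hv,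
        ← scalar_mul_comm, hW.apply_scalar, smul_eq_mul]
      exact sub_self _
    have hS : S = ⊤ := by
      refine eq_top_of_invariant hπ (S := S) (fun g a ha => ?_) hvS hv0
      have ha' : π (Matrix.GeneralLinearGroup.scalar (Fin 2) z) a = f z • a := ha
      change π _ (π g a) = f z • π g a
      rw [← Module.End.mul_apply, ← map_mul, scalar_mul_comm, map_mul, Module.End.mul_apply, ha',
        map_smul]
    have hw : w ∈ S := by rw [hS]; trivial
    exact hw
  have hspec : ∀ (z : Lˣ) (v : V),
      π (Matrix.GeneralLinearGroup.scalar (Fin 2) z) v = (centralChar π z : ℂ) • v := by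
    rw [centralChar, dif_pos hex]
    exact hex.choose_spec
  rw [hv, hv, map_mul, Module.End.mul_apply, hspec, map_smul, smul_eq_mul]

/-- `π` is unramified if and only if its conductor is trivial. -/
lemma IsNewVector.isUnramified_iff (hπ : π.IsIrreducible) (hΛ0 : Λ ≠ 0) :
    IsUnramified K π ↔ conductorIdeal K π = ⊤ := by
  have hK1 : K1 K (⊤ : Ideal (intRing K L)) = Set.range (intMap K L) := by
    ext g
    constructor
    · rintro ⟨k, -, -, rfl⟩
      exact ⟨k, rfl⟩
    · rintro ⟨k, rfl⟩
      exact ⟨k, trivial, trivial, rfl⟩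
  rw [IsUnramified, ← hK1]
  constructor
  · intro h
    exact top_le_iff.mp (le_sSup h)
  · intro h
    -- The conductor is defined as a supremum of ideals; the new vector shows that it carries
    -- non-zero invariants itself.
    obtain ⟨v, hv0, hv, -⟩ := hW.exists_vector hπ hΛ0
    rw [h] at hv
    intro hbot
    rw [hbot] at hv
    exact hv0 hv

/-- The action of a finite union of left cosets that is stable under `K_1(𝔠)` on the new vector. -/
lemma IsNewVector.sum_cosets {ι : Type*} [Fintype ι] (t : ι → GL (Fin 2) L)
    (hcov : ∀ k ∈ K1 K (conductorIdeal K π), ∀ i, ∃ j, ∃ k' ∈ K1 K (conductorIdeal K π),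
      k * t i = t j * k')
    (hinj : ∀ i j, ∀ k ∈ K1 K (conductorIdeal K π), t i = t j * k → i = j) :
    ∃ c : ℂ, ∀ g, ∑ i, W (g * t i) = c * W g := by
  refine hW.eq_smul (f := fun g => ∑ i, W (g * t i)) ⟨?_, fun k hk g => ?_⟩
  · have : (fun g => ∑ i, W (g * t i)) = ∑ i, fun g => W (g * t i) := by
      ext g
      rw [Finset.sum_apply]
    rw [this]
    exact sum_mem fun i _ => translate_mem_whittakerModel hW.mem.1 _
  -- Left multiplication by k permutes the cosets t_i K_1(𝔠), so the sum is K_1(𝔠)-invariant and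
  -- lies on the new line.
  · choose σ κ hκ hσ using hcov k hk
    have hσinj : Function.Injective σ := by
      intro i j hij
      refine hinj i j ((κ j)⁻¹ * κ i) (K1_mul (K1_inv (hκ j)) (hκ i)) ?_
      have h1 := hσ i
      have h2 := hσ j
      rw [hij] at h1
      have h3 : k * t i = k * (t j * ((κ j)⁻¹ * κ i)) := by
        rw [h1, ← mul_assoc k, h2]
        group
      exact mul_left_cancel h3
    have hbij : Function.Bijective σ := Finite.injective_iff_bijective.mp hσinj
    simp only
    rw [← Equiv.sum_comp (Equiv.ofBijective σ hbij) fun j => W (g * t j)]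
    refine Finset.sum_congr rfl fun i _ => ?_
    rw [mul_assoc, hσ, ← mul_assoc, hW.apply_mul_K1 (hκ i)]
    rfl

lemma IsNewVector.apply_diagL_mul_unit (x : Lˣ) (u : (intRing K L)ˣ) :
    W (diagL (x * Units.map (algebraMap (intRing K L) L).toMonoidHom u)) = W (diagL x) := by
  rw [diagL_mul, hW.apply_mul_K1 (diagL_mem_K1 u)]

/-- The new vector vanishes at `(x 0; 0 1)` unless `x` is integral. -/
lemma IsNewVector.apply_diagL_eq_zero (hψ : IsUnramifiedChar K ψ) (hΛ : IsWhittaker ψ π Λ)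
    {x : Lˣ} (hx : (x : L) ∉ intRing K L) : W (diagL x) = 0 := by
  -- For x not integral, 𝒪_L + x𝒪_L is strictly larger than 𝒪_L, so ψ(xb) ≠ 1 for some integral b.
  -- Moving the unipotent of b across diag(x, 1) then gives W = ψ(xb) W there.
  have hlt : (1 : Submodule (intRing K L) L) < 1 ⊔ Submodule.span (intRing K L) {(x : L)} := by
    refine lt_of_le_of_ne le_sup_left fun h => hx ?_
    have hmem : (x : L) ∈ (1 : Submodule (intRing K L) L) := by
      rw [h]
      exact Submodule.mem_sup_right (Submodule.mem_span_singleton_self _)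
    obtain ⟨y, hy⟩ := Submodule.mem_one.mp hmem
    rw [← hy]
    exact y.2
  obtain ⟨y, hy, hψy⟩ := hψ.nontrivial_on_larger _ hlt
  obtain ⟨a, ha, b', hb', rfl⟩ := Submodule.mem_sup.mp hy
  obtain ⟨a, rfl⟩ := Submodule.mem_one.mp ha
  obtain ⟨b, rfl⟩ := Submodule.mem_span_singleton.mp hb'
  have h1 : ψ (x * (b : L)) ≠ 1 := by
    intro h1
    refine hψy ?_
    have h2 : b • (x : L) = x * (b : L) := by rw [Algebra.smul_def, mul_comm]; rfl
    rw [AddChar.map_add_eq_mul, h2, h1, mul_one]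
    exact hψ.trivial_on_integers a
  have h3 := hW.apply_mul_K1 (upperRight_mem_K1 b) (diagL x)
  rw [diagL_mul_upperRight, apply_upperRight hΛ hW.mem.1] at h3
  by_contra h0
  exact h1 (mul_right_cancel₀ h0 (by rw [h3, one_mul]))

variable {p : intRing K L} {P : Lˣ}

/-- The recurrence for the values of the new vector given by the Hecke operator at `p`. -/
lemma IsNewVector.hecke (hψ : IsUnramifiedChar K ψ) (hΛ : IsWhittaker ψ π Λ) (hP : (P : L) = p)
    (hmax : (Ideal.span {p}).IsMaximal) [Finite (intRing K L ⧸ Ideal.span {p})]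
    (hpa : conductorIdeal K π ≤ Ideal.span {p} ∨ p - 1 ∈ conductorIdeal K π) :
    ∃ β γ : ℂ, ∀ x : Lˣ, (x : L) ∈ intRing K L →
      W (diagL (x * P)) = β * W (diagL x) + γ * W (diagL (x * P⁻¹)) := by
  have := Fintype.ofFinite (intRing K L ⧸ Ideal.span {p})
  set rep : intRing K L ⧸ Ideal.span {p} → intRing K L := Quotient.out with hrep
  have hrep_spec : ∀ i, Ideal.Quotient.mk _ (rep i) = i := fun i => Quotient.out_eq i
  let t : intRing K L ⧸ Ideal.span {p} → GL (Fin 2) L := fun i =>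
    Matrix.GeneralLinearGroup.upperRightHom (rep i : L) * diagL P
  set c := conductorIdeal K π with hc
  have hN : (Fintype.card (intRing K L ⧸ Ideal.span {p}) : ℂ) ≠ 0 :=
    Nat.cast_ne_zero.mpr Fintype.card_ne_zero
  -- The coset of (p e; 0 1) depends only on e modulo p, since (p e+py; 0 1) = (p e; 0 1)(1 y; 0 1).
  have hshift : ∀ e : intRing K L, ∃ j, ∃ k ∈ K1 K c,
      Matrix.GeneralLinearGroup.upperRightHom (e : L) * diagL P = t j * k := by
    intro e
    have h1 : Ideal.Quotient.mk (Ideal.span {p}) (e - rep (Ideal.Quotient.mk _ e)) = 0 := by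
      rw [map_sub, hrep_spec, sub_self]
    obtain ⟨y, hy⟩ := Ideal.mem_span_singleton.mp (Ideal.Quotient.eq_zero_iff_mem.mp h1)
    refine ⟨Ideal.Quotient.mk _ e, _, upperRight_mem_K1 y, ?_⟩
    have h2 : (e : L) = rep (Ideal.Quotient.mk _ e) + P * y := by
      rw [hP]
      have := congrArg Subtype.val hy
      change (e : L) - rep (Ideal.Quotient.mk _ e) = p * y at this
      linear_combination this
    change _ = _ * _ * _
    rw [mul_assoc, diagL_mul_upperRight, ← mul_assoc, ← AddChar.map_add_eq_mul, ← h2]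
  have hinj : ∀ i j, ∀ k ∈ K1 K c, t i = t j * k → i = j := by
    rintro i j k ⟨k, h10, h11, rfl⟩ h
    have h0 := congrArg (fun g : GL (Fin 2) L => g 0 1) h
    have h1 := congrArg (fun g : GL (Fin 2) L => g 1 1) h
    simp only [t, gl_mul_apply, intMap_apply] at h0 h1
    simp at h0 h1
    rw [← hrep_spec i, ← hrep_spec j, Ideal.Quotient.eq, Ideal.mem_span_singleton]
    refine ⟨k 0 1, Subtype.ext ?_⟩
    change (rep i : L) - rep j = p * (k 0 1 : intRing K L)
    rw [← h1, hP] at h0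
    linear_combination h0
  -- All cosets of the first kind contribute equally at diag(x, 1) with x integral, because ψ is
  -- trivial on 𝒪_L.
  have hval : ∀ x : Lˣ, (x : L) ∈ intRing K L → ∀ i, W (diagL x * t i) = W (diagL (x * P)) := by
    intro x hx i
    have h1 : ψ (x * (rep i : L)) = 1 := hψ.trivial_on_integers (⟨x, hx⟩ * rep i)
    change W (_ * (_ * _)) = _
    rw [← mul_assoc, diagL_mul_upperRight, mul_assoc, ← diagL_mul,
      apply_upperRight hΛ hW.mem.1, h1, one_mul]
  rcases hpa with hle | hp1
  · obtain ⟨l, hl⟩ := hW.sum_cosets t (fun k hk i => by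
      rcases heckeSet_cover hP hmax (Or.inl hle)
        (K1_mul_heckeSet hk (upperRight_mul_diagL_mem hP (rep i))) with ⟨e, k', hk', he⟩ | ⟨h1, -⟩
      · obtain ⟨j, k'', hk'', hj⟩ := hshift e
        exact ⟨j, k'' * k', K1_mul hk'' hk', he.trans (by rw [hj, mul_assoc])⟩
      · exfalso
        refine hmax.ne_top ((Ideal.eq_top_iff_one _).mpr ?_)
        have := sub_mem (Ideal.mem_span_singleton_self p) (hle h1)
        rwa [sub_sub_cancel] at this) hinj
    -- If 𝔠 ⊆ (p), the coset of (1 0; 0 p) is absent, so the recurrence has one term only and γ = 0.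
    refine ⟨l / Fintype.card (intRing K L ⧸ Ideal.span {p}), 0, fun x hx => ?_⟩
    have h1 := hl (diagL x)
    simp only [hval x hx, Finset.sum_const, Finset.card_univ, nsmul_eq_mul] at h1
    rw [zero_mul, add_zero]
    field_simp
    linear_combination h1
  · set ω := W (Matrix.GeneralLinearGroup.scalar (Fin 2) P)
    let t' : Option (intRing K L ⧸ Ideal.span {p}) → GL (Fin 2) L := fun o =>
      o.elim (Matrix.GeneralLinearGroup.scalar (Fin 2) P * diagL P⁻¹) t
    have hcov : ∀ g ∈ heckeSet c p, ∃ j, ∃ k' ∈ K1 K c, g = t' j * k' := by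
      intro g hg
      rcases heckeSet_cover hP hmax (Or.inr hp1) hg with ⟨e, k', hk', he⟩ | ⟨h1, k', hk', he⟩
      · obtain ⟨j, k'', hk'', hj⟩ := hshift e
        exact ⟨some j, k'' * k', K1_mul hk'' hk', by
          change g = t j * (k'' * k')
          rw [← mul_assoc, ← hj]; exact he⟩
      · exact ⟨none, k', hk', he⟩
    -- Separates the extra coset of (1 0; 0 p) from the others: their coincidence would make p a
    -- unit.
    have hunit : ¬ IsUnit p := fun hu => hmax.ne_top (Ideal.span_singleton_eq_top.mpr hu)
    obtain ⟨l, hl⟩ := hW.sum_cosets t' (fun k hk o => by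
      refine hcov _ (K1_mul_heckeSet hk ?_)
      cases o with
      | none => exact scalar_mul_diagL_mem hP hp1
      | some i => exact upperRight_mul_diagL_mem hP (rep i)) (by
      rintro (_ | i) (_ | j) k hk h
      · rfl
      · exfalso
        obtain ⟨k, -, -, rfl⟩ := hk
        have h0 := congrArg (fun g : GL (Fin 2) L => g 0 0) h
        have h1 := congrArg (fun g : GL (Fin 2) L => g 1 0) h
        simp only [t', t, Option.elim, gl_mul_apply, intMap_apply] at h0 h1
        simp at h0 h1
        rw [← h1, hP] at h0
        refine hunit (IsUnit.of_mul_eq_one (k 0 0) (Subtype.ext ?_))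
        change (p : L) * (k 0 0 : intRing K L) = 1
        linear_combination -h0
      · exfalso
        obtain ⟨k, -, -, rfl⟩ := hk
        have h1 := congrArg (fun g : GL (Fin 2) L => g 1 1) h
        simp only [t', t, Option.elim, gl_mul_apply, intMap_apply] at h1
        simp at h1
        refine hunit (IsUnit.of_mul_eq_one (k 1 1) (Subtype.ext ?_))
        change (p : L) * (k 1 1 : intRing K L) = 1
        rw [← hP, ← h1]
      · rw [hinj i j k hk h])
    refine ⟨l / Fintype.card (intRing K L ⧸ Ideal.span {p}),
      -ω / Fintype.card (intRing K L ⧸ Ideal.span {p}), fun x hx => ?_⟩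
    have h1 := hl (diagL x)
    rw [Fintype.sum_option] at h1
    have h2 : W (diagL x * t' none) = ω * W (diagL (x * P⁻¹)) := by
      change W (diagL x * (_ * _)) = _
      rw [← mul_assoc, ← scalar_mul_comm, mul_assoc, hW.apply_scalar, ← diagL_mul]
    have h3 : ∀ i, W (diagL x * t' (some i)) = W (diagL (x * P)) := fun i => hval x hx i
    simp only [h2, h3, Finset.sum_const, Finset.card_univ, nsmul_eq_mul] at h1
    field_simp
    linear_combination h1

/-- The values of the new vector along powers of `p`. -/
lemma IsNewVector.exists_isMatrixCoeff (hψ : IsUnramifiedChar K ψ) (hΛ : IsWhittaker ψ π Λ)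
    (hP : (P : L) = p) (hmax : (Ideal.span {p}).IsMaximal)
    [Finite (intRing K L ⧸ Ideal.span {p})]
    (hpa : conductorIdeal K π ≤ Ideal.span {p} ∨ p - 1 ∈ conductorIdeal K π) :
    ∃ α : ℕ → ℂ, IsMatrixCoeff α ∧ ∀ y : Lˣ, (y : L) ∈ intRing K L →
      ((y * P⁻¹ : Lˣ) : L) ∉ intRing K L → ∀ n, W (diagL (y * P ^ n)) = α n * W (diagL y) := by
  obtain ⟨β, γ, h⟩ := hW.hecke hψ hΛ hP hmax hpa
  -- The pair holds two consecutive terms. It starts at (1, β) because the γ-term of the first step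
  -- is W at the non-integral point y P⁻¹, which vanishes. In particular the sequence does not
  -- depend on y.
  let f : ℕ → ℂ × ℂ := fun n => (fun v : ℂ × ℂ => (v.2, β * v.2 + γ * v.1))^[n] (1, β)
  have hf : ∀ n, f (n + 1) = ((f n).2, β * (f n).2 + γ * (f n).1) := fun n => by
    simp only [f, Function.iterate_succ_apply']
  refine ⟨fun n => (f n).1, isMatrixCoeff_of_recurrence β γ rfl (by simp only [hf]; rfl)
    (fun n => by simp only [hf]), fun y hy hy' n => ?_⟩
  have key : ∀ n, W (diagL (y * P ^ n)) = (f n).1 * W (diagL y) ∧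
      W (diagL (y * P ^ (n + 1))) = (f n).2 * W (diagL y) := by
    intro n
    induction n with
    | zero =>
      refine ⟨by simp [f], ?_⟩
      rw [zero_add, pow_one, h y hy, hW.apply_diagL_eq_zero hψ hΛ hy', mul_zero, add_zero]
      rfl
    | succ n ih =>
      refine ⟨by rw [hf]; exact ih.2, ?_⟩
      have hint : ((y * P ^ (n + 1) : Lˣ) : L) ∈ intRing K L := by
        rw [Units.val_mul, Units.val_pow_eq_pow_val, hP]
        exact mul_mem hy (pow_mem p.2 _)
      have e1 : y * P ^ (n + 1 + 1) = y * P ^ (n + 1) * P := by rw [pow_succ, mul_assoc]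
      have e2 : y * P ^ (n + 1) * P⁻¹ = y * P ^ n := by rw [pow_succ, mul_assoc, mul_inv_cancel_right]
      rw [e1, h _ hint, e2, ih.1, ih.2, hf]
      ring
  exact (key n).1

end NewVector

/-! ### Quadratic algebras -/

section Quadratic

/-- Cayley–Hamilton for multiplication by x, whose characteristic polynomial has degree 2; t and n
are the trace and the norm. -/
lemma exists_sq_eq {F A : Type*} [Field F] [CommRing A] [Algebra F A]
    (hA : Module.finrank F A = 2) (x : A) :
    ∃ t n : F, x ^ 2 = algebraMap F A t * x - algebraMap F A n := by
  have : Module.Finite F A := Module.finite_of_finrank_pos (by omega)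
  set p := (Algebra.lmul F A x).charpoly with hp
  have hdeg : p.natDegree = 2 := by rw [hp, LinearMap.charpoly_natDegree, hA]
  have hmon : p.Monic := LinearMap.charpoly_monic _
  have h0 : aeval (Algebra.lmul F A x) p = 0 := LinearMap.aeval_self_charpoly _
  rw [aeval_algHom_apply] at h0
  have h1 : aeval x p = 0 := by
    have := congrArg (fun f : Module.End F A => f 1) h0
    simpa using this
  rw [aeval_eq_sum_range, hdeg] at h1
  have hc : p.coeff 2 = 1 := by rw [← hdeg]; exact hmon
  simp only [Finset.sum_range_succ, Finset.sum_range_zero, Algebra.smul_def, hc, map_one] at h1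
  refine ⟨-p.coeff 1, p.coeff 0, ?_⟩
  rw [map_neg]
  linear_combination h1

/-- A reduced algebra of degree two over a field `F` that is not a field is isomorphic to
`F × F`. -/
lemma nonempty_algEquiv_prod {F A : Type*} [Field F] [CommRing A] [Algebra F A] [IsReduced A]
    (hA : Module.finrank F A = 2) (hF : ¬ IsField A) : Nonempty ((F × F) ≃ₐ[F] A) := by
  have hfin : Module.Finite F A := Module.finite_of_finrank_pos (by omega)
  have : Nontrivial A := Module.nontrivial_of_finrank_pos (R := F) (by omega)
  have hinj : Function.Injective (algebraMap F A) := (algebraMap F A).injective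
  obtain ⟨x, hx0, hx⟩ : ∃ x : A, x ≠ 0 ∧ ¬ IsUnit x := by
    by_contra! h
    exact hF ⟨exists_pair_ne A, mul_comm, fun {a} ha => (h a ha).exists_right_inv⟩
  obtain ⟨t, n, htn⟩ := exists_sq_eq hA x
  have hn : n = 0 := by
    by_contra hn
    refine hx (IsUnit.of_mul_eq_one (algebraMap F A n⁻¹ * (algebraMap F A t - x)) ?_)
    have : algebraMap F A n * algebraMap F A n⁻¹ = 1 := by
      rw [← map_mul, mul_inv_cancel₀ hn, map_one]
    linear_combination this - algebraMap F A n⁻¹ * htn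
  rw [hn, map_zero, sub_zero] at htn
  have ht : t ≠ 0 := by
    rintro rfl
    rw [map_zero, zero_mul] at htn
    exact hx0 (pow_eq_zero_iff two_ne_zero |>.mp htn)
  have htt : algebraMap F A t * algebraMap F A t⁻¹ = 1 := by
    rw [← map_mul, mul_inv_cancel₀ ht, map_one]
  -- A non-zero non-unit x has norm 0, so x² = tx, and t ≠ 0 because A is reduced. Then x/t is an
  -- idempotent different from 0 and 1.
  set ε : A := algebraMap F A t⁻¹ * x with hε
  have hεε : ε * ε = ε := by
    rw [hε]
    linear_combination (algebraMap F A t⁻¹) ^ 2 * htn + algebraMap F A t⁻¹ * x * htt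
  have hε0 : ε ≠ 0 := by
    intro h
    refine hx0 ?_
    rw [hε] at h
    linear_combination algebraMap F A t * h - x * htt
  have hε1 : 1 - ε ≠ 0 := by
    intro h
    refine hx (IsUnit.of_mul_eq_one (algebraMap F A t⁻¹) ?_)
    rw [hε] at h
    linear_combination -h
  let f : (F × F) →ₐ[F] A :=
    { toFun := fun a => algebraMap F A a.1 * ε + algebraMap F A a.2 * (1 - ε)
      map_one' := by simp
      map_mul' := fun a b => by
        simp only [Prod.fst_mul, Prod.snd_mul, map_mul]
        linear_combination (-(algebraMap F A a.1 - algebraMap F A a.2) *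
          (algebraMap F A b.1 - algebraMap F A b.2)) * hεε
      map_zero' := by simp
      map_add' := fun a b => by
        simp only [Prod.fst_add, Prod.snd_add, map_add]
        ring
      commutes' := fun a => by
        simp only [Prod.algebraMap_apply, Algebra.algebraMap_self, RingHom.id_apply]
        ring }
  have hcancel : ∀ (a : F) (y : A), y ≠ 0 → algebraMap F A a * y = 0 → a = 0 := by
    intro a y hy h
    rw [← Algebra.smul_def] at h
    exact (smul_eq_zero.mp h).resolve_right hy
  have hf : Function.Injective f := by
    rw [injective_iff_map_eq_zero]
    rintro ⟨a, b⟩ hab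
    have hab' : algebraMap F A a * ε + algebraMap F A b * (1 - ε) = 0 := hab
    refine Prod.ext (hcancel a ε hε0 ?_) (hcancel b (1 - ε) hε1 ?_)
    · linear_combination ε * hab' + (algebraMap F A b - algebraMap F A a) * hεε
    · linear_combination (1 - ε) * hab' + (algebraMap F A a - algebraMap F A b) * hεε
  have hdim : Module.finrank F (F × F) = Module.finrank F A := by
    rw [hA, Module.finrank_prod, Module.finrank_self]
  exact ⟨AlgEquiv.ofBijective f
    ⟨hf, (LinearMap.injective_iff_surjective_of_finrank_eq_finrank hdim (f := f.toLinearMap)).mp hf⟩⟩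

end Quadratic

/-! ### The ring of integers of `L` -/

section IntegersSplit

variable {K : Type*} [Field K] [ValuativeRel K] [TopologicalSpace K] [IsNonarchimedeanLocalField K]
variable {L : Type*} [CommRing L] [Algebra K L]

/-- Integrality in K × K can be tested on each coordinate, and 𝒪_K is integrally closed. -/
lemma nonempty_intRing_algEquiv_prod (Φ : (K × K) ≃ₐ[K] L) :
    Nonempty ((𝒪[K] × 𝒪[K]) ≃ₐ[𝒪[K]] intRing K L) := by
  let ι : (𝒪[K] × 𝒪[K]) →ₐ[𝒪[K]] (K × K) :=
    AlgHom.prodMap (Algebra.ofId 𝒪[K] K) (Algebra.ofId 𝒪[K] K)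
  let f : (𝒪[K] × 𝒪[K]) →ₐ[𝒪[K]] L := (Φ.toAlgHom.restrictScalars 𝒪[K]).comp ι
  let g : (𝒪[K] × 𝒪[K]) →ₐ[𝒪[K]] intRing K L :=
    f.codRestrict _ fun x => (Algebra.IsIntegral.isIntegral (R := 𝒪[K]) x).map f
  have hg : ∀ x, (g x : L) = Φ ((x.1 : K), (x.2 : K)) := fun x => rfl
  refine ⟨AlgEquiv.ofBijective g ⟨fun x y hxy => ?_, fun x => ?_⟩⟩
  · have h1 := congrArg Subtype.val hxy
    rw [hg, hg] at h1
    have h2 := Φ.injective h1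
    exact Prod.ext (Subtype.ext (congrArg Prod.fst h2)) (Subtype.ext (congrArg Prod.snd h2))
  · have hx : IsIntegral 𝒪[K] (Φ.symm (x : L)) := IsIntegral.map
      ((Φ.symm.toAlgHom).restrictScalars 𝒪[K]) x.2
    obtain ⟨a, ha⟩ := IsIntegrallyClosed.isIntegral_iff.mp (hx.map (AlgHom.fst 𝒪[K] K K))
    obtain ⟨b, hb⟩ := IsIntegrallyClosed.isIntegral_iff.mp (hx.map (AlgHom.snd 𝒪[K] K K))
    refine ⟨(a, b), Subtype.ext ?_⟩
    rw [hg, ← Φ.apply_symm_apply (x : L)]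
    exact congrArg Φ (Prod.ext ha hb)

end IntegersSplit

/-! ### The ring of integers of a quadratic field extension. -/

section IntegersField

variable {K : Type*} [Field K] [ValuativeRel K] [TopologicalSpace K] [IsNonarchimedeanLocalField K]
variable {L : Type*} [Field L] [Algebra K L]

/-- Hensel's lemma for the polynomials `Y² - Y + a`. -/
lemma exists_sq_sub_self_eq {a : 𝒪[K]} (ha : a ∈ 𝓂[K]) : ∃ y : 𝒪[K], y ^ 2 - y + a = 0 := by
  let := IsTopologicalAddGroup.rightUniformSpace K
  have := isUniformAddGroup_of_addCommGroup (G := K)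
  have h : HenselianRing 𝒪[K] 𝓂[K] := inferInstance
  have hmon : (X ^ 2 - X + C a : 𝒪[K][X]).Monic := by monicity!
  obtain ⟨y, hy, -⟩ := h.is_henselian _ hmon 0 (by simpa using ha) (by simp)
  exact ⟨y, by simpa [IsRoot] using hy⟩

/-- If the trace t were not integral, then n/t² would lie in the maximal ideal and Hensel's lemma
would give a root y of Y² - Y + n/t². Then ty would be a root in K of the quadratic polynomial of x,
placing x in K. -/
lemma isIntegral_of_sq_eq {x : L} (hx : x ∉ Set.range (algebraMap K L)) {t n : K}
    (h : x ^ 2 = algebraMap K L t * x - algebraMap K L n) (hn : valuation K n ≤ 1) :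
    IsIntegral 𝒪[K] x := by
  have ht : valuation K t ≤ 1 := by
    by_contra! ht
    have ht0 : t ≠ 0 := by
      rintro rfl
      simp at ht
    have hlt : valuation K (n / t ^ 2) < 1 := by
      rw [map_div₀, map_pow, div_lt_one₀ (pow_pos (zero_lt_one.trans ht) 2)]
      exact hn.trans_lt (one_lt_pow₀ ht two_ne_zero)
    have hmem : (⟨n / t ^ 2, hlt.le⟩ : 𝒪[K]) ∈ 𝓂[K] := by
      rw [IsLocalRing.mem_maximalIdeal, mem_nonunits_iff]
      intro hu
      exact hlt.ne ((Valuation.Integers.isUnit_iff_valuation_eq_one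
          (Valuation.integer.integers (valuation K))).mp hu)
    obtain ⟨y, hy⟩ := exists_sq_sub_self_eq hmem
    have hy' : (y : K) ^ 2 - y + n / t ^ 2 = 0 := congrArg Subtype.val hy
    have hroot : (t * y) ^ 2 - t * (t * y) + n = 0 := by
      field_simp at hy'
      linear_combination hy'
    have hroot' := congrArg (algebraMap K L) hroot
    simp only [map_add, map_sub, map_mul, map_pow, map_zero] at hroot'
    have hprod : (x - algebraMap K L (t * y)) * (x - algebraMap K L (t - t * y)) = 0 := by
      simp only [map_mul, map_sub]
      linear_combination h - hroot'
    rcases mul_eq_zero.mp hprod with h1 | h1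
    · exact hx ⟨_, (sub_eq_zero.mp h1).symm⟩
    · exact hx ⟨_, (sub_eq_zero.mp h1).symm⟩
  refine ⟨X ^ 2 - C (⟨t, ht⟩ : 𝒪[K]) * X + C (⟨n, hn⟩ : 𝒪[K]), by monicity!, ?_⟩
  have e1 : algebraMap 𝒪[K] L ⟨t, ht⟩ = algebraMap K L t := rfl
  have e2 : algebraMap 𝒪[K] L ⟨n, hn⟩ = algebraMap K L n := rfl
  simp only [eval₂_add, eval₂_sub, eval₂_mul, eval₂_pow, eval₂_X, eval₂_C, e1, e2]
  linear_combination h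

/-- Integrality is decided by the norm: either n or n⁻¹ is integral, and x⁻¹ has trace t/n and norm
1/n. -/
lemma isIntegral_or_isIntegral_inv (hL : Module.finrank K L = 2) (x : L) :
    IsIntegral 𝒪[K] x ∨ IsIntegral 𝒪[K] x⁻¹ := by
  by_cases hx : x ∈ Set.range (algebraMap K L)
  · obtain ⟨a, rfl⟩ := hx
    have hint : ∀ b : K, valuation K b ≤ 1 → IsIntegral 𝒪[K] (algebraMap K L b) := fun b hb =>
      isIntegral_algebraMap (R := 𝒪[K]) (A := L) (x := ⟨b, hb⟩)
    rcases le_total (valuation K a) 1 with ha | ha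
    · exact Or.inl (hint a ha)
    · refine Or.inr ?_
      rw [← map_inv₀]
      refine hint _ ?_
      rw [map_inv₀]
      exact inv_le_one_of_one_le₀ ha
  · obtain ⟨t, n, h⟩ := exists_sq_eq hL x
    have hx0 : x ≠ 0 := by
      rintro rfl
      exact hx ⟨0, map_zero _⟩
    have hn0 : n ≠ 0 := by
      rintro rfl
      refine hx ⟨t, mul_right_cancel₀ hx0 ?_⟩
      rw [map_zero] at h
      linear_combination -h
    rcases le_total (valuation K n) 1 with hn | hn
    · exact Or.inl (isIntegral_of_sq_eq hx h hn)
    · refine Or.inr (isIntegral_of_sq_eq (t := t / n) (n := n⁻¹) ?_ ?_ ?_)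
      · rintro ⟨a, ha⟩
        exact hx ⟨a⁻¹, by rw [map_inv₀, ha, inv_inv]⟩
      · have hn' : algebraMap K L n ≠ 0 := by simpa using hn0
        rw [map_div₀, map_inv₀]
        field_simp
        linear_combination h
      · rw [map_inv₀]
        exact inv_le_one_of_one_le₀ hn

lemma valuationRing_intRing (hL : Module.finrank K L = 2) : ValuationRing (intRing K L) := by
  have : Module.Finite K L := Module.finite_of_finrank_pos (by omega)
  have : IsFractionRing (intRing K L) L :=
    integralClosure.isFractionRing_of_finite_extension K L
  refine (ValuationRing.iff_isInteger_or_isInteger (intRing K L) L).mpr fun x => ?_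
  rcases isIntegral_or_isIntegral_inv hL x with h | h
  · exact Or.inl ⟨⟨x, h⟩, rfl⟩
  · exact Or.inr ⟨⟨x⁻¹, h⟩, rfl⟩

/-- The structure of the ring of integers of a separable quadratic field extension. -/
lemma exists_prime_intRing (hL : Module.finrank K L = 2) [Algebra.IsSeparable K L] :
    ∃ p : intRing K L, p ≠ 0 ∧ (Ideal.span {p}).IsMaximal ∧
      Finite (intRing K L ⧸ Ideal.span {p}) ∧
      (∃ (e : ℕ) (u : (intRing K L)ˣ), algebraMap 𝒪[K] (intRing K L) (uniformiser K) = p ^ e * u) ∧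
      ∀ c : Ideal (intRing K L), c ≤ Ideal.span {p} ∨ c = ⊤ := by
  have : Module.Finite K L := Module.finite_of_finrank_pos (by omega)
  have hfin : Module.Finite 𝒪[K] (intRing K L) := IsIntegralClosure.finite 𝒪[K] K L (intRing K L)
  have hnoeth : IsNoetherianRing (intRing K L) :=
    IsIntegralClosure.isNoetherianRing 𝒪[K] K L (intRing K L)
  have hval : ValuationRing (intRing K L) := valuationRing_intRing hL
  have hint : Algebra.IsIntegral 𝒪[K] (intRing K L) := Algebra.IsIntegral.of_finite _ _
  have hinj : Function.Injective (algebraMap 𝒪[K] (intRing K L)) := by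
    intro a b hab
    have : algebraMap K L a = algebraMap K L b := congrArg Subtype.val hab
    exact Subtype.ext ((algebraMap K L).injective this)
  have hnf : ¬ IsField (intRing K L) := fun h => IsDiscreteValuationRing.not_isField 𝒪[K]
    (isField_of_isIntegral_of_isField hinj h)
  -- A noetherian valuation ring is principal, and it is not a field because 𝒪_K is not one.
  -- Noetherianity rests on separability of L over K.
  have hdvr : IsDiscreteValuationRing (intRing K L) :=
    { toIsPrincipalIdealRing := inferInstance
      toIsLocalRing := inferInstance
      not_a_field' := fun h => hnf (IsLocalRing.isField_iff_maximalIdeal_eq.mpr h) }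
  obtain ⟨p, hp⟩ := IsDiscreteValuationRing.exists_irreducible (intRing K L)
  have hspan : Ideal.span {p} = IsLocalRing.maximalIdeal (intRing K L) :=
    hp.maximalIdeal_eq.symm
  refine ⟨p, hp.ne_zero, hspan ▸ inferInstance, ?_, ?_, fun c => ?_⟩
  · have hcomap : (IsLocalRing.maximalIdeal (intRing K L)).comap (algebraMap 𝒪[K] (intRing K L)) =
        𝓂[K] := IsLocalRing.eq_maximalIdeal (Ideal.isMaximal_comap_of_isIntegral_of_isMaximal _)
    have hover : (IsLocalRing.maximalIdeal (intRing K L)).LiesOver 𝓂[K] := ⟨hcomap.symm⟩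
    have hk : Finite (𝒪[K] ⧸ 𝓂[K]) := inferInstanceAs (Finite 𝓀[K])
    rw [hspan]
    exact Module.finite_of_finite (𝒪[K] ⧸ 𝓂[K])
  · obtain ⟨e, u, h⟩ := IsDiscreteValuationRing.eq_unit_mul_pow_irreducible
      (x := algebraMap 𝒪[K] (intRing K L) (uniformiser K))
      (fun h => (uniformiser_irreducible K).ne_zero (hinj (by rw [h, map_zero]))) hp
    exact ⟨e, u, by rw [h, mul_comm]⟩
  · rw [hspan]
    by_cases hc : c = ⊤
    · exact Or.inr hc
    · exact Or.inl (IsLocalRing.le_maximalIdeal hc)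

end IntegersField

/-! ### The values of the new vector on the torus -/

section TorusValues

variable {K : Type*} [Field K] [ValuativeRel K] [TopologicalSpace K] [IsNonarchimedeanLocalField K]
variable {L : Type*} [CommRing L] [Algebra K L]
variable {V : Type*} [AddCommGroup V] [Module ℂ V] {π : Representation ℂ (GL (Fin 2) L) V}
variable {Λ : V →ₗ[ℂ] ℂ} {ψ : AddChar L ℂ} {W : GL (Fin 2) L → ℂ}

lemma torusValue_eq_diagL (n : ℕ) : torusValue K W n =
    W (diagL (Units.map (algebraMap K L).toMonoidHom (uniformiserUnit K) ^ n)) := by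
  rw [torusValue, inclH_diagH, zpow_natCast, map_pow]

variable (hW : IsNewVector K π Λ W)
include hW

lemma IsNewVector.torusValue_of_neg [Nontrivial L] (hψ : IsUnramifiedChar K ψ)
    (hΛ : IsWhittaker ψ π Λ) {n : ℤ} (hn : n < 0) : torusValue K W n = 0 := by
  rw [torusValue, inclH_diagH]
  refine hW.apply_diagL_eq_zero hψ hΛ fun h => ?_
  have h1 : IsIntegral 𝒪[K] (algebraMap K L ((uniformiserUnit K ^ n : Kˣ) : K)) := h
  rw [isIntegral_algebraMap_iff (algebraMap K L).injective] at h1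
  obtain ⟨a, ha⟩ := IsIntegrallyClosed.isIntegral_iff.mp h1
  have h2 : valuation K ((uniformiserUnit K ^ n : Kˣ) : K) ≤ 1 := by
    rw [← ha]
    exact a.2
  rw [Units.val_zpow_eq_zpow_val, map_zpow₀] at h2
  have h3 : unifVal K ^ n ≤ unifVal K ^ (0 : ℤ) := by
    rw [_root_.zpow_zero]
    exact h2
  rw [unifVal_zpow_le_iff] at h3
  omega

/-- Here ϖ_K = p^e u, and the unit u is absorbed by K_1(𝔠). The recurrence at p started at y = 1
gives a(n) = α(en). -/
lemma IsNewVector.isMatrixCoeff_of_local (hψ : IsUnramifiedChar K ψ) (hΛ : IsWhittaker ψ π Λ)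
    {p : intRing K L} (hmax : (Ideal.span {p}).IsMaximal) [Finite (intRing K L ⧸ Ideal.span {p})]
    {e : ℕ} {u : (intRing K L)ˣ}
    (hp : algebraMap 𝒪[K] (intRing K L) (uniformiser K) = p ^ e * u)
    (hc : ∀ c : Ideal (intRing K L), c ≤ Ideal.span {p} ∨ c = ⊤) (hp0 : IsUnit (p : L)) :
    IsMatrixCoeff fun n : ℕ => torusValue K W n := by
  obtain ⟨P, hP⟩ := hp0
  obtain ⟨α, hα, h⟩ := hW.exists_isMatrixCoeff hψ hΛ hP hmax
    ((hc (conductorIdeal K π)).imp_right fun h => by rw [h]; trivial)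
  have hunit : Units.map (algebraMap K L).toMonoidHom (uniformiserUnit K) =
      P ^ e * Units.map (algebraMap (intRing K L) L).toMonoidHom u := by
    ext
    rw [Units.val_mul, Units.val_pow_eq_pow_val, hP]
    exact congrArg Subtype.val hp
  have h1 : ∀ n : ℕ, torusValue K W n = α (e * n) := by
    intro n
    rw [torusValue_eq_diagL, hunit, mul_pow, ← map_pow, hW.apply_diagL_mul_unit, ← pow_mul,
      ← one_mul (P ^ (e * n)), h 1 (one_mem _)]
    · have : (diagL 1 : GL (Fin 2) L) = 1 := by apply gl_ext <;> simp
      rw [this, hW.normalised, mul_one]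
    · rw [one_mul]
      intro hmem
      refine hmax.ne_top (Ideal.span_singleton_eq_top.mpr
        (IsUnit.of_mul_eq_one ⟨_, hmem⟩ (Subtype.ext ?_)))
      change (p : L) * ((P⁻¹ : Lˣ) : L) = 1
      rw [← hP, Units.mul_inv]
  simp only [h1]
  exact hα.comp_mul e

/-- With ϖ_K = p₁p₂, the recurrence at p₁ is run from the starting point p₂^n and the one at p₂ from
the starting point 1. The first sequence does not depend on its starting point, so a(n) = α(n) β(n).
-/
lemma IsNewVector.isMatrixCoeff_of_split (hψ : IsUnramifiedChar K ψ) (hΛ : IsWhittaker ψ π Λ)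
    (f : (𝒪[K] × 𝒪[K]) ≃ₐ[𝒪[K]] intRing K L)
    (hϖ : IsUnit (algebraMap K L (uniformiser K))) :
    IsMatrixCoeff fun n : ℕ => torusValue K W n := by
  set ϖ := uniformiser K with hϖ_def
  have hm : Ideal.span {ϖ} = 𝓂[K] := (uniformiser_irreducible K).maximalIdeal_eq.symm
  set p₁ := f (ϖ, 1) with hp₁
  set p₂ := f (1, ϖ) with hp₂
  have hprod : p₁ * p₂ = algebraMap 𝒪[K] (intRing K L) ϖ := by
    rw [hp₁, hp₂, ← map_mul, ← f.commutes]
    congr 1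
    exact Prod.ext (mul_one _) (one_mul _)
  have hprod' : (p₁ : L) * p₂ = algebraMap K L ϖ := congrArg Subtype.val hprod
  obtain ⟨P₁, hP₁⟩ : IsUnit (p₁ : L) := isUnit_of_mul_isUnit_left (hprod' ▸ hϖ)
  obtain ⟨P₂, hP₂⟩ : IsUnit (p₂ : L) := isUnit_of_mul_isUnit_right (hprod' ▸ hϖ)
  have hunit : Units.map (algebraMap K L).toMonoidHom (uniformiserUnit K) = P₂ * P₁ := by
    ext
    rw [Units.val_mul, hP₁, hP₂, mul_comm, hprod']
    rfl
  let g₁ : intRing K L →+* 𝒪[K] := (RingHom.fst _ _).comp f.symm.toRingEquiv.toRingHom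
  let g₂ : intRing K L →+* 𝒪[K] := (RingHom.snd _ _).comp f.symm.toRingEquiv.toRingHom
  have hg₁ : ∀ a b, g₁ (f (a, b)) = a := fun a b => congrArg Prod.fst (f.symm_apply_apply (a, b))
  have hg₂ : ∀ a b, g₂ (f (a, b)) = b := fun a b => congrArg Prod.snd (f.symm_apply_apply (a, b))
  have hsurj : ∀ x, ∃ a b, x = f (a, b) := fun x => ⟨_, _, (f.apply_symm_apply x).symm⟩
  have hs₁ : Ideal.span {p₁} = 𝓂[K].comap g₁ := by
    ext x
    obtain ⟨a, b, rfl⟩ := hsurj x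
    rw [Ideal.mem_comap, hg₁, ← hm, Ideal.mem_span_singleton, Ideal.mem_span_singleton]
    constructor
    · intro h
      simpa [hp₁, hg₁] using map_dvd g₁ h
    · rintro ⟨c, rfl⟩
      refine ⟨f (c, b), ?_⟩
      rw [hp₁, ← map_mul, Prod.mk_mul_mk, one_mul]
  have hs₂ : Ideal.span {p₂} = 𝓂[K].comap g₂ := by
    ext x
    obtain ⟨a, b, rfl⟩ := hsurj x
    rw [Ideal.mem_comap, hg₂, ← hm, Ideal.mem_span_singleton, Ideal.mem_span_singleton]
    constructor
    · intro h
      simpa [hp₂, hg₂] using map_dvd g₂ h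
    · rintro ⟨c, rfl⟩
      refine ⟨f (a, c), ?_⟩
      rw [hp₂, ← map_mul, Prod.mk_mul_mk, one_mul]
  have hk : Finite (𝒪[K] ⧸ 𝓂[K]) := inferInstanceAs (Finite 𝓀[K])
  have hmax₁ : (Ideal.span {p₁}).IsMaximal := by
    rw [hs₁]
    exact Ideal.comap_isMaximal_of_surjective g₁ fun a => ⟨f (a, 0), hg₁ _ _⟩
  have hmax₂ : (Ideal.span {p₂}).IsMaximal := by
    rw [hs₂]
    exact Ideal.comap_isMaximal_of_surjective g₂ fun a => ⟨f (0, a), hg₂ _ _⟩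
  have hfin₁ : Finite (intRing K L ⧸ Ideal.span {p₁}) := by
    rw [hs₁]
    exact Finite.of_injective _ (Ideal.quotientMap_injective (I := 𝓂[K]) (f := g₁))
  have hfin₂ : Finite (intRing K L ⧸ Ideal.span {p₂}) := by
    rw [hs₂]
    exact Finite.of_injective _ (Ideal.quotientMap_injective (I := 𝓂[K]) (f := g₂))
  -- If 𝔠 is not inside (p₁), it has an element whose first coordinate is a unit, and then (ϖ - 1,
  -- 0) = p₁ - 1 is a multiple of that element.
  have hc₁ : conductorIdeal K π ≤ Ideal.span {p₁} ∨ p₁ - 1 ∈ conductorIdeal K π := by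
    rw [or_iff_not_imp_left, hs₁]
    intro h
    obtain ⟨x, hx, hx'⟩ := Set.not_subset.mp h
    obtain ⟨a, b, rfl⟩ := hsurj x
    have hu : IsUnit a := by
      rw [SetLike.mem_coe, Ideal.mem_comap, hg₁, IsLocalRing.mem_maximalIdeal, mem_nonunits_iff,
        not_not] at hx'
      exact hx'
    obtain ⟨u, rfl⟩ := hu
    have : p₁ - 1 = f (((u⁻¹ : 𝒪[K]ˣ) : 𝒪[K]) * (ϖ - 1), 0) * f ((u : 𝒪[K]), b) := by
      rw [hp₁, ← map_one f, ← map_sub, ← map_mul]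
      congr 1
      refine Prod.ext ?_ ?_
      · change ϖ - 1 = ((u⁻¹ : 𝒪[K]ˣ) : 𝒪[K]) * (ϖ - 1) * u
        rw [mul_right_comm, Units.inv_mul, one_mul]
      · change (1 : 𝒪[K]) - 1 = 0 * b
        rw [sub_self, zero_mul]
    rw [this]
    exact Ideal.mul_mem_left _ _ hx
  have hc₂ : conductorIdeal K π ≤ Ideal.span {p₂} ∨ p₂ - 1 ∈ conductorIdeal K π := by
    rw [or_iff_not_imp_left, hs₂]
    intro h
    obtain ⟨x, hx, hx'⟩ := Set.not_subset.mp h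
    obtain ⟨a, b, rfl⟩ := hsurj x
    have hu : IsUnit b := by
      rw [SetLike.mem_coe, Ideal.mem_comap, hg₂, IsLocalRing.mem_maximalIdeal, mem_nonunits_iff,
        not_not] at hx'
      exact hx'
    obtain ⟨u, rfl⟩ := hu
    have : p₂ - 1 = f (0, ((u⁻¹ : 𝒪[K]ˣ) : 𝒪[K]) * (ϖ - 1)) * f (a, (u : 𝒪[K])) := by
      rw [hp₂, ← map_one f, ← map_sub, ← map_mul]
      congr 1
      refine Prod.ext ?_ ?_
      · change (1 : 𝒪[K]) - 1 = 0 * a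
        rw [sub_self, zero_mul]
      · change ϖ - 1 = ((u⁻¹ : 𝒪[K]ˣ) : 𝒪[K]) * (ϖ - 1) * u
        rw [mul_right_comm, Units.inv_mul, one_mul]
    rw [this]
    exact Ideal.mul_mem_left _ _ hx
  obtain ⟨α, hα, h₁⟩ := hW.exists_isMatrixCoeff hψ hΛ hP₁ hmax₁ hc₁
  obtain ⟨β, hβ, h₂⟩ := hW.exists_isMatrixCoeff hψ hΛ hP₂ hmax₂ hc₂
  -- The first coordinate of p₂^n is 1, so dividing by p₁ leaves the integral ring and p₂^n is a
  -- valid starting point.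
  have hnot : ∀ n : ℕ, ((P₂ ^ n * P₁⁻¹ : Lˣ) : L) ∉ intRing K L := by
    intro n hmem
    have e1 : p₁ * ⟨_, hmem⟩ = p₂ ^ n := by
      refine Subtype.ext ?_
      change (p₁ : L) * ((P₂ ^ n * P₁⁻¹ : Lˣ) : L) = (p₂ : L) ^ n
      rw [← hP₁, ← hP₂, ← Units.val_mul, mul_comm P₁, inv_mul_cancel_right,
        Units.val_pow_eq_pow_val]
    have e2 := congrArg g₁ e1
    rw [map_mul, map_pow, hp₁, hp₂, hg₁, hg₁, one_pow] at e2
    exact (uniformiser_irreducible K).not_isUnit (IsUnit.of_mul_eq_one _ e2)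
  have hnot₂ : ((1 * P₂⁻¹ : Lˣ) : L) ∉ intRing K L := by
    rw [one_mul]
    intro hmem
    refine hmax₂.ne_top (Ideal.span_singleton_eq_top.mpr
      (IsUnit.of_mul_eq_one ⟨_, hmem⟩ (Subtype.ext ?_)))
    change (p₂ : L) * ((P₂⁻¹ : Lˣ) : L) = 1
    rw [← hP₂, Units.mul_inv]
  have key : ∀ n : ℕ, torusValue K W n = α n * β n := by
    intro n
    have hint : ((P₂ ^ n : Lˣ) : L) ∈ intRing K L := by
      rw [Units.val_pow_eq_pow_val, hP₂]
      exact pow_mem p₂.2 n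
    rw [torusValue_eq_diagL, hunit, mul_pow, h₁ _ hint (hnot n), ← one_mul (P₂ ^ n),
      h₂ 1 (one_mem _) hnot₂]
    have : (diagL 1 : GL (Fin 2) L) = 1 := by apply gl_ext <;> simp
    rw [this, hW.normalised, mul_one]
  simp only [key]
  exact hα.mul hβ

/-- The values of the new vector on the torus of `GL₂(K)` are a coefficient of the powers of
a matrix. -/
lemma IsNewVector.isMatrixCoeff_torusValue [Algebra.Etale K L] (hL : Module.finrank K L = 2)
    (hψ : IsUnramifiedChar K ψ) (hΛ : IsWhittaker ψ π Λ) :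
    IsMatrixCoeff fun n : ℕ => torusValue K W n := by
  have hϖ : (uniformiser K : K) ≠ 0 := (uniformiserUnit K).ne_zero
  by_cases hF : IsField L
  · obtain ⟨p, hp0, hmax, hfin, ⟨e, u, he⟩, hc⟩ :
        ∃ p : intRing K L, p ≠ 0 ∧ (Ideal.span {p}).IsMaximal ∧
          Finite (intRing K L ⧸ Ideal.span {p}) ∧
          (∃ (e : ℕ) (u : (intRing K L)ˣ),
            algebraMap 𝒪[K] (intRing K L) (uniformiser K) = p ^ e * u) ∧
          ∀ c : Ideal (intRing K L), c ≤ Ideal.span {p} ∨ c = ⊤ := by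
      let := hF.toField
      have : Algebra.IsSeparable K L := (Algebra.FormallyEtale.iff_isSeparable K L).mp inferInstance
      exact exists_prime_intRing hL
    have hp0' : (p : L) ≠ 0 := fun h => hp0 (Subtype.ext h)
    obtain ⟨q, hq⟩ := hF.mul_inv_cancel hp0'
    exact hW.isMatrixCoeff_of_local hψ hΛ hmax he hc (IsUnit.of_mul_eq_one q hq)
  -- An étale algebra of degree 2 that is not a field is reduced, hence split.
  · have : IsReduced L := Algebra.FormallyUnramified.isReduced_of_field K L
    obtain ⟨Φ⟩ := nonempty_algEquiv_prod hL hF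
    obtain ⟨f⟩ := nonempty_intRing_algEquiv_prod Φ
    exact hW.isMatrixCoeff_of_split hψ hΛ f ((isUnit_iff_ne_zero.mpr hϖ).map (algebraMap K L))

end TorusValues

/-! ### Invariance of the new vector under congruence subgroups of `GL₂(K)` -/

section Restriction

variable {K : Type*} [Field K] [ValuativeRel K] [TopologicalSpace K] [IsNonarchimedeanLocalField K]
variable {L : Type*} [CommRing L] [Algebra K L]
variable {V : Type*} [AddCommGroup V] [Module ℂ V] {π : Representation ℂ (GL (Fin 2) L) V}
variable {Λ : V →ₗ[ℂ] ℂ} {ψ : AddChar L ℂ} {W : GL (Fin 2) L → ℂ}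

lemma inclH_upperRight (x : K) : inclH K L (Matrix.GeneralLinearGroup.upperRightHom x) =
    Matrix.GeneralLinearGroup.upperRightHom (algebraMap K L x) := by
  apply gl_ext <;> simp [inclH]

lemma inclH_scalar (z : Kˣ) : inclH K L (Matrix.GeneralLinearGroup.scalar (Fin 2) z) =
    Matrix.GeneralLinearGroup.scalar (Fin 2) (Units.map (algebraMap K L).toMonoidHom z) := by
  apply gl_ext <;> simp [inclH]

lemma mem_span_uniformiser_pow {a : 𝒪[K]} {r : ℕ} (ha : valuation K (a : K) ≤ unifVal K ^ r) :
    a ∈ Ideal.span {uniformiser K ^ r} := by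
  rw [← Ideal.span_singleton_pow, ← (uniformiser_irreducible K).maximalIdeal_eq]
  obtain ⟨b, hb, hba⟩ := memPow_iff.mpr ha
  rwa [← Subtype.ext hba]

lemma inclH_mem_K1 {𝔞 : Ideal (intRing K L)} {r₀ r : ℕ}
    (h𝔞 : 𝔞.comap (algebraMap 𝒪[K] (intRing K L)) = Ideal.span {uniformiser K ^ r₀})
    (hr : r₀ ≤ r) {k : GL (Fin 2) K} (hk : k ∈ congruenceSet K r) : inclH K L k ∈ K1 K 𝔞 := by
  obtain ⟨k, h10, h11, rfl⟩ := hk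
  have hle : Ideal.span {uniformiser K ^ r} ≤ 𝔞.comap (algebraMap 𝒪[K] (intRing K L)) := by
    rw [h𝔞, Ideal.span_singleton_le_span_singleton]
    exact pow_dvd_pow _ hr
  refine ⟨Matrix.GeneralLinearGroup.map (n := Fin 2) (algebraMap 𝒪[K] (intRing K L)) k,
    hle (mem_span_uniformiser_pow h10), ?_, ?_⟩
  · have := hle (mem_span_uniformiser_pow (a := k 1 1 - 1) h11)
    rw [Ideal.mem_comap, map_sub, map_one] at this
    exact this
  · ext i j
    rfl

end Restriction

end AsaiZeta

end

/-! ### The comparison of the two zeta integrals. -/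

theorem mainTheorem7
    {K : Type*} [Field K] [ValuativeRel K] [TopologicalSpace K] [IsNonarchimedeanLocalField K]
    [MeasurableSpace Kˣ] [BorelSpace Kˣ]
    {L : Type*} [CommRing L] [Algebra K L] [Algebra.Etale K L] (hL : Module.finrank K L = 2)
    [TopologicalSpace L] [IsModuleTopology K L]
    (ψ : AddChar L ℂ) (hψ_cont : Continuous ψ) (hψK : ∀ x : K, ψ (algebraMap K L x) = 1)
    (hψ : IsUnramifiedChar K ψ)
    {V : Type*} [AddCommGroup V] [Module ℂ V] (π : Representation ℂ (GL (Fin 2) L) V)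
    (hπ_irr : π.IsIrreducible) (hπ_smooth : IsSmooth π)
    (Λ : V →ₗ[ℂ] ℂ) (hΛ : IsWhittaker ψ π Λ) (hΛ0 : Λ ≠ 0)
    (W : GL (Fin 2) L → ℂ) (hW : IsNewVector K π Λ W)
    (μ : MeasureTheory.Measure (CosetSpace K)) (hμ : IsUnramifiedInvariant μ)
    (r₀ : ℕ) (hr₀ : (conductorIdeal K π).comap (algebraMap 𝒪[K] (intRing K L)) =
      Ideal.span {uniformiser K ^ r₀}) :
    (∃ R, IsContinuation (resCard K) (PartialConverges K W) (partialIntegral K W) R) ∧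
    ∀ r : ℕ, (r = r₀ ∨ (1 ≤ r₀ ∧ r₀ ≤ r)) →
      (∃ R, IsContinuation (resCard K)
        (AsaiConverges μ W (restrictedCentralChar K π) (specialPhi K r))
        (asaiIntegral μ W (restrictedCentralChar K π) (specialPhi K r)) R) ∧
      imprimitiveAsai K π W = asaiZeta μ W (restrictedCentralChar K π) (specialPhi K r) := by
  have hLn : Nontrivial L := Module.nontrivial_of_finrank_pos (R := K) (by omega)
  have hN : ∀ (x : K) g,
      W (inclH K L (Matrix.GeneralLinearGroup.upperRightHom x) * g) = W g := fun x g => by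
    rw [inclH_upperRight, apply_upperRight hΛ hW.mem.1, hψK, one_mul]
  have hZ : ∀ (z : Kˣ) g, W (inclH K L (Matrix.GeneralLinearGroup.scalar (Fin 2) z) * g) =
      (restrictedCentralChar K π z : ℂ) * W g := fun z g => by
    rw [inclH_scalar, hW.apply_scalar_centralChar hπ_irr hΛ0]
    rfl
  have hK : ∀ r, r₀ ≤ r → ∀ k ∈ congruenceSet K r, ∀ g, W (g * inclH K L k) = W g :=
    fun r hr k hk g => hW.apply_mul_K1 (inclH_mem_K1 hr₀ hr hk) g
  have hneg : ∀ n < 0, torusValue K W n = 0 := fun n hn => hW.torusValue_of_neg hψ hΛ hn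
  -- Matches the case split in the imprimitive L-factor, on ramification of π, with the one in Φ_r:
  -- 𝔠 ∩ 𝒪_K is the whole ring only if 𝔠 contains 1.
  have hunr : IsUnramified K π ↔ r₀ = 0 := by
    rw [hW.isUnramified_iff hπ_irr hΛ0]
    constructor
    · intro h
      rw [h, Ideal.comap_top, eq_comm, Ideal.span_singleton_eq_top] at hr₀
      by_contra h0
      exact (uniformiser_irreducible K).not_isUnit ((isUnit_pow_iff h0).mp hr₀)
    · rintro rfl
      rw [pow_zero, Ideal.span_singleton_one] at hr₀
      exact Ideal.comap_eq_top_iff.mp hr₀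
  obtain ⟨R, hR⟩ := exists_isTorusSum (hW.isMatrixCoeff_torusValue hL hψ hΛ)
  have hpart := hR.partial_isContinuation (hK r₀ le_rfl) hneg
  have hpart' : partialZeta K W = R := hpart.continuation_eq (one_lt_resCard K)
  refine ⟨⟨R, hpart⟩, fun r hr => ?_⟩
  cases r with
  | zero =>
    -- Level 0 is allowed only when r₀ = 0, so Φ_0 is never used for ramified π; likewise a positive
    -- level forces r₀ ≥ 1.
    obtain rfl : r₀ = 0 := by omega
    have h := hR.asai_isContinuation_zero hμ hN hZ (hK 0 le_rfl) hneg hW.normalised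
    refine ⟨⟨_, h⟩, ?_⟩
    rw [imprimitiveAsai, if_pos (hunr.mpr rfl), hpart', asaiZeta,
      h.continuation_eq (one_lt_resCard K)]
  | succ r =>
    have h := hR.asai_isContinuation_succ hμ hN hZ (hK (r + 1) (by omega)) hneg hW.normalised
    refine ⟨⟨_, h⟩, ?_⟩
    rw [imprimitiveAsai, if_neg (fun h => by rw [hunr] at h; omega), hpart', asaiZeta,
      h.continuation_eq (one_lt_resCard K)]
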